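/- Let $R<R'$ be real numbers, $\Omega:=\mathbb R^2\times(R,R')$, and let all fields be complex valued. Write $u\in H(\mathrm{curl};\Omega)$ (respectively $u\in H(\mathrm{div};\Omega)$) if $u\in L^2(\Omega)^3$ has a weak curl in $L^2(\Omega)^3$ (respectively a weak divergence in $L^2(\Omega)$), with $\|u\|_{H(\mathrm{curl};\Omega)}^2=\|u\|_{L^2(\Omega)}^2+\|\nabla\times u\|_{L^2(\Omega)}^2$. The tangential trace $u_T=(u_1,u_2,0)^\top|_{\partial\Omega}$ of $u\in H(\mathrm{curl};\Omega)$ is understood in the weak sense of Green's formula $$\int_\Omega \big((\nabla\times u)\cdot\varphi-u\cdot(\nabla\times\varphi)\big)\,dx=\int_{\partial\Omega}(n\times u_T)\cdot\varphi\,dS\qquad\text{for all }\varphi\in C_0^\infty(\mathbb R^3)^3,$$ where $n=e_3$ on $\mathbb R^2\times\{R'\}$ and $n=-e_3$ on $\mathbb R^2\times\{R\}$. Let $TH^{1/2}(\partial\Omega)$ be the space of tangential fields $g=(g_1,g_2,0)^\top\in H^{1/2}(\partial\Omega)^3$ on the two planes forming $\partial\Omega$, with $$\|g\|_{TH^{1/2}(\partial\Omega)}^2=\sum_{t\in\{R,R'\}}\int_{\mathbb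 R^2}(1+|\xi|^2)^{1/2}\,\big|\mathcal F\big(g(\cdot,t)\big)(\xi)\big|^2\,d\xi ,$$ where $\mathcal F$ is the unitary Fourier transform on $L^2(\mathbb R^2)$ with kernel $\frac1{2\pi}e^{-i\xi\cdot y}$. Then there is a constant $c$, depending only on $R$ and $R'$, such that every $u\in H(\mathrm{curl};\Omega)\cap H(\mathrm{div};\Omega)$ with $u_T\in TH^{1/2}(\partial\Omega)$ belongs to $H^1(\Omega)^3$ and satisfies $$\|u\|_{H^1(\Omega)^3}\le c\,\big(\|u\|_{H(\mathrm{curl};\Omega)}+\|\nabla\cdot u\|_{L^2(\Omega)}+\|u_T\|_{TH^{1/2}(\partial\Omega)}\big).$$ -/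

import Mathlib

open MeasureTheory TopologicalSpace
open scoped Distributions FourierTransform SchwartzMap

noncomputable section

/-- The space `ℝ³` with its Euclidean norm and Lebesgue measure. -/
abbrev E3 := EuclideanSpace ℝ (Fin 3)

/-- The plane `ℝ²` with its Euclidean norm and Lebesgue measure. -/
abbrev E2 := EuclideanSpace ℝ (Fin 2)

/-- The values `ℂ³` of the vector fields. -/
abbrev C3 := EuclideanSpace ℂ (Fin 3)

/-- The values `ℂ²` of the tangential fields on a horizontal plane; the field
`(φ₁, φ₂, 0)` is represented by `(φ₁, φ₂)`. -/
abbrev C2 := EuclideanSpace ℂ (Fin 2)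

/-- The slab `ℝ² × (R, R')`. -/
def slab (R R' : ℝ) : Opens E3 where
  carrier := {x | R < x 2 ∧ x 2 < R'}
  is_open' := by
    have h : Continuous fun x : E3 => x 2 := by fun_prop
    exact (isOpen_lt continuous_const h).inter (isOpen_lt h continuous_const)

/-- The point `(y₁, y₂, t)` of the horizontal plane at height `t`. -/
def atHeight (t : ℝ) (y : E2) : E3 := !₂[y 0, y 1, t]

/-- The norm of `L²(Ω)`. -/
def l2Norm {F : Type*} [NormedAddCommGroup F] (Ω : Opens E3) (f : E3 → F) : ℝ :=
  (eLpNorm f 2 (volume.restrict (Ω : Set E3))).toReal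

/-- `f ∈ L²(Ω)`. -/
def MemL2 {F : Type*} [NormedAddCommGroup F] (Ω : Opens E3) (f : E3 → F) : Prop :=
  MemLp f 2 (volume.restrict (Ω : Set E3))

/-- The classical partial derivative `∂ᵢ φ` of a scalar function. -/
def partialD (i : Fin 3) (φ : E3 → ℝ) (x : E3) : ℝ :=
  fderiv ℝ φ x (EuclideanSpace.single i 1)

/-- The classical curl, `(curl φ)ᵢ = ∂ᵢ₊₁ φᵢ₊₂ - ∂ᵢ₊₂ φᵢ₊₁` with indices modulo `3`. -/
def classicalCurl (φ : E3 → E3) (x : E3) : E3 :=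
  WithLp.toLp 2 fun i =>
    partialD (i + 1) (fun y => φ y (i + 2)) x - partialD (i + 2) (fun y => φ y (i + 1)) x

/-- The bilinear product `a · b = ∑ᵢ aᵢ bᵢ` of a complex and a real vector. -/
def dot3 (a : C3) (b : E3) : ℂ := ∑ i, a i * (b i : ℂ)

/-- `w` is the weak curl of `u` in `Ω`: `∫_Ω w · φ = ∫_Ω u · curl φ` for all test fields `φ`. -/
def IsWeakCurl (Ω : Opens E3) (u w : E3 → C3) : Prop :=
  ∀ φ : 𝓓(Ω, E3), ∫ x in (Ω : Set E3), dot3 (w x) (φ x) =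
    ∫ x in (Ω : Set E3), dot3 (u x) (classicalCurl φ x)

/-- `d` is the weak divergence of `u` in `Ω`: `∫_Ω d φ = - ∫_Ω u · ∇φ` for all test
functions `φ`. -/
def IsWeakDiv (Ω : Opens E3) (u : E3 → C3) (d : E3 → ℂ) : Prop :=
  ∀ φ : 𝓓(Ω, ℝ), ∫ x in (Ω : Set E3), d x * (φ x : ℂ) =
    - ∫ x in (Ω : Set E3), ∑ i, u x i * (partialD i φ x : ℂ)

/-- `v` is the weak partial derivative `∂ⱼ u` in `Ω` (componentwise). -/
def IsWeakPartial (Ω : Opens E3) (j : Fin 3) (u v : E3 → C3) : Prop :=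
  ∀ φ : 𝓓(Ω, ℝ), ∫ x in (Ω : Set E3), φ x • v x =
    - ∫ x in (Ω : Set E3), partialD j φ x • u x

/-- `u ∈ H(curl; Ω)`. -/
def MemHcurl (Ω : Opens E3) (u : E3 → C3) : Prop :=
  MemL2 Ω u ∧ ∃ w, MemL2 Ω w ∧ IsWeakCurl Ω u w

/-- `u ∈ H(div; Ω)`. -/
def MemHdiv (Ω : Opens E3) (u : E3 → C3) : Prop :=
  MemL2 Ω u ∧ ∃ d, MemL2 Ω d ∧ IsWeakDiv Ω u d

/-- `u ∈ H¹(Ω)³`. -/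
def MemH1 (Ω : Opens E3) (u : E3 → C3) : Prop :=
  MemL2 Ω u ∧ ∀ j, ∃ v, MemL2 Ω v ∧ IsWeakPartial Ω j u v

open Classical in
/-- The weak curl in `L²(Ω)³` (unique almost everywhere in `Ω`; `0` if there is none). -/
def weakCurl (Ω : Opens E3) (u : E3 → C3) : E3 → C3 :=
  if h : ∃ w, MemL2 Ω w ∧ IsWeakCurl Ω u w then h.choose else 0

open Classical in
/-- The weak divergence in `L²(Ω)` (unique almost everywhere in `Ω`; `0` if there is none). -/
def weakDiv (Ω : Opens E3) (u : E3 → C3) : E3 → ℂ :=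
  if h : ∃ d, MemL2 Ω d ∧ IsWeakDiv Ω u d then h.choose else 0

open Classical in
/-- The weak derivative `∂ⱼ u` in `L²(Ω)³` (unique almost everywhere in `Ω`; `0` if there is
none). -/
def weakPartial (Ω : Opens E3) (j : Fin 3) (u : E3 → C3) : E3 → C3 :=
  if h : ∃ v, MemL2 Ω v ∧ IsWeakPartial Ω j u v then h.choose else 0

/-- `‖u‖²_{H(curl)} = ‖u‖² + ‖curl u‖²`. -/
def hcurlNorm (Ω : Opens E3) (u : E3 → C3) : ℝ :=
  √(l2Norm Ω u ^ 2 + l2Norm Ω (weakCurl Ω u) ^ 2)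

/-- `‖u‖²_{H¹} = ‖u‖² + ∑ⱼ ‖∂ⱼ u‖²`. -/
def h1Norm (Ω : Opens E3) (u : E3 → C3) : ℝ :=
  √(l2Norm Ω u ^ 2 + ∑ j, l2Norm Ω (weakPartial Ω j u) ^ 2)

/-- The tangential trace `u_T = (u₁, u₂)` of `u ∈ H(curl; ℝ² × (R, R'))` is a priori only a
distribution on the boundary, defined by Green's formula
`∫_Ω (curl u · φ - u · curl φ) = ∫_∂Ω (n × u_T) · φ` for smooth compactly supported fields `φ`
on `ℝ³`. This says that it is given by the function `g` on `ℝ² × {R}` and by the function `g'`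
on `ℝ² × {R'}`, where the outward normal `n` is `-e₃` and `e₃`, respectively. -/
def HasTangentialTrace (R R' : ℝ) (u : E3 → C3) (g g' : Lp C2 2 (volume : Measure E2)) : Prop :=
  ∀ φ : 𝓓((⊤ : Opens E3), E3),
    ∫ x in (slab R R' : Set E3),
        (dot3 (weakCurl (slab R R') u x) (φ x) - dot3 (u x) (classicalCurl φ x)) =
      (∫ y : E2, (g' y 0 * (φ (atHeight R' y) 1 : ℂ) - g' y 1 * (φ (atHeight R' y) 0 : ℂ))) -
      ∫ y : E2, (g y 0 * (φ (atHeight R y) 1 : ℂ) - g y 1 * (φ (atHeight R y) 0 : ℂ))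

/-- `g ∈ H^{1/2}(ℝ²)²`. -/
def MemTHHalf (g : Lp C2 2 (volume : Measure E2)) : Prop :=
  TemperedDistribution.MemSobolev (1 / 2) 2 (g : 𝓢'(E2, C2))

/-- The square of the norm of `H^{1/2}(ℝ²)²`, that is `∫ (1 + |ξ|²)^{1/2} |ĝ(ξ)|² dξ` for the
unitary Fourier transform with kernel `(2π)⁻¹ exp(-i ξ·y)`; here `ξ = 2πη` because the kernel of
`𝓕` is `exp(-2πi η·y)`. -/
def thHalfNormSq (g : Lp C2 2 (volume : Measure E2)) : ℝ :=
  ∫ η : E2, √(1 + (2 * Real.pi * ‖η‖) ^ 2) * ‖(𝓕 g : Lp C2 2 (volume : Measure E2)) η‖ ^ 2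

/-- The norm of `TH^{1/2}(∂Ω)` for the two boundary planes of the slab. -/
def thHalfNorm (g g' : Lp C2 2 (volume : Measure E2)) : ℝ :=
  √(thHalfNormSq g + thHalfNormSq g')

end

/-! For smooth fields, integration by parts gives ‖∇u‖² = ‖curl u‖² + ‖div u‖² up to boundary terms.
In a slab, separation of variables turns this into algebra. In the plane the Fourier transform is
taken; in the height, u₁ and u₂ are expanded in sines and u₃ in cosines of frequency k = πn/(R' -
R), n ∈ ℤ. The first two curl equations are tested with cosines, whose values at the ends bring in
the boundary data cos(k(R' - R)) g' - g. The third curl equation and the divergence equation are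
tested with sines: these vanish at the ends, so the unknown normal trace of u never appears.

For every n and almost every ξ this yields four linear equations for one mode a = (a₀, a₁, a₂), and
by `mode_identity` the squares of their data add up to (|ξ|² + k²)|a|². Multiplying by |ξ|²/(|ξ|² +
k²) bounds |ξ|²|a|². The curl and the divergence then carry a multiplier at most 1 and are summed
over n by Parseval. The boundary data have a bound independent of n and are summed by means of ∑ₙ
|ξ|²/(|ξ|² + k²) ≤ C (1 + |ξ|²)^{1/2} (`tsum_slabFreq_multiplier_le`); this is exactly the weight of
H^{1/2}. The result is `SlabSystem.tsum_mode_le`.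

Thus the horizontal derivatives are square integrable mode by mode. They are reassembled into weak
derivatives on the slab by `exists_weak_planeDeriv` and `exists_weak_slabDeriv`, the latter using
the adjoint of the isometric mode expansion. The sine series of u₁ and u₂ must not be differentiated
in the height, because these components need not vanish on the boundary. Instead
`SlabSystem.exists_vertical_deriv` solves the curl and divergence equations for the three vertical
derivatives. -/

/-! ### Coordinates and measure on the slab. -/

/-- The coordinates `(y, t) ↦ (y₁, y₂, t)` of `ℝ³`. -/
noncomputable def planeHeight : (E2 × ℝ) ≃L[ℝ] E3 :=
  LinearEquiv.toContinuousLinearEquiv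
    { toFun := fun p => atHeight p.2 p.1
      invFun := fun x => (!₂[x 0, x 1], x 2)
      map_add' := by
        intro p q; ext i; fin_cases i <;> simp [atHeight]
      map_smul' := by
        intro c p; ext i; fin_cases i <;> simp [atHeight]
      left_inv := by
        intro p
        refine Prod.ext ?_ ?_
        · ext i; fin_cases i <;> simp [atHeight]
        · simp [atHeight]
      right_inv := by
        intro x; ext i; fin_cases i <;> simp [atHeight] }

lemma planeHeight_apply (p : E2 × ℝ) : planeHeight p = atHeight p.2 p.1 := rfl

@[simp] lemma planeHeight_apply_zero (p : E2 × ℝ) : planeHeight p 0 = p.1 0 := by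
  simp [planeHeight_apply, atHeight]

@[simp] lemma planeHeight_apply_one (p : E2 × ℝ) : planeHeight p 1 = p.1 1 := by
  simp [planeHeight_apply, atHeight]

@[simp] lemma planeHeight_apply_two (p : E2 × ℝ) : planeHeight p 2 = p.2 := by
  simp [planeHeight_apply, atHeight]

lemma measurableEmbedding_planeHeight : MeasurableEmbedding planeHeight :=
  planeHeight.toHomeomorph.measurableEmbedding

lemma measurePreserving_planeHeight :
    MeasurePreserving planeHeight ((volume : Measure E2).prod (volume : Measure ℝ)) volume := by
  have h1 := (volume_preserving_piFinSuccAbove (fun _ : Fin 3 => ℝ) (Fin.last 2)).symm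
  have h2 : MeasurePreserving (Prod.swap : (Fin 2 → ℝ) × ℝ → ℝ × (Fin 2 → ℝ))
    (volume.prod volume) (volume.prod volume) := Measure.measurePreserving_swap
  have h3 : MeasurePreserving (Prod.map (WithLp.ofLp : E2 → Fin 2 → ℝ) (id : ℝ → ℝ))
      (volume.prod volume) (volume.prod volume) :=
    (PiLp.volume_preserving_ofLp (Fin 2)).prod (MeasurePreserving.id volume)
  have h4 := (PiLp.volume_preserving_toLp (Fin 3)).comp (h1.comp (h2.comp h3))
  have h5 : ⇑planeHeight = WithLp.toLp 2 ∘
      ⇑(MeasurableEquiv.piFinSuccAbove (fun _ : Fin 3 => ℝ) (Fin.last 2)).symm ∘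
        Prod.swap ∘ Prod.map WithLp.ofLp id := by
    funext p
    ext i
    fin_cases i
    all_goals first | (simp; done) | (simp; rfl)
  rw [h5]
  exact h4

/-- The measure of the slab `ℝ² × (R, R')` in the coordinates `(y, t)`. -/
noncomputable def slabMeasure (R R' : ℝ) : Measure (E2 × ℝ) :=
  (volume : Measure E2).prod (volume.restrict (Set.Ioo R R'))

lemma slabMeasure_eq_restrict (R R' : ℝ) :
    slabMeasure R R' = ((volume : Measure E2).prod (volume : Measure ℝ)).restrict
      (planeHeight ⁻¹' (slab R R' : Set E3)) := by
  have : planeHeight ⁻¹' (slab R R' : Set E3) = Set.univ ×ˢ Set.Ioo R R' := by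
    ext p
    change R < planeHeight p 2 ∧ planeHeight p 2 < R' ↔ _
    simp
  rw [this, slabMeasure, ← Measure.prod_restrict, Measure.restrict_univ]

lemma measurePreserving_slab (R R' : ℝ) :
    MeasurePreserving planeHeight (slabMeasure R R')
      (volume.restrict (slab R R' : Set E3)) := by
  rw [slabMeasure_eq_restrict]
  exact measurePreserving_planeHeight.restrict_preimage (slab R R').isOpen.measurableSet

lemma measurePreserving_slab_symm (R R' : ℝ) :
    MeasurePreserving planeHeight.symm (volume.restrict (slab R R' : Set E3))
      (slabMeasure R R') :=
  MeasurePreserving.symm planeHeight.toHomeomorph.toMeasurableEquiv (measurePreserving_slab R R')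

lemma setIntegral_slab {F : Type*} [NormedAddCommGroup F] [NormedSpace ℝ F] (R R' : ℝ)
    (f : E3 → F) :
    ∫ x in (slab R R' : Set E3), f x = ∫ p, f (planeHeight p) ∂slabMeasure R R' :=
  ((measurePreserving_slab R R').integral_comp measurableEmbedding_planeHeight f).symm

/-! ### Parseval's identity for sines and cosines on an interval. -/

/-- The frequency `k = π n / (R' - R)` of the `n`-th trigonometric function on `(R, R')`. -/
noncomputable def slabFreq (R R' : ℝ) (n : ℤ) : ℝ := Real.pi * n / (R' - R)

/-- The functions `sin (k (t - R))`. -/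
noncomputable def slabSin (R R' : ℝ) (n : ℤ) (t : ℝ) : ℝ := Real.sin (slabFreq R R' n * (t - R))

/-- The functions `cos (k (t - R))`. -/
noncomputable def slabCos (R R' : ℝ) (n : ℤ) (t : ℝ) : ℝ := Real.cos (slabFreq R R' n * (t - R))

/-- Reflection at `R` is the even extension for `ε = 1` and the odd one for `ε = -1`. On the doubled
interval, of length `2 * (R' - R)`, the exponentials of frequency `slabFreq` form the usual Fourier
system. -/
lemma memLp_reflection {R R' : ℝ} (ε : ℂ) {f : ℝ → ℂ}
    (hf : MemLp f 2 (volume.restrict (Set.Ioo R R'))) :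
    MemLp (fun t => if R < t then f t else ε * f (2 * R - t)) 2
      (volume.restrict (Set.Ioc (2 * R - R') R')) := by
  have hpre : (fun t : ℝ => 2 * R - t) ⁻¹' Set.Ioo R R' = Set.Ioo (2 * R - R') R := by
    ext t; simp only [Set.mem_preimage, Set.mem_Ioo]; constructor <;> rintro ⟨h1, h2⟩ <;>
      constructor <;> linarith
  have hmp := (Measure.measurePreserving_sub_left (volume : Measure ℝ) (2 * R)).restrict_preimage
    (measurableSet_Ioo (a := R) (b := R'))
  rw [hpre] at hmp
  have h2 : MemLp (fun t => ε * f (2 * R - t)) 2 (volume.restrict (Set.Ioc (2 * R - R') R)) := by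
    rw [← restrict_Ioo_eq_restrict_Ioc]
    exact (hf.comp_measurePreserving hmp).const_mul ε
  have h1 : MemLp f 2 (volume.restrict (Set.Ioc R R')) := by
    rwa [← restrict_Ioo_eq_restrict_Ioc]
  refine MemLp.piecewise (s := Set.Ioi R) measurableSet_Ioi ?_ ?_
  · rw [Measure.restrict_restrict measurableSet_Ioi]
    have hsub : Set.Ioi R ∩ Set.Ioc (2 * R - R') R' ⊆ Set.Ioc R R' := fun x hx => ⟨hx.1, hx.2.2⟩
    exact h1.mono_measure (Measure.restrict_mono hsub le_rfl)
  · rw [Measure.restrict_restrict measurableSet_Ioi.compl]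
    have hsub : (Set.Ioi R)ᶜ ∩ Set.Ioc (2 * R - R') R' ⊆ Set.Ioc (2 * R - R') R :=
      fun x hx => ⟨hx.2.1, not_lt.mp hx.1⟩
    exact h2.mono_measure (Measure.restrict_mono hsub le_rfl)

/-- The substitution t ↦ 2R - t folds the left half onto (R, R') and conjugates the exponential
there. The constant phase e^{-ikR}, caused by measuring t from `R`, disappears in the norm. -/
lemma fourierCoeffOn_reflection {R R' : ℝ} (h : R < R') (h' : 2 * R - R' < R') (ε : ℂ) {f : ℝ → ℂ}
    (hf : MemLp f 2 (volume.restrict (Set.Ioo R R'))) (n : ℤ) :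
    ‖fourierCoeffOn h' (fun t => if R < t then f t else ε * f (2 * R - t)) n‖ =
      (2 * (R' - R))⁻¹ * ‖∫ t in Set.Ioo R R',
        (Complex.exp (-(slabFreq R R' n * (t - R) : ℝ) * Complex.I) +
          ε * Complex.exp ((slabFreq R R' n * (t - R) : ℝ) * Complex.I)) * f t‖ := by
  set F : ℝ → ℂ := fun t => if R < t then f t else ε * f (2 * R - t) with hF
  set E : ℝ → ℂ := fun t => Complex.exp (-(slabFreq R R' n * (t - R) : ℝ) * Complex.I) with hE
  have hL : (R' - R : ℂ) ≠ 0 := by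
    rw [← Complex.ofReal_sub]; exact_mod_cast (sub_pos.mpr h).ne'
  have hEc : Continuous E := by fun_prop
  have hEb : ∀ t, ‖E t‖ ≤ 1 := by
    intro t
    rw [hE]
    simp only
    rw [← Complex.ofReal_neg, Complex.norm_exp_ofReal_mul_I]
  have hFint : IntegrableOn F (Set.Ioc (2 * R - R') R') :=
    (memLp_reflection ε hf).integrable (by norm_num)
  have hfint : IntegrableOn f (Set.Ioo R R') := hf.integrable (by norm_num)
  have hEF : IntegrableOn (fun t => E t * F t) (Set.Ioc (2 * R - R') R') :=
    hFint.bdd_mul hEc.aestronglyMeasurable (Filter.Eventually.of_forall hEb)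
  have hphase : ∀ x : ℝ, (fourier (-n) (x : AddCircle (R' - (2 * R - R')))) • F x =
      Complex.exp ((-(slabFreq R R' n * R) : ℝ) * Complex.I) * (E x * F x) := by
    intro x
    rw [fourier_coe_apply, smul_eq_mul, ← mul_assoc, hE]
    simp only
    rw [← Complex.exp_add]
    congr 2
    simp only [slabFreq]
    push_cast
    have : (R' - (2 * R - R') : ℂ) ≠ 0 := by
      rw [show (R' - (2 * R - R') : ℂ) = 2 * (R' - R) by ring]
      exact mul_ne_zero two_ne_zero hL
    field_simp
    ring
  have hEint : ∫ t in Set.Ioo R R', E t * f t = ∫ t in R..R', E t * f t := by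
    rw [intervalIntegral.integral_of_le h.le, integral_Ioc_eq_integral_Ioo]
  have hmain : ∫ x in (2 * R - R')..R', E x * F x =
      ∫ t in Set.Ioo R R', (E t + ε * Complex.exp ((slabFreq R R' n * (t - R) : ℝ) * Complex.I))
        * f t := by
    have hi1 : IntervalIntegrable (fun t => E t * F t) volume (2 * R - R') R :=
      (intervalIntegrable_iff_integrableOn_Ioc_of_le (by linarith)).mpr
        (hEF.mono_set (Set.Ioc_subset_Ioc le_rfl h.le))
    have hi2 : IntervalIntegrable (fun t => E t * F t) volume R R' :=
      (intervalIntegrable_iff_integrableOn_Ioc_of_le h.le).mpr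
        (hEF.mono_set (Set.Ioc_subset_Ioc (by linarith) le_rfl))
    rw [← intervalIntegral.integral_add_adjacent_intervals hi1 hi2]
    have e1 : ∫ x in (2 * R - R')..R, E x * F x =
        ∫ t in Set.Ioo R R', ε * Complex.exp ((slabFreq R R' n * (t - R) : ℝ) * Complex.I) * f t := by
      have := intervalIntegral.integral_comp_sub_left (a := 2 * R - R') (b := R)
        (fun t => ε * Complex.exp ((slabFreq R R' n * (t - R) : ℝ) * Complex.I) * f t) (2 * R)
      rw [show 2 * R - R = R by ring, show 2 * R - (2 * R - R') = R' by ring,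
        intervalIntegral.integral_of_le h.le, integral_Ioc_eq_integral_Ioo] at this
      rw [← this, intervalIntegral.integral_of_le (by linarith),
        intervalIntegral.integral_of_le (by linarith)]
      refine setIntegral_congr_fun measurableSet_Ioc fun t ht => ?_
      simp only [hF, hE, if_neg (not_lt.mpr ht.2)]
      rw [show -((slabFreq R R' n * (t - R) : ℝ) : ℂ) =
        ((slabFreq R R' n * (2 * R - t - R) : ℝ) : ℂ) by push_cast; ring]
      ring
    have e2 : ∫ x in R..R', E x * F x = ∫ t in Set.Ioo R R', E t * f t := by
      rw [intervalIntegral.integral_of_le h.le, integral_Ioc_eq_integral_Ioo]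
      refine setIntegral_congr_fun measurableSet_Ioo fun t ht => ?_
      simp only [hF, if_pos ht.1]
    rw [e1, e2, ← integral_add]
    · refine integral_congr_ae (Filter.Eventually.of_forall fun t => ?_)
      simp only
      ring
    · refine hfint.bdd_mul (c := ‖ε‖) (by fun_prop) (Filter.Eventually.of_forall fun t => ?_)
      rw [norm_mul, Complex.norm_exp_ofReal_mul_I, mul_one]
    · exact hfint.bdd_mul hEc.aestronglyMeasurable (Filter.Eventually.of_forall hEb)
  rw [fourierCoeffOn_eq_integral]
  simp_rw [hphase]
  rw [intervalIntegral.integral_const_mul, hmain, norm_smul, norm_mul,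
    Complex.norm_exp_ofReal_mul_I, one_mul, Real.norm_of_nonneg]
  · congr 1
    rw [one_div]; congr 1; ring
  · exact one_div_nonneg.mpr (by linarith)

/-- With L = R' - R, the extension has squared norm 2∫|f|², the average in Parseval's formula
contributes (2L)⁻¹, and removing the normalization of the coefficients contributes (2L)²; the
product is 4L. -/
lemma hasSum_sq_reflection {R R' : ℝ} (h : R < R') {ε : ℂ} (hε : ‖ε‖ = 1) {f : ℝ → ℂ}
    (hf : MemLp f 2 (volume.restrict (Set.Ioo R R'))) :
    HasSum (fun n : ℤ => ‖∫ t in Set.Ioo R R',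
        (Complex.exp (-(slabFreq R R' n * (t - R) : ℝ) * Complex.I) +
          ε * Complex.exp ((slabFreq R R' n * (t - R) : ℝ) * Complex.I)) * f t‖ ^ 2)
      (4 * (R' - R) * ∫ t in Set.Ioo R R', ‖f t‖ ^ 2) := by
  have h' : 2 * R - R' < R' := by linarith
  have hL : R' - R ≠ 0 := (sub_pos.mpr h).ne'
  have hsum := (hasSum_sq_fourierCoeffOn h' (memLp_reflection ε hf)).mul_left
    ((2 * (R' - R)) ^ 2)
  simp_rw [fourierCoeffOn_reflection h h' ε hf, mul_pow] at hsum
  have hF2 : IntegrableOn (fun t => ‖if R < t then f t else ε * f (2 * R - t)‖ ^ 2)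
      (Set.Ioc (2 * R - R') R') := (memLp_reflection ε hf).integrable_norm_pow (by norm_num)
  have hval : ∫ t in (2 * R - R')..R', ‖if R < t then f t else ε * f (2 * R - t)‖ ^ 2 =
      2 * ∫ t in Set.Ioo R R', ‖f t‖ ^ 2 := by
    rw [← intervalIntegral.integral_add_adjacent_intervals (b := R)]
    · have e1 : ∫ t in (2 * R - R')..R, ‖if R < t then f t else ε * f (2 * R - t)‖ ^ 2 =
          ∫ t in Set.Ioo R R', ‖f t‖ ^ 2 := by
        have := intervalIntegral.integral_comp_sub_left (a := 2 * R - R') (b := R)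
          (fun t => ‖f t‖ ^ 2) (2 * R)
        rw [show 2 * R - R = R by ring, show 2 * R - (2 * R - R') = R' by ring,
          intervalIntegral.integral_of_le h.le, integral_Ioc_eq_integral_Ioo] at this
        rw [← this, intervalIntegral.integral_of_le (by linarith),
          intervalIntegral.integral_of_le (by linarith)]
        refine setIntegral_congr_fun measurableSet_Ioc fun t ht => ?_
        simp only [if_neg (not_lt.mpr ht.2), norm_mul, hε, one_mul]
      have e2 : ∫ t in R..R', ‖if R < t then f t else ε * f (2 * R - t)‖ ^ 2 =
          ∫ t in Set.Ioo R R', ‖f t‖ ^ 2 := by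
        rw [intervalIntegral.integral_of_le h.le, integral_Ioc_eq_integral_Ioo]
        refine setIntegral_congr_fun measurableSet_Ioo fun t ht => ?_
        simp only [if_pos ht.1]
      rw [e1, e2]; ring
    · exact (intervalIntegrable_iff_integrableOn_Ioc_of_le (by linarith)).mpr
        (hF2.mono_set (Set.Ioc_subset_Ioc le_rfl h.le))
    · exact (intervalIntegrable_iff_integrableOn_Ioc_of_le h.le).mpr
        (hF2.mono_set (Set.Ioc_subset_Ioc (by linarith) le_rfl))
  rw [hval] at hsum
  have e : 2 ^ 2 * (R' - R) ^ 2 * ((R' - (2 * R - R'))⁻¹ • (2 * ∫ t in Set.Ioo R R', ‖f t‖ ^ 2)) =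
      4 * (R' - R) * ∫ t in Set.Ioo R R', ‖f t‖ ^ 2 := by
    rw [show R' - (2 * R - R') = 2 * (R' - R) by ring, smul_eq_mul]
    field_simp
    ring
  rw [e] at hsum
  refine hsum.congr_fun ?_
  intro n
  rw [← mul_pow, ← mul_assoc, ← mul_pow, mul_inv_cancel₀ (mul_ne_zero two_ne_zero hL), one_pow,
    one_mul]

/-- For ε = 1 the two exponentials add up to twice the cosine, hence the division by 4. Since n runs
through ℤ, each nonzero frequency is counted twice, and no separate normalization of n = 0 is
needed. -/
lemma hasSum_sq_slabCos {R R' : ℝ} (h : R < R') {f : ℝ → ℂ}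
    (hf : MemLp f 2 (volume.restrict (Set.Ioo R R'))) :
    HasSum (fun n : ℤ => ‖∫ t in Set.Ioo R R', (slabCos R R' n t : ℂ) * f t‖ ^ 2)
      ((R' - R) * ∫ t in Set.Ioo R R', ‖f t‖ ^ 2) := by
  have := (hasSum_sq_reflection h (ε := 1) (by simp) hf).mul_left (1 / 4)
  convert! this using 1
  · funext n
    have : ∀ t : ℝ, (Complex.exp (-(slabFreq R R' n * (t - R) : ℝ) * Complex.I) +
          1 * Complex.exp ((slabFreq R R' n * (t - R) : ℝ) * Complex.I)) * f t
          = 2 * ((slabCos R R' n t : ℂ) * f t) := by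
      intro t
      rw [slabCos, Complex.ofReal_cos, Complex.cos]
      ring
    simp_rw [this, integral_const_mul, norm_mul]
    norm_num
    ring
  · ring

/-- For ε = -1 the two exponentials combine to -2i times the sine. -/
lemma hasSum_sq_slabSin {R R' : ℝ} (h : R < R') {f : ℝ → ℂ}
    (hf : MemLp f 2 (volume.restrict (Set.Ioo R R'))) :
    HasSum (fun n : ℤ => ‖∫ t in Set.Ioo R R', (slabSin R R' n t : ℂ) * f t‖ ^ 2)
      ((R' - R) * ∫ t in Set.Ioo R R', ‖f t‖ ^ 2) := by
  have := (hasSum_sq_reflection h (ε := -1) (by simp) hf).mul_left (1 / 4)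
  convert! this using 1
  · funext n
    have : ∀ t : ℝ, (Complex.exp (-(slabFreq R R' n * (t - R) : ℝ) * Complex.I) +
          -1 * Complex.exp ((slabFreq R R' n * (t - R) : ℝ) * Complex.I)) * f t
          = (-2 * Complex.I) * ((slabSin R R' n t : ℂ) * f t) := by
      intro t
      rw [slabSin, Complex.ofReal_sin, Complex.sin]
      ring_nf
      rw [Complex.I_sq]; ring
    simp_rw [this, integral_const_mul, norm_mul]
    norm_num
    ring
  · ring

/-! ### Divergence equations on the plane and their Fourier transforms. -/

open scoped ContDiff LineDeriv

/-- The partial derivatives of a function on the plane. -/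
noncomputable def planeDeriv {F : Type*} [NormedAddCommGroup F] [NormedSpace ℝ F]
    (i : Fin 2) (ψ : E2 → F) (y : E2) : F :=
  fderiv ℝ ψ y (EuclideanSpace.single i 1)

/-- The integrand of the weak form of `b = ∂₁ a₀ + ∂₂ a₁`. -/
noncomputable def planePairing (a₀ a₁ b ψ : E2 → ℂ) (y : E2) : ℂ :=
  b y * ψ y + (a₀ y * planeDeriv 0 ψ y + a₁ y * planeDeriv 1 ψ y)

/-- `b = ∂₁ a₀ + ∂₂ a₁` in the sense of distributions on the plane. -/
def IsPlaneDiv (a₀ a₁ b : E2 → ℂ) : Prop :=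
  ∀ ψ : E2 → ℝ, ContDiff ℝ ∞ ψ → HasCompactSupport ψ →
    ∫ y, planePairing a₀ a₁ b (fun z => (ψ z : ℂ)) y = 0

section Fourier

lemma integral_fourier_smul_Lp {F : Type*} [NormedAddCommGroup F] [InnerProductSpace ℂ F]
    [CompleteSpace F] (f : Lp F 2 (volume : Measure E2)) (χ : 𝓢(E2, ℂ)) :
    ∫ y, (𝓕 χ) y • f y = ∫ η, χ η • (𝓕 f : Lp F 2 (volume : Measure E2)) η := by
  have h := congrArg (fun T : 𝓢'(E2, F) => T χ) (Lp.fourier_toTemperedDistribution_eq f)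
  simpa using h

lemma Lp_ext_schwartz {F : Type*} [NormedAddCommGroup F] [NormedSpace ℂ F]
    [CompleteSpace F] {f g : Lp F 2 (volume : Measure E2)}
    (h : ∀ χ : 𝓢(E2, ℂ), ∫ y, χ y • f y = ∫ y, χ y • g y) : f = g := by
  have hinj := LinearMap.ker_eq_bot.mp
    (Lp.ker_toTemperedDistributionCLM_eq_bot (F := F) (μ := (volume : Measure E2)) (p := 2))
  apply hinj
  ext χ
  simpa using h χ

lemma memLp_schwartz_smul_integrable {F : Type*} [NormedAddCommGroup F] [NormedSpace ℂ F]
    (χ : 𝓢(E2, ℂ)) {f : E2 → F} (hf : MemLp f 2 volume) : Integrable fun y => χ y • f y :=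
  memLp_one_iff_integrable.mp (hf.smul (χ.memLp 2))

/-- For coordinate projections this links the vector-valued transform in `thHalfNormSq` to the
scalar transforms in the mode equations. -/
lemma fourier_compLp (T : C2 →L[ℂ] ℂ) (g : Lp C2 2 (volume : Measure E2)) :
    (𝓕 (T.compLp g) : Lp ℂ 2 (volume : Measure E2)) =
      T.compLp (𝓕 g : Lp C2 2 (volume : Measure E2)) := by
  refine Lp_ext_schwartz fun χ => ?_
  have key : ∀ (χ : 𝓢(E2, ℂ)) (h : Lp C2 2 (volume : Measure E2)),
      ∫ y, χ y • (T.compLp h) y = T (∫ y, χ y • h y) := by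
    intro χ h
    rw [← T.integral_comp_comm (memLp_schwartz_smul_integrable χ (Lp.memLp h))]
    refine integral_congr_ae ?_
    filter_upwards [T.coeFn_compLp h] with y hy
    rw [hy, map_smul]
  rw [← integral_fourier_smul_Lp, key, key, integral_fourier_smul_Lp]

end Fourier

section Cutoff

lemma planePairing_integrable {a₀ a₁ b : E2 → ℂ} (h₀ : MemLp a₀ 2 volume)
    (h₁ : MemLp a₁ 2 volume) (hb : MemLp b 2 volume) (ψ : 𝓢(E2, ℂ)) :
    Integrable (planePairing a₀ a₁ b ψ) := by
  have e : planePairing a₀ a₁ b ψ = fun y => ψ y • b y +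
      ((∂_{(EuclideanSpace.single 0 1 : E2)} ψ) y • a₀ y +
        (∂_{(EuclideanSpace.single 1 1 : E2)} ψ) y • a₁ y) := by
    funext y
    simp only [planePairing, planeDeriv, SchwartzMap.lineDerivOp_apply_eq_fderiv, smul_eq_mul]
    ring
  rw [e]
  exact (memLp_schwartz_smul_integrable _ hb).add
    ((memLp_schwartz_smul_integrable _ h₀).add (memLp_schwartz_smul_integrable _ h₁))

/-- A compactly supported smooth real function as a complex Schwartz function. -/
noncomputable def schwartzOfReal (ψ : E2 → ℝ) (h : ContDiff ℝ ∞ ψ) (hc : HasCompactSupport ψ) :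
    𝓢(E2, ℂ) :=
  have h₁ : HasCompactSupport fun y => (ψ y : ℂ) :=
    hc.comp_left (g := fun r : ℝ => (r : ℂ)) Complex.ofReal_zero
  have h₂ : ContDiff ℝ ∞ fun y => (ψ y : ℂ) := Complex.ofRealCLM.contDiff.comp h
  h₁.toSchwartzMap h₂

@[simp] lemma schwartzOfReal_apply (ψ : E2 → ℝ) (h : ContDiff ℝ ∞ ψ) (hc : HasCompactSupport ψ)
    (y : E2) : schwartzOfReal ψ h hc y = ψ y := rfl

lemma planeDeriv_ofReal_add {p q : E2 → ℝ} (hp : ContDiff ℝ ∞ p) (hq : ContDiff ℝ ∞ q)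
    (i : Fin 2) (y : E2) :
    planeDeriv i (fun z => (p z : ℂ) + (q z : ℂ) * Complex.I) y =
      planeDeriv i (fun z => (p z : ℂ)) y + planeDeriv i (fun z => (q z : ℂ)) y * Complex.I := by
  have h1 : DifferentiableAt ℝ (fun z => (p z : ℂ)) y :=
    (Complex.ofRealCLM.contDiff.comp hp).differentiable (by simp) y
  have h2 : DifferentiableAt ℝ (fun z => (q z : ℂ)) y :=
    (Complex.ofRealCLM.contDiff.comp hq).differentiable (by simp) y
  unfold planeDeriv
  rw [fderiv_fun_add h1 (h2.mul_const _), fderiv_mul_const h2]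
  simp [mul_comm]

lemma IsPlaneDiv.complex {a₀ a₁ b : E2 → ℂ} (h₀ : MemLp a₀ 2 volume)
    (h₁ : MemLp a₁ 2 volume) (hb : MemLp b 2 volume) (h : IsPlaneDiv a₀ a₁ b) {ψ : E2 → ℂ}
    (hψ : ContDiff ℝ ∞ ψ) (hc : HasCompactSupport ψ) :
    ∫ y, planePairing a₀ a₁ b ψ y = 0 := by
  have hp : ContDiff ℝ ∞ fun z => (ψ z).re := Complex.reCLM.contDiff.comp hψ
  have hq : ContDiff ℝ ∞ fun z => (ψ z).im := Complex.imCLM.contDiff.comp hψ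
  have hpc : HasCompactSupport fun z => (ψ z).re := hc.comp_left (g := Complex.re) rfl
  have hqc : HasCompactSupport fun z => (ψ z).im := hc.comp_left (g := Complex.im) rfl
  have e : ∀ y, planePairing a₀ a₁ b ψ y =
      planePairing a₀ a₁ b (fun z => ((ψ z).re : ℂ)) y +
        planePairing a₀ a₁ b (fun z => ((ψ z).im : ℂ)) y * Complex.I := by
    intro y
    have hd : ∀ i, planeDeriv i ψ y = planeDeriv i (fun z => ((ψ z).re : ℂ)) y +
        planeDeriv i (fun z => ((ψ z).im : ℂ)) y * Complex.I := by
      intro i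
      rw [← planeDeriv_ofReal_add hp hq]
      simp [Complex.re_add_im]
    unfold planePairing
    rw [hd, hd]
    nth_rw 1 [← Complex.re_add_im (ψ y)]
    ring
  have i₁ : Integrable (planePairing a₀ a₁ b fun z => ((ψ z).re : ℂ)) :=
    planePairing_integrable h₀ h₁ hb (schwartzOfReal _ hp hpc)
  have i₂ : Integrable (planePairing a₀ a₁ b fun z => ((ψ z).im : ℂ)) :=
    planePairing_integrable h₀ h₁ hb (schwartzOfReal _ hq hqc)
  simp_rw [e]
  rw [integral_add i₁ (i₂.mul_const _),
    integral_mul_const, h _ hp hpc, h _ hq hqc]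
  simp

lemma exists_cutoff : ∃ θ : E2 → ℝ, ContDiff ℝ ∞ θ ∧ HasCompactSupport θ ∧
    (∀ y, ‖y‖ ≤ 1 → θ y = 1) ∧ (∀ y, |θ y| ≤ 1) ∧
      ∃ C, ∀ y, ‖fderiv ℝ θ y‖ ≤ C := by
  let f : ContDiffBump (0 : E2) := ⟨1, 2, by norm_num, by norm_num⟩
  refine ⟨f, f.contDiff, f.hasCompactSupport, fun y hy => f.one_of_mem_closedBall (by simpa using hy), 
    fun y => abs_le.mpr ⟨by linarith [f.nonneg' y], f.le_one⟩, ?_⟩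
  exact (f.contDiff.continuous_fderiv (n := ∞) (by simp)).bounded_above_of_compact_support
    (f.hasCompactSupport.fderiv (𝕜 := ℝ))

/-- Schwartz test functions are needed because the Fourier transform of a test function is not
compactly supported. With the cutoffs θ(εy), ε → 0, the product rule leaves an extra term
ε(∂ᵢθ)(εy)ψ(y), which is dominated by a multiple of |ψ| and tends to 0, so dominated convergence
applies. -/
lemma IsPlaneDiv.schwartz {a₀ a₁ b : E2 → ℂ} (h₀ : MemLp a₀ 2 volume)
    (h₁ : MemLp a₁ 2 volume) (hb : MemLp b 2 volume) (h : IsPlaneDiv a₀ a₁ b) (ψ : 𝓢(E2, ℂ)) :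
    ∫ y, planePairing a₀ a₁ b ψ y = 0 := by
  obtain ⟨θ, hθ, hθc, hθ1, hθb, C, hC⟩ := exists_cutoff
  have hC0 : 0 ≤ C := (norm_nonneg _).trans (hC 0)
  set ε : ℕ → ℝ := fun N => ((N : ℝ) + 1)⁻¹ with hε
  have hεpos : ∀ N, 0 < ε N := fun N => by positivity
  have hεle : ∀ N, ε N ≤ 1 := fun N => inv_le_one_of_one_le₀ (by simp)
  have hεlim : Filter.Tendsto ε Filter.atTop (nhds 0) := by
    simpa [hε] using tendsto_one_div_add_atTop_nhds_zero_nat (𝕜 := ℝ)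
  set Θ : ℕ → E2 → ℝ := fun N y => θ (ε N • y) with hΘ
  have hΘs : ∀ N, ContDiff ℝ ∞ (Θ N) := fun N => hθ.comp (by fun_prop)
  have hΘc : ∀ N, HasCompactSupport (Θ N) := fun N =>
    hθc.comp_smul (hεpos N).ne'
  have hΘd : ∀ N i y, planeDeriv i (Θ N) y = ε N * planeDeriv i θ (ε N • y) := by
    intro N i y
    unfold planeDeriv
    rw [hΘ]
    simp only
    rw [fderiv_comp_smul]
    simp
  have hdb : ∀ i y, |planeDeriv i θ y| ≤ C := by
    intro i y
    refine ((fderiv ℝ θ y).le_opNorm _).trans ?_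
    simpa using hC y
  have hprod : ∀ N i y, planeDeriv i (fun z => (Θ N z : ℂ) * ψ z) y =
      (Θ N y : ℂ) * planeDeriv i ψ y + (ε N * planeDeriv i θ (ε N • y) : ℝ) * ψ y := by
    intro N i y
    have e1 : DifferentiableAt ℝ (fun z => (Θ N z : ℂ)) y :=
      (Complex.ofRealCLM.contDiff.comp (hΘs N)).differentiable (by simp) y
    have e2 : DifferentiableAt ℝ ψ y := ψ.differentiableAt
    have e3 : fderiv ℝ (fun z => (Θ N z : ℂ)) y =
        Complex.ofRealCLM.comp (fderiv ℝ (Θ N) y) :=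
      (Complex.ofRealCLM.hasFDerivAt.comp y
        (((hΘs N).differentiable (by simp)) y).hasFDerivAt).fderiv
    rw [← hΘd]
    unfold planeDeriv
    rw [fderiv_fun_mul e1 e2, e3]
    simp [mul_comm]
  have hz : ∀ N, ∫ y, planePairing a₀ a₁ b (fun z => (Θ N z : ℂ) * ψ z) y = 0 := fun N =>
    h.complex h₀ h₁ hb ((Complex.ofRealCLM.contDiff.comp (hΘs N)).mul (ψ.smooth ⊤))
      (HasCompactSupport.mul_right ((hΘc N).comp_left (g := fun r : ℝ => (r : ℂ)) rfl))
  have hΘ1 : ∀ y, Filter.Tendsto (fun N => (Θ N y : ℂ)) Filter.atTop (nhds 1) := by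
    intro y
    have : Filter.Tendsto (fun N => ‖ε N • y‖) Filter.atTop (nhds 0) := by
      have := (hεlim.smul_const y).norm
      simpa using this
    refine tendsto_const_nhds.congr' ?_
    filter_upwards [this.eventually (ge_mem_nhds zero_lt_one)] with N hN
    simp only [hΘ]
    rw [hθ1 _ hN, Complex.ofReal_one]
  have hd0 : ∀ i y, Filter.Tendsto
      (fun N => ((ε N * planeDeriv i θ (ε N • y) : ℝ) : ℂ)) Filter.atTop (nhds 0) := by
    intro i y
    have : Filter.Tendsto (fun N => ε N * planeDeriv i θ (ε N • y)) Filter.atTop (nhds 0) :=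
      hεlim.zero_mul_isBoundedUnder_le
        (Filter.isBoundedUnder_of ⟨C, fun N => hdb i _⟩)
    have h0 := (Complex.continuous_ofReal.tendsto 0).comp this
    rw [Complex.ofReal_zero] at h0
    exact h0
  have hlim := tendsto_integral_of_dominated_convergence (μ := (volume : Measure E2))
    (F := fun N => planePairing a₀ a₁ b (fun z => (Θ N z : ℂ) * ψ z))
    (f := planePairing a₀ a₁ b ψ)
    (fun y => ‖ψ y • b y‖ + ((‖(∂_{(EuclideanSpace.single 0 1 : E2)} ψ) y • a₀ y‖ +
      C * ‖ψ y • a₀ y‖) + (‖(∂_{(EuclideanSpace.single 1 1 : E2)} ψ) y • a₁ y‖ +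
      C * ‖ψ y • a₁ y‖))) ?_ ?_ ?_ ?_
  · simp_rw [hz] at hlim
    exact tendsto_nhds_unique hlim tendsto_const_nhds
  · intro N
    have hs : ContDiff ℝ ∞ fun z => (Θ N z : ℂ) * ψ z :=
      (Complex.ofRealCLM.contDiff.comp (hΘs N)).mul (ψ.smooth ⊤)
    have hcs : HasCompactSupport fun z => (Θ N z : ℂ) * ψ z :=
      HasCompactSupport.mul_right ((hΘc N).comp_left (g := fun r : ℝ => (r : ℂ)) rfl)
    exact (planePairing_integrable h₀ h₁ hb (hcs.toSchwartzMap hs)).aestronglyMeasurable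
  · exact ((memLp_schwartz_smul_integrable _ hb).norm).add
      (((memLp_schwartz_smul_integrable _ h₀).norm.add
        ((memLp_schwartz_smul_integrable _ h₀).norm.const_mul _)).add
      ((memLp_schwartz_smul_integrable _ h₁).norm.add
        ((memLp_schwartz_smul_integrable _ h₁).norm.const_mul _)))
  · intro N
    refine Filter.Eventually.of_forall fun y => ?_
    have hΘn : ‖(Θ N y : ℂ)‖ ≤ 1 := by
      rw [Complex.norm_real]; exact hθb _
    have hdn : ∀ i, ‖((ε N * planeDeriv i θ (ε N • y) : ℝ) : ℂ)‖ ≤ C := by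
      intro i
      rw [Complex.norm_real, norm_mul, Real.norm_of_nonneg (hεpos N).le]
      exact (mul_le_mul (hεle N) (hdb i _) (abs_nonneg _) zero_le_one).trans (one_mul C).le
    have hterm : ∀ (i : Fin 2) (a : ℂ), ‖a * planeDeriv i (fun z => (Θ N z : ℂ) * ψ z) y‖ ≤
        ‖(∂_{(EuclideanSpace.single i 1 : E2)} ψ) y • a‖ + C * ‖ψ y • a‖ := by
      intro i a
      rw [hprod, SchwartzMap.lineDerivOp_apply_eq_fderiv]
      change _ ≤ ‖planeDeriv i ψ y • a‖ + _
      rw [mul_add]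
      refine (norm_add_le _ _).trans (add_le_add ?_ ?_)
      · rw [norm_mul, norm_mul, norm_smul, mul_comm ‖planeDeriv i ψ y‖]
        exact mul_le_mul_of_nonneg_left (mul_le_of_le_one_left (norm_nonneg _) hΘn) (norm_nonneg _)
      · rw [norm_mul, norm_mul, norm_smul]
        calc _ = ‖((ε N * planeDeriv i θ (ε N • y) : ℝ) : ℂ)‖ * (‖ψ y‖ * ‖a‖) := by ring
          _ ≤ _ := mul_le_mul_of_nonneg_right (hdn i) (by positivity)
    unfold planePairing
    refine (norm_add_le _ _).trans (add_le_add ?_ ((norm_add_le _ _).trans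
      (add_le_add (hterm 0 _) (hterm 1 _))))
    rw [norm_mul, norm_mul, norm_smul, mul_comm]
    exact mul_le_mul_of_nonneg_right (mul_le_of_le_one_left (norm_nonneg _) hΘn) (norm_nonneg _)
  · refine Filter.Eventually.of_forall fun y => ?_
    have hterm : ∀ (i : Fin 2), Filter.Tendsto
        (fun N => planeDeriv i (fun z => (Θ N z : ℂ) * ψ z) y) Filter.atTop
        (nhds (planeDeriv i ψ y)) := by
      intro i
      simp_rw [hprod]
      simpa using ((hΘ1 y).mul_const (planeDeriv i ψ y)).add ((hd0 i y).mul_const (ψ y))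
    unfold planePairing
    refine Filter.Tendsto.add ?_ (((hterm 0).const_mul _).add ((hterm 1).const_mul _))
    simpa using ((hΘ1 y).mul_const (ψ y)).const_mul (b y)

end Cutoff

/-- The Fourier symbol `2πi (η₀ a₀ + η₁ a₁)` of `∂₁ a₀ + ∂₂ a₁`. -/
noncomputable def planeSymbol (a₀ a₁ : E2 → ℂ) (η : E2) : ℂ :=
  2 * Real.pi * Complex.I * (η 0 * a₀ η + η 1 * a₁ η)

lemma inner_single_hasTemperateGrowth (i : Fin 2) :
    Function.HasTemperateGrowth fun x : E2 => inner ℝ x (EuclideanSpace.single i (1 : ℝ)) := by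
  fun_prop

/-- The derivative of 𝓕χ is the transform of -2πi ηᵢ χ, and the duality ∫ a 𝓕χ = ∫ χ 𝓕a moves the
transform onto `a`; so `a` itself is never differentiated. -/
lemma integral_mul_lineDeriv_fourier (a : Lp ℂ 2 (volume : Measure E2)) (i : Fin 2)
    (χ : 𝓢(E2, ℂ)) :
    Integrable (fun η => χ η * ((η i : ℂ) * (𝓕 a : Lp ℂ 2 (volume : Measure E2)) η)) ∧
    ∫ y, a y * planeDeriv i (𝓕 χ : 𝓢(E2, ℂ)) y =
      -(2 * Real.pi * Complex.I) *
        ∫ η, χ η * ((η i : ℂ) * (𝓕 a : Lp ℂ 2 (volume : Measure E2)) η) := by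
  set m : E2 := EuclideanSpace.single i (1 : ℝ) with hm
  set κ : 𝓢(E2, ℂ) := SchwartzMap.smulLeftCLM ℂ (fun x : E2 => inner ℝ x m) χ with hκ
  have hκv : ∀ η, κ η = (η i : ℂ) * χ η := by
    intro η
    rw [hκ, SchwartzMap.smulLeftCLM_apply_apply (inner_single_hasTemperateGrowth i)]
    simp [EuclideanSpace.inner_single_right]
  have h1 : ∀ y, a y * planeDeriv i (𝓕 χ : 𝓢(E2, ℂ)) y =
      -(2 * Real.pi * Complex.I) * ((𝓕 κ) y • a y) := by
    intro y
    have : planeDeriv i (𝓕 χ : 𝓢(E2, ℂ)) y = (∂_{m} (𝓕 χ)) y := by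
      rw [SchwartzMap.lineDerivOp_apply_eq_fderiv]; rfl
    rw [this, SchwartzMap.lineDerivOp_fourier_eq, FourierTransform.fourier_smul]
    simp only [smul_apply, smul_eq_mul, ← hκ]
    ring
  have h2 : ∀ η, κ η • (𝓕 a : Lp ℂ 2 (volume : Measure E2)) η =
      χ η * ((η i : ℂ) * (𝓕 a : Lp ℂ 2 (volume : Measure E2)) η) := by
    intro η
    rw [hκv, smul_eq_mul]; ring
  refine ⟨?_, ?_⟩
  · have := memLp_schwartz_smul_integrable κ (Lp.memLp (𝓕 a : Lp ℂ 2 (volume : Measure E2)))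
    simpa only [h2] using this
  · simp_rw [h1]
    rw [integral_const_mul, integral_fourier_smul_Lp]
    simp_rw [h2]

lemma integral_planePairing_fourier (a₀ a₁ b : Lp ℂ 2 (volume : Measure E2)) (χ : 𝓢(E2, ℂ)) :
    ∫ y, planePairing a₀ a₁ b (𝓕 χ : 𝓢(E2, ℂ)) y =
      ∫ η, χ η * ((𝓕 b : Lp ℂ 2 (volume : Measure E2)) η -
        planeSymbol (𝓕 a₀ : Lp ℂ 2 (volume : Measure E2))
          (𝓕 a₁ : Lp ℂ 2 (volume : Measure E2)) η) := by
  have hd : ∀ (a : Lp ℂ 2 (volume : Measure E2)) (i : Fin 2),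
      Integrable fun y => a y * planeDeriv i (𝓕 χ : 𝓢(E2, ℂ)) y := by
    intro a i
    have := memLp_schwartz_smul_integrable (∂_{(EuclideanSpace.single i 1 : E2)} (𝓕 χ))
      (Lp.memLp a)
    refine this.congr (Filter.Eventually.of_forall fun y => ?_)
    simp only [SchwartzMap.lineDerivOp_apply_eq_fderiv, smul_eq_mul]
    rw [mul_comm]; rfl
  have hb : Integrable fun y => b y * (𝓕 χ : 𝓢(E2, ℂ)) y := by
    refine (memLp_schwartz_smul_integrable (𝓕 χ) (Lp.memLp b)).congr
      (Filter.Eventually.of_forall fun y => ?_)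
    simp only [smul_eq_mul]; rw [mul_comm]
  have hb' := memLp_schwartz_smul_integrable χ (Lp.memLp (𝓕 b : Lp ℂ 2 (volume : Measure E2)))
  have hbi : ∫ y, b y * (𝓕 χ : 𝓢(E2, ℂ)) y = ∫ η, χ η • (𝓕 b : Lp ℂ 2 (volume : Measure E2)) η := by
    rw [← integral_fourier_smul_Lp]
    refine integral_congr_ae (Filter.Eventually.of_forall fun y => ?_)
    simp only [smul_eq_mul]; rw [mul_comm]
  obtain ⟨i0, e0⟩ := integral_mul_lineDeriv_fourier a₀ 0 χ
  obtain ⟨i1, e1⟩ := integral_mul_lineDeriv_fourier a₁ 1 χ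
  unfold planePairing
  have hd' : Integrable fun y => a₀ y * planeDeriv 0 (𝓕 χ : 𝓢(E2, ℂ)) y +
      a₁ y * planeDeriv 1 (𝓕 χ : 𝓢(E2, ℂ)) y := (hd a₀ 0).add (hd a₁ 1)
  have hs : Integrable fun η => -(2 * Real.pi * Complex.I) *
      (χ η * ((η 0 : ℂ) * (𝓕 a₀ : Lp ℂ 2 (volume : Measure E2)) η) +
        χ η * ((η 1 : ℂ) * (𝓕 a₁ : Lp ℂ 2 (volume : Measure E2)) η)) :=
    (i0.add i1).const_mul _
  rw [integral_add hb hd', integral_add (hd a₀ 0) (hd a₁ 1), e0, e1, hbi, ← mul_add,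
    ← integral_add i0 i1, ← integral_const_mul,
    ← integral_add hb' hs]
  refine integral_congr_ae (Filter.Eventually.of_forall fun η => ?_)
  simp only [planeSymbol, smul_eq_mul]
  ring

lemma memLp_locallyIntegrable {f : E2 → ℂ} (hf : MemLp f 2 volume) :
    LocallyIntegrable f volume := hf.locallyIntegrable (by norm_num)

lemma LocallyIntegrable.coord_mul {f : E2 → ℂ} (hf : LocallyIntegrable f volume) (i : Fin 2) :
    LocallyIntegrable (fun η => (η i : ℂ) * f η) volume := by
  have hc : Continuous fun η : E2 => (η i : ℂ) := by fun_prop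
  simpa only [smul_eq_mul, mul_comm] using hf.smul_continuous hc

/-- The weak equation `b = ∂₁ a₀ + ∂₂ a₁` on the Fourier side. -/
lemma IsPlaneDiv.fourier {a₀ a₁ b : Lp ℂ 2 (volume : Measure E2)} (h : IsPlaneDiv a₀ a₁ b) :
    ∀ᵐ η, (𝓕 b : Lp ℂ 2 (volume : Measure E2)) η =
        planeSymbol (𝓕 a₀ : Lp ℂ 2 (volume : Measure E2))
          (𝓕 a₁ : Lp ℂ 2 (volume : Measure E2)) η := by
  -- The symbol grows linearly, so the difference is known only to be locally integrable; that
  -- suffices for the fundamental lemma of the calculus of variations.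
  have hl : LocallyIntegrable (fun η => (𝓕 b : Lp ℂ 2 (volume : Measure E2)) η -
      planeSymbol (𝓕 a₀ : Lp ℂ 2 (volume : Measure E2))
        (𝓕 a₁ : Lp ℂ 2 (volume : Measure E2)) η) volume := by
    refine (memLp_locallyIntegrable (Lp.memLp _)).sub ?_
    refine LocallyIntegrable.smul (c := (2 * Real.pi * Complex.I : ℂ)) ?_
    exact (LocallyIntegrable.coord_mul (memLp_locallyIntegrable (Lp.memLp _)) 0).add
      (LocallyIntegrable.coord_mul (memLp_locallyIntegrable (Lp.memLp _)) 1)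
  have := ae_eq_zero_of_integral_contDiff_smul_eq_zero hl ?_
  · filter_upwards [this] with η hη
    exact sub_eq_zero.mp hη
  · intro χ hχ hχc
    have h1 := integral_planePairing_fourier a₀ a₁ b (schwartzOfReal χ hχ hχc)
    rw [h.schwartz (Lp.memLp _) (Lp.memLp _) (Lp.memLp _)] at h1
    simpa using h1.symm

lemma isPlaneDiv_of_fourier {a₀ a₁ b : Lp ℂ 2 (volume : Measure E2)}
    (h : ∀ᵐ η, (𝓕 b : Lp ℂ 2 (volume : Measure E2)) η =
        planeSymbol (𝓕 a₀ : Lp ℂ 2 (volume : Measure E2))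
          (𝓕 a₁ : Lp ℂ 2 (volume : Measure E2)) η) : IsPlaneDiv a₀ a₁ b := by
  intro ψ hψ hc
  -- Every test function is the transform of a Schwartz function, so the pairing formula can be read
  -- backwards.
  have h1 := integral_planePairing_fourier a₀ a₁ b (𝓕⁻ (schwartzOfReal ψ hψ hc))
  rw [FourierTransform.fourier_fourierInv_eq] at h1
  refine h1.trans ?_
  rw [← integral_zero E2 ℂ]
  refine integral_congr_ae ?_
  filter_upwards [h] with η hη
  rw [hη, sub_self, mul_zero]

/-- Membership in the Sobolev space supplies an L² function equal to (1 + |η|²)^{1/4} ĝ. The weight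
of the norm is expressed in ξ = 2πη and exceeds (1 + |η|²)^{1/2} by at most the factor 2π.
Integrability matters because the integral in `thHalfNormSq` would otherwise have the default value
0. -/
lemma integrable_thHalf {g : Lp C2 2 (volume : Measure E2)} (hg : MemTHHalf g) :
    Integrable fun η : E2 => √(1 + (2 * Real.pi * ‖η‖) ^ 2) *
      ‖(𝓕 g : Lp C2 2 (volume : Measure E2)) η‖ ^ 2 := by
  obtain ⟨f, hf⟩ := TemperedDistribution.memSobolev_iff_exists_smulLeftCLM_fourier.mp hg
  rw [Lp.fourier_toTemperedDistribution_eq] at hf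
  set G := (𝓕 g : Lp C2 2 (volume : Measure E2)) with hG
  set w : E2 → ℝ := fun x => (1 + ‖x‖ ^ 2) ^ ((1 / 2 : ℝ) / 2) with hw
  have hwt : Function.HasTemperateGrowth fun x : E2 => ((w x : ℝ) : ℂ) := by
    rw [hw]; fun_prop
  have hwc : Continuous w := by
    have := Complex.continuous_re.comp hwt.1.continuous
    exact this
  have hae : ∀ᵐ η, f η = w η • G η := by
    refine ae_eq_of_integral_contDiff_smul_eq ((Lp.memLp f).locallyIntegrable (by norm_num))
      (((Lp.memLp G).locallyIntegrable (by norm_num)).continuous_smul hwc) ?_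
    intro χ hχ hχc
    have h1 := congrArg (fun T : 𝓢'(E2, C2) => T (schwartzOfReal χ hχ hχc)) hf
    simp only [TemperedDistribution.smulLeftCLM_apply_apply, Lp.toTemperedDistribution_apply] at h1
    calc ∫ x, χ x • f x = ∫ x, (schwartzOfReal χ hχ hχc) x • f x := by
          simp
      _ = _ := h1.symm
      _ = _ := by
          refine integral_congr_ae (Filter.Eventually.of_forall fun x => ?_)
          simp only
          rw [SchwartzMap.smulLeftCLM_apply_apply hwt]
          simp only [schwartzOfReal_apply, smul_eq_mul, mul_smul, Complex.coe_smul]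
          rw [smul_comm]
  have hdom : Integrable fun η => 2 * Real.pi * ‖f η‖ ^ 2 :=
    ((Lp.memLp f).integrable_norm_pow (by norm_num)).const_mul _
  refine hdom.mono' ?_ ?_
  · exact (Continuous.aestronglyMeasurable (by fun_prop)).mul
      ((Lp.aestronglyMeasurable G).norm.pow 2)
  · filter_upwards [hae] with η hη
    rw [Real.norm_of_nonneg (by positivity), hη, norm_smul, mul_pow ‖w η‖, ← mul_assoc]
    refine mul_le_mul_of_nonneg_right ?_ (by positivity)
    have e1 : ‖w η‖ ^ 2 = √(1 + ‖η‖ ^ 2) := by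
      rw [Real.norm_of_nonneg (by positivity), hw, Real.sqrt_eq_rpow]
      simp only
      rw [← Real.rpow_natCast, ← Real.rpow_mul (by positivity)]
      norm_num
    rw [e1]
    have hpi : 1 ≤ (2 * Real.pi) ^ 2 := by nlinarith [Real.pi_gt_three]
    calc √(1 + (2 * Real.pi * ‖η‖) ^ 2) ≤ √((2 * Real.pi) ^ 2 * (1 + ‖η‖ ^ 2)) := by
          apply Real.sqrt_le_sqrt; nlinarith
      _ = _ := by rw [Real.sqrt_mul (by positivity), Real.sqrt_sq (by positivity)]

/-! ### Squared L² norms with values in [0, ∞]. -/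

open scoped ENNReal

/-- The square of the norm of `L²(μ)`, possibly infinite. -/
noncomputable def l2Sq {α F : Type*} [MeasurableSpace α] [NormedAddCommGroup F] (μ : Measure α)
    (f : α → F) : ℝ≥0∞ :=
  ∫⁻ x, ‖f x‖ₑ ^ 2 ∂μ

section L2

variable {α F : Type*} [MeasurableSpace α] [NormedAddCommGroup F] {μ : Measure α}

lemma l2Sq_eq_eLpNorm_sq (f : α → F) : l2Sq μ f = eLpNorm f 2 μ ^ 2 := by
  have := eLpNorm_nnreal_pow_eq_lintegral (f := f) (μ := μ) (p := 2) two_ne_zero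
  simp only [NNReal.coe_ofNat, ENNReal.rpow_ofNat, ENNReal.coe_ofNat] at this
  rw [l2Sq, this]

lemma MemLp.l2Sq_lt_top {f : α → F} (hf : MemLp f 2 μ) : l2Sq μ f < ⊤ := by
  rw [l2Sq_eq_eLpNorm_sq]
  exact ENNReal.pow_lt_top hf.eLpNorm_lt_top

lemma memLp_of_l2Sq_lt_top {f : α → F} (hm : AEStronglyMeasurable f μ) (h : l2Sq μ f < ⊤) :
    MemLp f 2 μ := by
  refine ⟨hm, ?_⟩
  rw [l2Sq_eq_eLpNorm_sq] at h
  exact (ENNReal.pow_lt_top_iff.mp h).resolve_right (by norm_num)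

lemma l2Sq_congr_ae {f g : α → F} (h : f =ᵐ[μ] g) : l2Sq μ f = l2Sq μ g := by
  refine lintegral_congr_ae ?_
  filter_upwards [h] with x hx
  rw [hx]

lemma norm_toLp_sq {f : α → F} (hf : MemLp f 2 μ) : ‖hf.toLp f‖ ^ 2 = (l2Sq μ f).toReal := by
  rw [Lp.norm_toLp, l2Sq_eq_eLpNorm_sq, ENNReal.toReal_pow]

lemma Lp_norm_sq (f : Lp F 2 μ) : ‖f‖ ^ 2 = (l2Sq μ f).toReal := by
  rw [Lp.norm_def, l2Sq_eq_eLpNorm_sq, ENNReal.toReal_pow]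

lemma l2Sq_eq_ofReal {f : α → F} (hf : MemLp f 2 μ) :
    l2Sq μ f = ENNReal.ofReal (∫ x, ‖f x‖ ^ 2 ∂μ) := by
  rw [ofReal_integral_eq_lintegral_ofReal (hf.integrable_norm_pow (by norm_num))
    (Filter.Eventually.of_forall fun x => by positivity)]
  refine lintegral_congr fun x => ?_
  rw [ENNReal.ofReal_pow (norm_nonneg _), ofReal_norm]

end L2

/-! ### Expansion of functions on the slab into vertical modes. -/

/-- Families of functions on `(R, R')` for which Parseval's identity holds, up to the factor
`R' - R`. -/
structure IsParsevalFamily (R R' : ℝ) (e : ℤ → ℝ → ℝ) : Prop where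
  continuous : ∀ n, Continuous (e n)
  abs_le_one : ∀ n t, |e n t| ≤ 1
  hasSum : ∀ f : ℝ → ℂ, MemLp f 2 (volume.restrict (Set.Ioo R R')) →
    HasSum (fun n => ‖∫ t in Set.Ioo R R', (e n t : ℂ) * f t‖ ^ 2)
      ((R' - R) * ∫ t in Set.Ioo R R', ‖f t‖ ^ 2)

lemma isParsevalFamily_slabCos {R R' : ℝ} (h : R < R') : IsParsevalFamily R R' (slabCos R R') where
  continuous n := by unfold slabCos; fun_prop
  abs_le_one n t := Real.abs_cos_le_one _
  hasSum f hf := hasSum_sq_slabCos h hf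

lemma isParsevalFamily_slabSin {R R' : ℝ} (h : R < R') : IsParsevalFamily R R' (slabSin R R') where
  continuous n := by unfold slabSin; fun_prop
  abs_le_one n t := Real.abs_sin_le_one _
  hasSum f hf := hasSum_sq_slabSin h hf

/-- The coefficient `∫ e(t) f(y, t) dt` of a function on the slab. -/
noncomputable def slabCoeff (R R' : ℝ) (e : ℝ → ℝ) (f : E2 × ℝ → ℂ) (y : E2) : ℂ :=
  ∫ t in Set.Ioo R R', (e t : ℂ) * f (y, t)

section Coeff

variable {R R' : ℝ} {e : ℤ → ℝ → ℝ} {f g : E2 × ℝ → ℂ}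

lemma memLp_slice (hf : MemLp f 2 (slabMeasure R R')) :
    ∀ᵐ y : E2, MemLp (fun t => f (y, t)) 2 (volume.restrict (Set.Ioo R R')) := by
  have h1 : Integrable (fun p => ‖f p‖ ^ 2) (slabMeasure R R') :=
    hf.integrable_norm_pow (by norm_num)
  have h2 := hf.aestronglyMeasurable
  unfold slabMeasure at h1 h2
  filter_upwards [h1.prod_right_ae, h2.prodMk_left] with y hy hy2
  exact (memLp_two_iff_integrable_sq_norm hy2).mpr hy

lemma slice_integrable (he : IsParsevalFamily R R' e) (n : ℤ) {q : ℝ → ℂ}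
    (hq : MemLp q 2 (volume.restrict (Set.Ioo R R'))) :
    Integrable (fun t => (e n t : ℂ) * q t) (volume.restrict (Set.Ioo R R')) := by
  refine (hq.integrable (by norm_num)).bdd_mul (c := 1) ?_
    (Filter.Eventually.of_forall fun t => ?_)
  · exact (Complex.continuous_ofReal.comp (he.continuous n)).aestronglyMeasurable
  · rw [Complex.norm_real]; exact he.abs_le_one n t

lemma aestronglyMeasurable_slabCoeff (he : IsParsevalFamily R R' e) (n : ℤ)
    (hf : AEStronglyMeasurable f (slabMeasure R R')) :
    AEStronglyMeasurable (slabCoeff R R' (e n) f) volume := by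
  have hc : Continuous fun p : E2 × ℝ => (e n p.2 : ℂ) :=
    Complex.continuous_ofReal.comp ((he.continuous n).comp continuous_snd)
  exact (hc.aestronglyMeasurable.mul hf).integral_prod_right'

/-- Parseval holds on almost every vertical line; integration over the plane and Tonelli give the
identity on the slab. -/
lemma tsum_l2Sq_slabCoeff (hR : R < R') (he : IsParsevalFamily R R' e)
    (hf : MemLp f 2 (slabMeasure R R')) :
    ∑' n, l2Sq volume (slabCoeff R R' (e n) f) =
      ENNReal.ofReal (R' - R) * l2Sq (slabMeasure R R') f := by
  have hm := hf.aestronglyMeasurable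
  unfold l2Sq
  rw [← lintegral_tsum]
  · rw [slabMeasure] at hm ⊢
    rw [lintegral_prod _ (hm.enorm.pow_const 2), ← lintegral_const_mul'' _
      (hm.enorm.pow_const 2).lintegral_prod_right']
    refine lintegral_congr_ae ?_
    filter_upwards [memLp_slice hf] with y hy
    have h1 := he.hasSum _ hy
    change _ = _ * l2Sq _ (fun t => f (y, t))
    rw [l2Sq_eq_ofReal hy, ← ENNReal.ofReal_mul (by linarith), ← h1.tsum_eq,
      ENNReal.ofReal_tsum_of_nonneg (fun n => by positivity) h1.summable]
    refine tsum_congr fun n => ?_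
    rw [ENNReal.ofReal_pow (norm_nonneg _), ofReal_norm]
    rfl
  · intro n
    exact (aestronglyMeasurable_slabCoeff he n hm).enorm.pow_const 2

lemma memLp_slabCoeff (hR : R < R') (he : IsParsevalFamily R R' e) (n : ℤ)
    (hf : MemLp f 2 (slabMeasure R R')) : MemLp (slabCoeff R R' (e n) f) 2 volume := by
  refine memLp_of_l2Sq_lt_top (aestronglyMeasurable_slabCoeff he n hf.aestronglyMeasurable) ?_
  refine (ENNReal.le_tsum (f := fun n => l2Sq volume (slabCoeff R R' (e n) f)) n).trans_lt ?_
  rw [tsum_l2Sq_slabCoeff hR he hf]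
  exact ENNReal.mul_lt_top ENNReal.ofReal_lt_top (MemLp.l2Sq_lt_top hf)

lemma slabCoeff_congr_ae (φ : ℝ → ℝ) (h : f =ᵐ[slabMeasure R R'] g) :
    slabCoeff R R' φ f =ᵐ[volume] slabCoeff R R' φ g := by
  unfold slabMeasure at h
  filter_upwards [Measure.ae_ae_of_ae_prod h] with y hy
  refine integral_congr_ae ?_
  filter_upwards [hy] with t ht
  rw [ht]

lemma slabCoeff_add (he : IsParsevalFamily R R' e) (n : ℤ)
    (hf : MemLp f 2 (slabMeasure R R')) (hg : MemLp g 2 (slabMeasure R R')) :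
    slabCoeff R R' (e n) (f + g) =ᵐ[volume]
      slabCoeff R R' (e n) f + slabCoeff R R' (e n) g := by
  filter_upwards [memLp_slice hf, memLp_slice hg] with y h1 h2
  simp only [slabCoeff, Pi.add_apply, mul_add]
  exact integral_add (slice_integrable he n h1) (slice_integrable he n h2)

lemma slabCoeff_smul (φ : ℝ → ℝ) (c : ℂ) :
    slabCoeff R R' φ (c • f) = c • slabCoeff R R' φ f := by
  funext y
  simp only [slabCoeff, Pi.smul_apply, smul_eq_mul, ← integral_const_mul]
  congr 1; funext t; ring

/-- The coefficient of a square integrable function as an element of `L²(ℝ²)`. -/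
noncomputable def slabCoeffLp (hR : R < R') (he : IsParsevalFamily R R' e) (n : ℤ)
    (f : Lp ℂ 2 (slabMeasure R R')) : Lp ℂ 2 (volume : Measure E2) :=
  (memLp_slabCoeff hR he n (Lp.memLp f)).toLp _

lemma coeFn_slabCoeffLp (hR : R < R') (he : IsParsevalFamily R R' e) (n : ℤ)
    (f : Lp ℂ 2 (slabMeasure R R')) :
    slabCoeffLp hR he n f =ᵐ[volume] slabCoeff R R' (e n) f :=
  MemLp.coeFn_toLp _

lemma hasSum_slabCoeffLp (hR : R < R') (he : IsParsevalFamily R R' e)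
    (f : Lp ℂ 2 (slabMeasure R R')) :
    HasSum (fun n => ‖slabCoeffLp hR he n f‖ ^ 2) ((R' - R) * ‖f‖ ^ 2) := by
  have h1 := tsum_l2Sq_slabCoeff hR he (Lp.memLp f)
  have hfin : ENNReal.ofReal (R' - R) * l2Sq (slabMeasure R R') f ≠ ⊤ :=
    ENNReal.mul_ne_top ENNReal.ofReal_ne_top (MemLp.l2Sq_lt_top (Lp.memLp f)).ne
  have h2 := ENNReal.hasSum_toReal (h1.trans_ne hfin)
  rw [← ENNReal.tsum_toReal_eq (ENNReal.ne_top_of_tsum_ne_top (h1.trans_ne hfin)), h1,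
    ENNReal.toReal_mul, ENNReal.toReal_ofReal (by linarith), ← Lp_norm_sq] at h2
  refine h2.congr_fun fun n => ?_
  exact norm_toLp_sq _

/-- The expansion of a square integrable function with respect to a Parseval family. -/
noncomputable def slabExpansion (hR : R < R') (he : IsParsevalFamily R R' e) :
    Lp ℂ 2 (slabMeasure R R') →ₗᵢ[ℂ] lp (fun _ : ℤ => Lp ℂ 2 (volume : Measure E2)) 2 where
  -- The factor (R' - R)^{-1/2} absorbs the Parseval constant. The map is isometric but need not be
  -- onto: sine coefficients, for instance, are odd in n.
  toFun f := ⟨fun n => (((√(R' - R))⁻¹ : ℝ) : ℂ) • slabCoeffLp hR he n f, by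
    refine memℓp_gen ?_
    have := (hasSum_slabCoeffLp hR he f).summable.mul_left (‖(((√(R' - R))⁻¹ : ℝ) : ℂ)‖ ^ 2)
    simpa [norm_smul, mul_pow] using this⟩
  map_add' f g := by
    ext1; funext n
    change (((√(R' - R))⁻¹ : ℝ) : ℂ) • slabCoeffLp hR he n (f + g) =
      (((√(R' - R))⁻¹ : ℝ) : ℂ) • slabCoeffLp hR he n f +
        (((√(R' - R))⁻¹ : ℝ) : ℂ) • slabCoeffLp hR he n g
    rw [← smul_add]
    congr 1
    refine Lp.ext ?_
    filter_upwards [coeFn_slabCoeffLp hR he n (f + g),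
      Lp.coeFn_add (slabCoeffLp hR he n f) (slabCoeffLp hR he n g),
      coeFn_slabCoeffLp hR he n f, coeFn_slabCoeffLp hR he n g,
      slabCoeff_congr_ae (e n) (Lp.coeFn_add f g), slabCoeff_add he n (Lp.memLp f) (Lp.memLp g)]
      with y h1 h2 h3 h4 h5 h6
    rw [h1, h2, h5, h6, Pi.add_apply, Pi.add_apply, h3, h4]
  map_smul' c f := by
    ext1; funext n
    change (((√(R' - R))⁻¹ : ℝ) : ℂ) • slabCoeffLp hR he n (c • f) =
      c • ((((√(R' - R))⁻¹ : ℝ) : ℂ) • slabCoeffLp hR he n f)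
    rw [smul_comm]
    congr 1
    refine Lp.ext ?_
    filter_upwards [coeFn_slabCoeffLp hR he n (c • f),
      Lp.coeFn_smul c (slabCoeffLp hR he n f),
      coeFn_slabCoeffLp hR he n f,
      slabCoeff_congr_ae (e n) (Lp.coeFn_smul c f)] with y h1 h2 h3 h5
    rw [h1, h2, h5, slabCoeff_smul, Pi.smul_apply, Pi.smul_apply, h3]
  norm_map' f := by
    rw [← sq_eq_sq₀ (norm_nonneg _) (norm_nonneg _)]
    have h1 := lp.hasSum_norm (p := 2) (by norm_num) (⟨fun n => (((√(R' - R))⁻¹ : ℝ) : ℂ) •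
      slabCoeffLp hR he n f, by
        refine memℓp_gen ?_
        have := (hasSum_slabCoeffLp hR he f).summable.mul_left (‖(((√(R' - R))⁻¹ : ℝ) : ℂ)‖ ^ 2)
        simpa [norm_smul, mul_pow] using this⟩ :
          lp (fun _ : ℤ => Lp ℂ 2 (volume : Measure E2)) 2)
    have h2 := (hasSum_slabCoeffLp hR he f).mul_left (‖(((√(R' - R))⁻¹ : ℝ) : ℂ)‖ ^ 2)
    simp only [norm_smul, ENNReal.toReal_ofNat, Real.rpow_ofNat, mul_pow] at h1
    have h3 := h1.unique h2
    refine h3.trans ?_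
    rw [Complex.norm_real, Real.norm_of_nonneg (by positivity), inv_pow,
      Real.sq_sqrt (by linarith), ← mul_assoc, inv_mul_cancel₀ (by linarith), one_mul]

lemma slabExpansion_apply (hR : R < R') (he : IsParsevalFamily R R' e)
    (f : Lp ℂ 2 (slabMeasure R R')) (n : ℤ) :
    slabExpansion hR he f n = (((√(R' - R))⁻¹ : ℝ) : ℂ) • slabCoeffLp hR he n f := rfl

end Coeff

/-! ### Weak horizontal derivatives from square summable modes. -/

/-- The horizontal partial derivatives in the coordinates `(y, t)`. -/
noncomputable def slabDeriv (i : Fin 2) (φ : E2 × ℝ → ℝ) (p : E2 × ℝ) : ℝ :=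
  planeDeriv i (fun y => φ (y, p.2)) p.1

section

variable {R R' : ℝ} {e : ℤ → ℝ → ℝ}

instance : IsFiniteMeasureOnCompacts (slabMeasure R R') := by
  unfold slabMeasure; infer_instance

lemma memLp_slab_of_hasCompactSupport {φ : E2 × ℝ → ℝ} (h : Continuous φ)
    (hc : HasCompactSupport φ) : MemLp (fun p => (φ p : ℂ)) 2 (slabMeasure R R') :=
  (Complex.continuous_ofReal.comp h).memLp_of_hasCompactSupport
    (hc.comp_left (g := fun r : ℝ => (r : ℂ)) Complex.ofReal_zero)

lemma slabDeriv_eq_fderiv (i : Fin 2) {φ : E2 × ℝ → ℝ} (h : ContDiff ℝ ∞ φ) :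
    slabDeriv i φ = fun p => fderiv ℝ φ p (EuclideanSpace.single i 1, 0) := by
  funext p
  have h1 : HasFDerivAt (fun y : E2 => (y, p.2))
      ((ContinuousLinearMap.id ℝ E2).prod 0) p.1 :=
    (hasFDerivAt_id p.1).prodMk (hasFDerivAt_const p.2 p.1)
  have h2 : HasFDerivAt φ (fderiv ℝ φ p) (p.1, p.2) :=
    (h.differentiable (by simp) p).hasFDerivAt
  have h3 := (h2.comp p.1 h1).fderiv
  unfold slabDeriv planeDeriv
  change fderiv ℝ (φ ∘ fun y => (y, p.2)) p.1 _ = _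
  rw [h3]
  simp

lemma continuous_slabDeriv (i : Fin 2) {φ : E2 × ℝ → ℝ} (h : ContDiff ℝ ∞ φ) :
    Continuous (slabDeriv i φ) := by
  rw [slabDeriv_eq_fderiv i h]
  exact (h.continuous_fderiv (by simp)).clm_apply continuous_const

lemma hasCompactSupport_slabDeriv (i : Fin 2) {φ : E2 × ℝ → ℝ} (h : ContDiff ℝ ∞ φ)
    (hc : HasCompactSupport φ) : HasCompactSupport (slabDeriv i φ) := by
  rw [slabDeriv_eq_fderiv i h]
  exact hc.fderiv_apply (𝕜 := ℝ) _

lemma hasCompactSupport_slice {φ : E2 × ℝ → ℝ} (hc : HasCompactSupport φ) (t : ℝ) :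
    HasCompactSupport fun y => φ (y, t) := by
  refine HasCompactSupport.intro (hc.isCompact.image continuous_fst) fun y hy => ?_
  by_contra hne
  exact hy ⟨(y, t), subset_tsupport _ hne, rfl⟩

lemma contDiff_slice {φ : E2 × ℝ → ℝ} (h : ContDiff ℝ ∞ φ) (t : ℝ) :
    ContDiff ℝ ∞ fun y => φ (y, t) :=
  h.comp (contDiff_id.prodMk contDiff_const)

lemma integral_slabCoeff_mul (he : IsParsevalFamily R R' e) (n : ℤ) {φ : E2 × ℝ → ℝ}
    (h : Continuous φ) (hc : HasCompactSupport φ) {b : E2 → ℂ} (hb : MemLp b 2 volume) :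
    ∫ y, slabCoeff R R' (e n) (fun p => (φ p : ℂ)) y * b y =
      ∫ t in Set.Ioo R R', (e n t : ℂ) * ∫ y, b y * φ (y, t) := by
  have h1 : Integrable (fun p : E2 × ℝ => (e n p.2 : ℂ) * ((φ p : ℂ) * b p.1))
      (slabMeasure R R') := by
    have hb' : MemLp (fun p : E2 × ℝ => b p.1) 2 (slabMeasure R R') := by
      unfold slabMeasure
      exact hb.comp_fst _
    have := memLp_one_iff_integrable.mp (hb'.mul (r := 1)
      (memLp_slab_of_hasCompactSupport (R := R) (R' := R') h hc))
    refine this.bdd_mul (c := 1) ?_ (Filter.Eventually.of_forall fun p => ?_)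
    · exact (Complex.continuous_ofReal.comp
        ((he.continuous n).comp continuous_snd)).aestronglyMeasurable
    · rw [Complex.norm_real]; exact he.abs_le_one n p.2
  have h2 := integral_integral_swap (μ := (volume : Measure E2))
    (ν := volume.restrict (Set.Ioo R R'))
    (f := fun y t => (e n t : ℂ) * ((φ (y, t) : ℂ) * b y)) h1
  calc _ = ∫ y, ∫ t in Set.Ioo R R', (e n t : ℂ) * ((φ (y, t) : ℂ) * b y) := by
        refine integral_congr_ae (Filter.Eventually.of_forall fun y => ?_)
        simp only [slabCoeff, ← integral_mul_const, mul_assoc]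
    _ = _ := h2
    _ = _ := by
        refine integral_congr_ae (Filter.Eventually.of_forall fun t => ?_)
        simp only [← integral_const_mul, mul_comm (b _)]

/-- By Fubini the identity reduces to the slices y ↦ φ(y, t), which are test functions on the plane.
Hence no condition on φ at the boundary planes is required. -/
lemma integral_slabCoeff_slabDeriv (he : IsParsevalFamily R R' e) (n : ℤ) (i : Fin 2)
    {φ : E2 × ℝ → ℝ} (h : ContDiff ℝ ∞ φ) (hc : HasCompactSupport φ) {a b : E2 → ℂ}
    (ha : MemLp a 2 volume) (hb : MemLp b 2 volume)
    (hab : ∀ ψ : E2 → ℝ, ContDiff ℝ ∞ ψ → HasCompactSupport ψ →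
      ∫ y, b y * ψ y = - ∫ y, a y * planeDeriv i ψ y) :
    ∫ y, slabCoeff R R' (e n) (fun p => (φ p : ℂ)) y * b y =
      - ∫ y, slabCoeff R R' (e n) (fun p => (slabDeriv i φ p : ℂ)) y * a y := by
  rw [integral_slabCoeff_mul he n h.continuous hc hb,
    integral_slabCoeff_mul he n (continuous_slabDeriv i h) (hasCompactSupport_slabDeriv i h hc) ha,
    ← integral_neg]
  refine integral_congr_ae (Filter.Eventually.of_forall fun t => ?_)
  simp only
  rw [hab _ (contDiff_slice h t) (hasCompactSupport_slice hc t), mul_neg]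
  rfl

/-- If every coefficient of `u` has a weak derivative and these are square summable, then `u` has
a weak derivative. -/
lemma exists_weak_slabDeriv (hR : R < R') (he : IsParsevalFamily R R' e) (i : Fin 2)
    {u : E2 × ℝ → ℂ} (hu : MemLp u 2 (slabMeasure R R'))
    (b : ℤ → Lp ℂ 2 (volume : Measure E2)) (hb : ∑' n, l2Sq volume (b n) ≠ ⊤)
    (hub : ∀ n, ∀ ψ : E2 → ℝ, ContDiff ℝ ∞ ψ → HasCompactSupport ψ →
      ∫ y, b n y * ψ y = - ∫ y, slabCoeff R R' (e n) u y * planeDeriv i ψ y) :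
    ∃ v : E2 × ℝ → ℂ, MemLp v 2 (slabMeasure R R') ∧
      ENNReal.ofReal (R' - R) * l2Sq (slabMeasure R R') v ≤ ∑' n, l2Sq volume (b n) ∧
      ∀ φ : E2 × ℝ → ℝ, ContDiff ℝ ∞ φ → HasCompactSupport φ →
        ∫ p, (φ p : ℂ) * v p ∂slabMeasure R R' =
          - ∫ p, (slabDeriv i φ p : ℂ) * u p ∂slabMeasure R R' := by
  have hL : 0 < R' - R := by linarith
  set c : ℂ := (((√(R' - R))⁻¹ : ℝ) : ℂ) with hc
  have hcn : ‖c‖ ^ 2 = (R' - R)⁻¹ := by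
    rw [hc, Complex.norm_real, Real.norm_of_nonneg (by positivity), inv_pow,
      Real.sq_sqrt hL.le]
  have hbs : HasSum (fun n => ‖b n‖ ^ 2) (∑' n, l2Sq volume (b n)).toReal := by
    have h2 := ENNReal.hasSum_toReal hb
    rw [← ENNReal.tsum_toReal_eq (ENNReal.ne_top_of_tsum_ne_top hb)] at h2
    exact h2.congr_fun fun n => Lp_norm_sq _
  have hmem : Memℓp (fun n => c • b n) 2 := by
    refine memℓp_gen ?_
    have := hbs.summable.mul_left (‖c‖ ^ 2)
    simpa [norm_smul, mul_pow] using this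
  obtain ⟨β, hβn⟩ : ∃ β : lp (fun _ : ℤ => Lp ℂ 2 (volume : Measure E2)) 2, ∀ n, β n = c • b n :=
    ⟨⟨fun n => c • b n, hmem⟩, fun n => rfl⟩
  have hβ2 : ‖β‖ ^ 2 = (R' - R)⁻¹ * (∑' n, l2Sq volume (b n)).toReal := by
    have h1 := lp.hasSum_norm (p := 2) (by norm_num) β
    have h2 := hbs.mul_left (‖c‖ ^ 2)
    simp only [hβn, norm_smul, ENNReal.toReal_ofNat, Real.rpow_ofNat, mul_pow] at h1
    rw [h1.unique h2, hcn]
  obtain ⟨A, hA⟩ : ∃ A, A = slabExpansion hR he := ⟨_, rfl⟩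
  -- The sequence `b` is not known to be the expansion of a function, since the expansion need not
  -- be onto. The adjoint of the isometry still produces a candidate, and it does not increase the
  -- norm.
  obtain ⟨V, hV⟩ : ∃ V : Lp ℂ 2 (slabMeasure R R'), V = A.toContinuousLinearMap.adjoint β :=
    ⟨_, rfl⟩
  refine ⟨V, Lp.memLp V, ?_, ?_⟩
  · have h1 : ‖V‖ ≤ ‖β‖ := by
      rw [hV]
      refine (ContinuousLinearMap.le_opNorm _ _).trans ?_
      refine mul_le_of_le_one_left (norm_nonneg _) ?_
      rw [LinearIsometryEquiv.norm_map]
      exact A.norm_toContinuousLinearMap_le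
    have h2 : (R' - R) * ‖V‖ ^ 2 ≤ (∑' n, l2Sq volume (b n)).toReal := by
      calc (R' - R) * ‖V‖ ^ 2 ≤ (R' - R) * ‖β‖ ^ 2 := by gcongr
        _ = _ := by rw [hβ2, ← mul_assoc, mul_inv_cancel₀ hL.ne', one_mul]
    rw [Lp_norm_sq] at h2
    rw [← ENNReal.ofReal_toReal hb, ← ENNReal.ofReal_toReal (MemLp.l2Sq_lt_top (Lp.memLp V)).ne,
      ← ENNReal.ofReal_mul hL.le]
    exact ENNReal.ofReal_le_ofReal h2
  · intro φ hφ hφc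
    have htest : ∀ {q : E2 × ℝ → ℝ}, Continuous q → HasCompactSupport q →
        ∃ Q : Lp ℂ 2 (slabMeasure R R'),
          (∀ w : Lp ℂ 2 (slabMeasure R R'),
            inner ℂ Q w = ∫ p, (q p : ℂ) * w p ∂slabMeasure R R') ∧
          ∀ (n : ℤ) (w : Lp ℂ 2 (volume : Measure E2)), inner ℂ (A Q n) (c • w) =
            ((R' - R)⁻¹ : ℝ) * ∫ y, slabCoeff R R' (e n) (fun p => (q p : ℂ)) y * w y := by
      intro q hq hqc
      have hm := memLp_slab_of_hasCompactSupport (R := R) (R' := R') hq hqc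
      refine ⟨hm.toLp _, fun w => ?_, fun n w => ?_⟩
      · rw [L2.inner_def]
        refine integral_congr_ae ?_
        filter_upwards [hm.coeFn_toLp] with p hp
        rw [hp, RCLike.inner_apply, Complex.conj_ofReal, mul_comm]
      · rw [hA, slabExpansion_apply, ← hc, inner_smul_left, inner_smul_right, ← mul_assoc,
          mul_comm (starRingEnd ℂ c), Complex.mul_conj', ← Complex.ofReal_pow, hcn, L2.inner_def]
        congr 1
        refine integral_congr_ae ?_
        filter_upwards [coeFn_slabCoeffLp hR he n (hm.toLp _),
          slabCoeff_congr_ae (e n) hm.coeFn_toLp] with y h1 h2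
        rw [h1, h2, RCLike.inner_apply, mul_comm]
        congr 1
        rw [slabCoeff, ← integral_conj]
        simp
    have hs := hφ.continuous
    have hds := continuous_slabDeriv i hφ
    have hdc := hasCompactSupport_slabDeriv i hφ hφc
    obtain ⟨Q, hQ, hQc⟩ := htest hs hφc
    obtain ⟨Q', hQ', hQc'⟩ := htest hds hdc
    have e1 : ∫ p, (slabDeriv i φ p : ℂ) * u p ∂slabMeasure R R' =
        ∫ p, (slabDeriv i φ p : ℂ) * hu.toLp u p ∂slabMeasure R R' := by
      refine integral_congr_ae ?_
      filter_upwards [hu.coeFn_toLp] with p hp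
      rw [hp]
    have e3 : inner ℂ Q V = inner ℂ (A Q) β := by
      rw [hV]
      exact ContinuousLinearMap.adjoint_inner_right A.toContinuousLinearMap _ β
    have e4 := (A.inner_map_map Q' (hu.toLp u)).trans (hQ' (hu.toLp u))
    -- The pairing with `V` is ⟨AQ, β⟩, a sum over modes. In each mode the derivative passes to the
    -- test function, and since `A` preserves inner products, the sum obtained is the pairing of
    -- `Q'` with `u`.
    refine (hQ V).symm.trans (e3.trans (Eq.trans ?_ (congrArg Neg.neg (e4.trans e1.symm))))
    rw [lp.inner_eq_tsum, lp.inner_eq_tsum, ← tsum_neg]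
    refine tsum_congr fun n => ?_
    have e2 : A (hu.toLp u) n = c • slabCoeffLp hR he n (hu.toLp u) := by
      rw [hA, slabExpansion_apply]
    rw [hβn, hQc, e2, hQc', ← mul_neg]
    congr 1
    rw [integral_slabCoeff_slabDeriv he n i hφ hφc (Lp.memLp _) (Lp.memLp _) ?_]
    intro ψ hψ hψc
    rw [hub n ψ hψ hψc]
    congr 1
    refine integral_congr_ae ?_
    filter_upwards [coeFn_slabCoeffLp hR he n (hu.toLp u),
      slabCoeff_congr_ae (e n) hu.coeFn_toLp] with y h1 h2
    rw [h1, h2]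

end

/-! ### The weak curl-div system in the coordinates (y, t). -/

/-- The vertical derivative in the coordinates `(y, t)`. -/
noncomputable def heightDeriv (f : E2 × ℝ → ℝ) (p : E2 × ℝ) : ℝ :=
  deriv (fun t => f (p.1, t)) p.2

/-- The weak form of `curl U = W` and `div U = D` in the slab, with the tangential traces `G` and
`G'` on the lower and the upper boundary plane. -/
structure SlabSystem (R R' : ℝ) (U W : Fin 3 → Lp ℂ 2 (slabMeasure R R'))
    (D : Lp ℂ 2 (slabMeasure R R')) (G G' : Fin 2 → Lp ℂ 2 (volume : Measure E2)) : Prop where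
  curl_zero : ∀ f : E2 × ℝ → ℝ, ContDiff ℝ ∞ f → HasCompactSupport f →
    ∫ p, W 0 p * f p + U 2 p * slabDeriv 1 f p - U 1 p * heightDeriv f p ∂slabMeasure R R' =
      (∫ y, G 1 y * f (y, R)) - ∫ y, G' 1 y * f (y, R')
  curl_one : ∀ f : E2 × ℝ → ℝ, ContDiff ℝ ∞ f → HasCompactSupport f →
    ∫ p, W 1 p * f p + U 0 p * heightDeriv f p - U 2 p * slabDeriv 0 f p ∂slabMeasure R R' =
      (∫ y, G' 0 y * f (y, R')) - ∫ y, G 0 y * f (y, R)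
  curl_two : ∀ f : E2 × ℝ → ℝ, ContDiff ℝ ∞ f → HasCompactSupport f →
    ∫ p, W 2 p * f p + U 1 p * slabDeriv 0 f p - U 0 p * slabDeriv 1 f p ∂slabMeasure R R' = 0
  -- No trace of the normal component is given, so these test functions have to vanish near both
  -- boundary planes, in contrast to those of the curl equations.
  div : ∀ f : E2 × ℝ → ℝ, ContDiff ℝ ∞ f → HasCompactSupport f →
    tsupport f ⊆ Set.univ ×ˢ Set.Ioo R R' →
    ∫ p, D p * f p + (U 0 p * slabDeriv 0 f p + U 1 p * slabDeriv 1 f p +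
      U 2 p * heightDeriv f p) ∂slabMeasure R R' = 0

section Coordinates

lemma planeHeight_single (i : Fin 2) :
    planeHeight (EuclideanSpace.single i 1, 0) = EuclideanSpace.single i.castSucc 1 := by
  ext j
  fin_cases i <;> fin_cases j <;> simp [planeHeight_apply, atHeight]

lemma planeHeight_height : planeHeight (0, 1) = EuclideanSpace.single 2 1 := by
  ext j
  fin_cases j <;> simp [planeHeight_apply, atHeight]

lemma partialD_planeHeight_castSucc {φ : E3 → ℝ} (h : ContDiff ℝ ∞ φ) (i : Fin 2) (p : E2 × ℝ) :
    partialD i.castSucc φ (planeHeight p) = slabDeriv i (φ ∘ planeHeight) p := by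
  have hd : DifferentiableAt ℝ φ (planeHeight p) := h.differentiable (by simp) _
  rw [slabDeriv_eq_fderiv i (h.comp planeHeight.contDiff)]
  simp only
  rw [planeHeight.comp_right_fderiv, partialD, ← planeHeight_single]
  rfl

lemma heightDeriv_eq_fderiv {φ : E2 × ℝ → ℝ} (h : ContDiff ℝ ∞ φ) :
    heightDeriv φ = fun p => fderiv ℝ φ p (0, 1) := by
  funext p
  have h1 : HasDerivAt (fun t : ℝ => (p.1, t)) (0, 1) p.2 :=
    (hasDerivAt_const p.2 p.1).prodMk (hasDerivAt_id p.2)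
  have h2 : HasFDerivAt φ (fderiv ℝ φ p) (p.1, p.2) :=
    (h.differentiable (by simp) p).hasFDerivAt
  exact (h2.comp_hasDerivAt p.2 h1).deriv

lemma partialD_planeHeight_two {φ : E3 → ℝ} (h : ContDiff ℝ ∞ φ) (p : E2 × ℝ) :
    partialD 2 φ (planeHeight p) = heightDeriv (φ ∘ planeHeight) p := by
  rw [heightDeriv_eq_fderiv (h.comp planeHeight.contDiff)]
  simp only
  rw [planeHeight.comp_right_fderiv, partialD, ← planeHeight_height]
  rfl

end Coordinates

section SingleField

/-- The vector field with the single component `f` in direction `j`. -/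
noncomputable def singleField (j : Fin 3) (f : E3 → ℝ) (x : E3) : E3 := EuclideanSpace.single j (f x)

lemma contDiff_singleField (j : Fin 3) {f : E3 → ℝ} (h : ContDiff ℝ ∞ f) :
    ContDiff ℝ ∞ (singleField j f) := by
  rw [contDiff_euclidean]
  intro i
  by_cases hij : i = j
  · subst hij; simpa [singleField] using h
  · simp [singleField, hij, contDiff_const]

lemma tsupport_singleField_subset (j : Fin 3) (f : E3 → ℝ) :
    tsupport (singleField j f) ⊆ tsupport f := by
  refine closure_mono fun x hx => ?_
  contrapose! hx
  simp only [Function.mem_support, not_not] at hx ⊢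
  simp [singleField, hx]

lemma hasCompactSupport_singleField (j : Fin 3) {f : E3 → ℝ} (h : HasCompactSupport f) :
    HasCompactSupport (singleField j f) :=
  h.mono' ((subset_tsupport _).trans (tsupport_singleField_subset j f))

/-- A test field with a single component. -/
noncomputable def singleTest {Ω : Opens E3} (j : Fin 3) {f : E3 → ℝ} (h : ContDiff ℝ ∞ f)
    (hc : HasCompactSupport f) (hs : tsupport f ⊆ Ω) : 𝓓(Ω, E3) :=
  ⟨singleField j f, contDiff_singleField j h, hasCompactSupport_singleField j hc,
    (tsupport_singleField_subset j f).trans hs⟩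

lemma dot3_singleField (a : C3) (j : Fin 3) (f : E3 → ℝ) (x : E3) :
    dot3 a (singleField j f x) = a j * f x := by
  fin_cases j <;> simp [dot3, singleField, Fin.sum_univ_three]

lemma partialD_singleField (i j k : Fin 3) (f : E3 → ℝ) (x : E3) :
    partialD i (fun y => singleField j f y k) x = if k = j then partialD i f x else 0 := by
  by_cases h : k = j
  · subst h; simp [singleField]
  · simp [singleField, h, partialD]

lemma dot3_curl_singleField_zero (a : C3) (f : E3 → ℝ) (x : E3) :
    dot3 a (classicalCurl (singleField 0 f) x) = a 1 * partialD 2 f x - a 2 * partialD 1 f x := by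
  simp only [dot3, classicalCurl, partialD_singleField, Fin.sum_univ_three]
  simp [show (2 : Fin 3) + 2 = 1 from rfl, show (2 : Fin 3) + 1 = 0 from rfl,
    show (1 : Fin 3) + 2 = 0 from rfl, show (1 : Fin 3) + 1 = 2 from rfl]
  ring

lemma dot3_curl_singleField_one (a : C3) (f : E3 → ℝ) (x : E3) :
    dot3 a (classicalCurl (singleField 1 f) x) = a 2 * partialD 0 f x - a 0 * partialD 2 f x := by
  simp only [dot3, classicalCurl, partialD_singleField, Fin.sum_univ_three]
  simp [show (2 : Fin 3) + 2 = 1 from rfl, show (2 : Fin 3) + 1 = 0 from rfl,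
    show (1 : Fin 3) + 2 = 0 from rfl, show (1 : Fin 3) + 1 = 2 from rfl]
  ring

lemma dot3_curl_singleField_two (a : C3) (f : E3 → ℝ) (x : E3) :
    dot3 a (classicalCurl (singleField 2 f) x) = a 0 * partialD 1 f x - a 1 * partialD 0 f x := by
  simp only [dot3, classicalCurl, partialD_singleField, Fin.sum_univ_three]
  simp [show (2 : Fin 3) + 2 = 1 from rfl, show (2 : Fin 3) + 1 = 0 from rfl,
    show (1 : Fin 3) + 2 = 0 from rfl, show (1 : Fin 3) + 1 = 2 from rfl]
  ring

end SingleField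

section System

variable {R R' : ℝ}

lemma memL2_weakCurl {Ω : Opens E3} {u : E3 → C3} (h : MemHcurl Ω u) :
    MemL2 Ω (weakCurl Ω u) ∧ IsWeakCurl Ω u (weakCurl Ω u) := by
  unfold weakCurl
  rw [dif_pos h.2]
  exact h.2.choose_spec

lemma memL2_weakDiv {Ω : Opens E3} {u : E3 → C3} (h : MemHdiv Ω u) :
    MemL2 Ω (weakDiv Ω u) ∧ IsWeakDiv Ω u (weakDiv Ω u) := by
  unfold weakDiv
  rw [dif_pos h.2]
  exact h.2.choose_spec

lemma memLp_planeHeight {F : Type*} [NormedAddCommGroup F] {f : E3 → F}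
    (h : MemL2 (slab R R') f) : MemLp (fun p => f (planeHeight p)) 2 (slabMeasure R R') :=
  h.comp_measurePreserving (measurePreserving_slab R R')

lemma memLp_component {u : E3 → C3} (h : MemL2 (slab R R') u) (j : Fin 3) :
    MemLp (fun p => u (planeHeight p) j) 2 (slabMeasure R R') :=
  (EuclideanSpace.proj (𝕜 := ℂ) j).comp_memLp' (memLp_planeHeight h)

/-- The components of a field in the slab as functions of the coordinates `(y, t)`. -/
noncomputable def componentLp {u : E3 → C3} (h : MemL2 (slab R R') u) (j : Fin 3) :
    Lp ℂ 2 (slabMeasure R R') :=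
  (memLp_component h j).toLp _

/-- The components of a tangential field. -/
noncomputable def traceComponent (g : Lp C2 2 (volume : Measure E2)) (i : Fin 2) :
    Lp ℂ 2 (volume : Measure E2) :=
  (EuclideanSpace.proj (𝕜 := ℂ) i : C2 →L[ℂ] ℂ).compLp g

lemma coeFn_componentLp {u : E3 → C3} (h : MemL2 (slab R R') u) (j : Fin 3) :
    componentLp h j =ᵐ[slabMeasure R R'] fun p => u (planeHeight p) j :=
  MemLp.coeFn_toLp _

lemma coeFn_traceComponent (g : Lp C2 2 (volume : Measure E2)) (i : Fin 2) :
    traceComponent g i =ᵐ[volume] fun y => g y i :=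
  ContinuousLinearMap.coeFn_compLp _ g

lemma integral_traceComponent (g : Lp C2 2 (volume : Measure E2)) (i : Fin 2) (q : E2 → ℂ) :
    ∫ y, traceComponent g i y * q y = ∫ y, g y i * q y := by
  refine integral_congr_ae ?_
  filter_upwards [coeFn_traceComponent g i] with y hy
  rw [hy]

lemma hasCompactSupport_comp_symm {f : E2 × ℝ → ℝ} (hc : HasCompactSupport f) :
    HasCompactSupport (f ∘ planeHeight.symm) :=
  hc.comp_homeomorph planeHeight.symm.toHomeomorph

/-- Fields with a single nonzero component split Green's formula into three scalar equations. The
vertical one has no boundary term because n × u_T is horizontal. -/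
lemma slabSystem {u : E3 → C3} (hc : MemHcurl (slab R R') u) (hd : MemHdiv (slab R R') u)
    {g g' : Lp C2 2 (volume : Measure E2)} (ht : HasTangentialTrace R R' u g g') :
    SlabSystem R R' (componentLp hc.1) (componentLp (memL2_weakCurl hc).1)
      ((memLp_planeHeight (memL2_weakDiv hd).1).toLp _) (traceComponent g) (traceComponent g') := by
  set w := weakCurl (slab R R') u with hw
  have hU := coeFn_componentLp hc.1
  have hW := coeFn_componentLp (memL2_weakCurl hc).1
  have key : ∀ f : E2 × ℝ → ℝ, ContDiff ℝ ∞ f → HasCompactSupport f →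
      (∀ p, partialD 0 (f ∘ planeHeight.symm) (planeHeight p) = slabDeriv 0 f p) ∧
      (∀ p, partialD 1 (f ∘ planeHeight.symm) (planeHeight p) = slabDeriv 1 f p) ∧
      (∀ p, partialD 2 (f ∘ planeHeight.symm) (planeHeight p) = heightDeriv f p) := by
    intro f hf hfc
    have hs : ContDiff ℝ ∞ (f ∘ planeHeight.symm) := hf.comp planeHeight.symm.contDiff
    have he : (f ∘ planeHeight.symm) ∘ planeHeight = f := by
      funext p; simp
    refine ⟨fun p => ?_, fun p => ?_, fun p => ?_⟩
    · have := partialD_planeHeight_castSucc hs 0 p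
      rwa [he] at this
    · have := partialD_planeHeight_castSucc hs 1 p
      rwa [he] at this
    · have := partialD_planeHeight_two hs p
      rwa [he] at this
  have hval : ∀ (f : E2 × ℝ → ℝ) (y : E2) (t : ℝ),
      f (planeHeight.symm (atHeight t y)) = f (y, t) := by
    intro f y t
    rw [← planeHeight_apply (y, t)]; simp
  have hval' : ∀ (f : E2 × ℝ → ℝ) (p : E2 × ℝ),
      (f ∘ planeHeight.symm) (planeHeight p) = f p := by
    intro f p; simp
  refine ⟨fun f hf hfc => ?_, fun f hf hfc => ?_, fun f hf hfc => ?_, fun f hf hfc hfs => ?_⟩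
  · obtain ⟨k0, k1, k2⟩ := key f hf hfc
    have h := ht (singleTest 0 (hf.comp planeHeight.symm.contDiff)
      (hasCompactSupport_comp_symm hfc) (Set.subset_univ _))
    rw [setIntegral_slab] at h
    simp only [singleTest, TestFunction.coe_mk, dot3_singleField, dot3_curl_singleField_zero,
      k1, k2, hval'] at h
    rw [integral_traceComponent, integral_traceComponent]
    trans ∫ p, w (planeHeight p) 0 * f p - (u (planeHeight p) 1 * heightDeriv f p -
      u (planeHeight p) 2 * slabDeriv 1 f p) ∂slabMeasure R R'
    · refine integral_congr_ae ?_
      filter_upwards [hU 1, hU 2, hW 0] with p h1 h2 h3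
      rw [h1, h2, h3]; ring
    · rw [h]
      simp [singleField, hval, integral_neg]
      ring
  · obtain ⟨k0, k1, k2⟩ := key f hf hfc
    have h := ht (singleTest 1 (hf.comp planeHeight.symm.contDiff)
      (hasCompactSupport_comp_symm hfc) (Set.subset_univ _))
    rw [setIntegral_slab] at h
    simp only [singleTest, TestFunction.coe_mk, dot3_singleField, dot3_curl_singleField_one,
      k0, k2, hval'] at h
    rw [integral_traceComponent, integral_traceComponent]
    trans ∫ p, w (planeHeight p) 1 * f p - (u (planeHeight p) 2 * slabDeriv 0 f p -
      u (planeHeight p) 0 * heightDeriv f p) ∂slabMeasure R R'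
    · refine integral_congr_ae ?_
      filter_upwards [hU 0, hU 2, hW 1] with p h1 h2 h3
      rw [h1, h2, h3]; ring
    · rw [h]
      simp [singleField, hval]
  · obtain ⟨k0, k1, k2⟩ := key f hf hfc
    have h := ht (singleTest 2 (hf.comp planeHeight.symm.contDiff)
      (hasCompactSupport_comp_symm hfc) (Set.subset_univ _))
    rw [setIntegral_slab] at h
    simp only [singleTest, TestFunction.coe_mk, dot3_singleField, dot3_curl_singleField_two,
      k0, k1, hval'] at h
    trans ∫ p, w (planeHeight p) 2 * f p - (u (planeHeight p) 0 * slabDeriv 1 f p -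
      u (planeHeight p) 1 * slabDeriv 0 f p) ∂slabMeasure R R'
    · refine integral_congr_ae ?_
      filter_upwards [hU 0, hU 1, hW 2] with p h1 h2 h3
      rw [h1, h2, h3]; ring
    · rw [h]
      simp [singleField]
  · obtain ⟨k0, k1, k2⟩ := key f hf hfc
    have hts : tsupport (f ∘ planeHeight.symm) ⊆ (slab R R' : Set E3) := by
      have e : tsupport (f ∘ planeHeight.symm) = planeHeight.symm ⁻¹' tsupport f :=
        tsupport_comp_eq_preimage f planeHeight.symm.toHomeomorph
      rw [e]
      intro x hx
      exact (hfs hx).2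
    have h := (memL2_weakDiv hd).2 ⟨f ∘ planeHeight.symm, hf.comp planeHeight.symm.contDiff,
      hasCompactSupport_comp_symm hfc, hts⟩
    rw [setIntegral_slab, setIntegral_slab] at h
    simp only [TestFunction.coe_mk, Fin.sum_univ_three, k0, k1, k2, hval'] at h
    have hD := (memLp_planeHeight (memL2_weakDiv hd).1).coeFn_toLp
    have i1 : Integrable (fun p => weakDiv (slab R R') u (planeHeight p) * (f p : ℂ))
        (slabMeasure R R') :=
      (memLp_planeHeight (memL2_weakDiv hd).1).integrable_mul
        (memLp_slab_of_hasCompactSupport hf.continuous hfc)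
    have i2 : ∀ i j, Integrable (fun p => u (planeHeight p) j * (slabDeriv i f p : ℂ))
        (slabMeasure R R') := fun i j =>
      (memLp_component hc.1 j).integrable_mul
        (memLp_slab_of_hasCompactSupport (continuous_slabDeriv i hf)
          (hasCompactSupport_slabDeriv i hf hfc))
    have hhc : Continuous (heightDeriv f) := by
      rw [heightDeriv_eq_fderiv hf]
      exact (hf.continuous_fderiv (by simp)).clm_apply continuous_const
    have hhs : HasCompactSupport (heightDeriv f) := by
      rw [heightDeriv_eq_fderiv hf]
      exact hfc.fderiv_apply (𝕜 := ℝ) _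
    have i3 : Integrable (fun p => u (planeHeight p) 2 * (heightDeriv f p : ℂ))
        (slabMeasure R R') :=
      (memLp_component hc.1 2).integrable_mul (memLp_slab_of_hasCompactSupport hhc hhs)
    have i4 : Integrable (fun p => u (planeHeight p) 0 * (slabDeriv 0 f p : ℂ) +
        u (planeHeight p) 1 * (slabDeriv 1 f p : ℂ) +
        u (planeHeight p) 2 * (heightDeriv f p : ℂ)) (slabMeasure R R') :=
      ((i2 0 0).add (i2 1 1)).add i3
    trans ∫ p, weakDiv (slab R R') u (planeHeight p) * (f p : ℂ) +
      (u (planeHeight p) 0 * (slabDeriv 0 f p : ℂ) +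
        u (planeHeight p) 1 * (slabDeriv 1 f p : ℂ) +
        u (planeHeight p) 2 * (heightDeriv f p : ℂ)) ∂slabMeasure R R'
    · refine integral_congr_ae ?_
      filter_upwards [hU 0, hU 1, hU 2, hD] with p h0 h1 h2 h3
      rw [h0, h1, h2, h3]
    · rw [integral_add i1 i4, h, neg_add_cancel]

end System

/-! ### Admissible vertical test functions. -/

section Cutoffs

/-- Sines and cosines are not compactly supported in the height, but only their values on [R, R']
and their derivatives inside enter the curl equations, so they may be cut off outside. -/
lemma exists_compactSupport_eqOn {R R' : ℝ} (hR : R < R') {e : ℝ → ℝ} (he : ContDiff ℝ ∞ e) :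
    ∃ τ : ℝ → ℝ, ContDiff ℝ ∞ τ ∧ HasCompactSupport τ ∧ (∀ t ∈ Set.Icc R R', τ t = e t) ∧
      ∀ t ∈ Set.Ioo R R', deriv τ t = deriv e t := by
  let χ : ContDiffBump ((R + R') / 2) := ⟨R' - R, 2 * (R' - R), by linarith, by linarith⟩
  have h1 : ∀ t ∈ Set.Icc R R', e t * χ t = e t := by
    intro t ht
    rw [χ.one_of_mem_closedBall, mul_one]
    rw [Metric.mem_closedBall, Real.dist_eq, abs_le]
    constructor
    · change -(R' - R) ≤ _; linarith [ht.1]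
    · change _ ≤ R' - R; linarith [ht.2]
  refine ⟨fun t => e t * χ t, he.mul χ.contDiff, χ.hasCompactSupport.mul_left, h1, fun t ht => ?_⟩
  refine Filter.EventuallyEq.deriv_eq ?_
  filter_upwards [Ioo_mem_nhds ht.1 ht.2] with s hs
  exact h1 s ⟨hs.1.le, hs.2.le⟩

/-- A smooth step from `0` on `(-∞, 1]` to `1` on `[2, ∞)`. -/
noncomputable def smoothStep (x : ℝ) : ℝ := Real.smoothTransition (x - 1)

lemma contDiff_smoothStep : ContDiff ℝ ∞ smoothStep :=
  Real.smoothTransition.contDiff.comp (contDiff_id.sub contDiff_const)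

lemma smoothStep_zero {x : ℝ} (h : x ≤ 1) : smoothStep x = 0 :=
  Real.smoothTransition.zero_of_nonpos (by linarith)

lemma smoothStep_one {x : ℝ} (h : 2 ≤ x) : smoothStep x = 1 :=
  Real.smoothTransition.one_of_one_le (by linarith)

lemma abs_smoothStep_le (x : ℝ) : |smoothStep x| ≤ 1 :=
  abs_le.mpr ⟨by linarith [Real.smoothTransition.nonneg (x - 1), smoothStep.eq_1 x],
    Real.smoothTransition.le_one _⟩

lemma deriv_smoothStep_zero {x : ℝ} (h : x < 1) : deriv smoothStep x = 0 := by
  have : smoothStep =ᶠ[nhds x] fun _ => 0 := by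
    filter_upwards [Iio_mem_nhds h] with s hs
    exact smoothStep_zero (le_of_lt hs)
  rw [this.deriv_eq, deriv_const]

lemma deriv_smoothStep_one {x : ℝ} (h : 2 < x) : deriv smoothStep x = 0 := by
  have : smoothStep =ᶠ[nhds x] fun _ => 1 := by
    filter_upwards [Ioi_mem_nhds h] with s hs
    exact smoothStep_one (le_of_lt hs)
  rw [this.deriv_eq, deriv_const]

lemma exists_abs_mul_deriv_smoothStep_le :
    ∃ C, 0 ≤ C ∧ ∀ x, |x * deriv smoothStep x| ≤ C := by
  have hc : Continuous fun x => x * deriv smoothStep x :=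
    continuous_id.mul (contDiff_smoothStep.continuous_deriv (by simp))
  obtain ⟨C, hC⟩ := isCompact_Icc.exists_bound_of_continuousOn (s := Set.Icc (1 : ℝ) 2)
    hc.continuousOn
  have hC0 : 0 ≤ C := (norm_nonneg _).trans (hC 1 (by norm_num))
  refine ⟨C, hC0, fun x => ?_⟩
  rcases lt_or_ge x 1 with h | h
  · rw [deriv_smoothStep_zero h, mul_zero, abs_zero]; exact hC0
  · rcases lt_or_ge 2 x with h2 | h2
    · rw [deriv_smoothStep_one h2, mul_zero, abs_zero]; exact hC0
    · exact hC x ⟨h, h2⟩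

/-- A function vanishing at both ends of `(R, R')` is a limit of test functions, with
derivatives. -/
lemma exists_test_approximation {R R' K : ℝ} {s : ℝ → ℝ} (hs : ContDiff ℝ ∞ s)
    (hb : ∀ t, |s t| ≤ 1) (hd : ∀ t, |deriv s t| ≤ K) (h1 : ∀ t, |s t| ≤ K * |t - R|)
    (h2 : ∀ t, |s t| ≤ K * |R' - t|) :
    ∃ τ : ℕ → ℝ → ℝ, (∀ m, ContDiff ℝ ∞ (τ m)) ∧ (∀ m, tsupport (τ m) ⊆ Set.Ioo R R') ∧
      (∀ m, HasCompactSupport (τ m)) ∧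
      (∃ C, ∀ m t, |τ m t| ≤ C ∧ |deriv (τ m) t| ≤ C) ∧
      ∀ t ∈ Set.Ioo R R', Filter.Tendsto (fun m => τ m t) Filter.atTop (nhds (s t)) ∧
        Filter.Tendsto (fun m => deriv (τ m) t) Filter.atTop (nhds (deriv s t)) := by
  obtain ⟨C, hC0, hC⟩ := exists_abs_mul_deriv_smoothStep_le
  have hK : 0 ≤ K := (abs_nonneg _).trans (hd 0)
  set N : ℕ → ℝ := fun m => (m : ℝ) + 1 with hN
  have hNpos : ∀ m, 0 < N m := fun m => by positivity
  set p : ℕ → ℝ → ℝ := fun m t => smoothStep (N m * (t - R)) with hp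
  set q : ℕ → ℝ → ℝ := fun m t => smoothStep (N m * (R' - t)) with hq
  have hsp : ∀ m, ContDiff ℝ ∞ (p m) := fun m => contDiff_smoothStep.comp (by fun_prop)
  have hsq : ∀ m, ContDiff ℝ ∞ (q m) := fun m => contDiff_smoothStep.comp (by fun_prop)
  have hpd : ∀ m t, deriv (p m) t = N m * deriv smoothStep (N m * (t - R)) := by
    intro m t
    have e1 : HasDerivAt (fun t => N m * (t - R)) (N m * 1) t :=
      ((hasDerivAt_id t).sub_const R).const_mul _
    have e2 := (contDiff_smoothStep.differentiable (by simp) (N m * (t - R))).hasDerivAt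
    have := (e2.comp t e1).deriv
    rw [mul_one, mul_comm] at this
    exact this
  have hqd : ∀ m t, deriv (q m) t = -(N m * deriv smoothStep (N m * (R' - t))) := by
    intro m t
    have e1 : HasDerivAt (fun t => N m * (R' - t)) (N m * (-1)) t :=
      ((hasDerivAt_id t).const_sub R').const_mul _
    have e2 := (contDiff_smoothStep.differentiable (by simp) (N m * (R' - t))).hasDerivAt
    have := (e2.comp t e1).deriv
    rw [show deriv smoothStep (N m * (R' - t)) * (N m * -1) =
      -(N m * deriv smoothStep (N m * (R' - t))) by ring] at this
    exact this
  have hder : ∀ m t, deriv (fun t => s t * (p m t * q m t)) t =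
      deriv s t * (p m t * q m t) + s t * (deriv (p m) t * q m t + p m t * deriv (q m) t) := by
    intro m t
    have e1 := (hs.differentiable (by simp) t).hasDerivAt
    have e2 := ((hsp m).differentiable (by simp) t).hasDerivAt
    have e3 := ((hsq m).differentiable (by simp) t).hasDerivAt
    exact (e1.mul (e2.mul e3)).deriv
  have hpb : ∀ m t, |p m t| ≤ 1 := fun m t => abs_smoothStep_le _
  have hqb : ∀ m t, |q m t| ≤ 1 := fun m t => abs_smoothStep_le _
  have hpq : ∀ m t, |p m t * q m t| ≤ 1 := fun m t => by
    rw [abs_mul]; exact mul_le_one₀ (hpb m t) (abs_nonneg _) (hqb m t)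
  -- The derivative of the cutoff is of order `N m` near the end of the interval, while `s` vanishes
  -- there at least linearly; since x ↦ x·smoothStep'(x) is bounded, the product is bounded
  -- uniformly in `m`.
  have hspd : ∀ m t, |s t * deriv (p m) t| ≤ K * C := by
    intro m t
    rw [hpd, abs_mul]
    calc |s t| * |N m * deriv smoothStep (N m * (t - R))|
        ≤ K * |t - R| * |N m * deriv smoothStep (N m * (t - R))| := by
          gcongr; exact h1 t
      _ = K * |N m * (t - R) * deriv smoothStep (N m * (t - R))| := by
          rw [mul_assoc, ← abs_mul]; congr 2; ring
      _ ≤ K * C := by gcongr; exact hC _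
  have hsqd : ∀ m t, |s t * deriv (q m) t| ≤ K * C := by
    intro m t
    rw [hqd, abs_mul, abs_neg]
    calc |s t| * |N m * deriv smoothStep (N m * (R' - t))|
        ≤ K * |R' - t| * |N m * deriv smoothStep (N m * (R' - t))| := by
          gcongr; exact h2 t
      _ = K * |N m * (R' - t) * deriv smoothStep (N m * (R' - t))| := by
          rw [mul_assoc, ← abs_mul]; congr 2; ring
      _ ≤ K * C := by gcongr; exact hC _
  -- The step function vanishes up to 1 rather than only up to 0, which keeps the closed support at
  -- distance 1/N from the end points.
  have htsup : ∀ m, tsupport (fun t => s t * (p m t * q m t)) ⊆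
      Set.Icc (R + (N m)⁻¹) (R' - (N m)⁻¹) := by
    intro m
    refine closure_minimal (fun t ht => ?_) isClosed_Icc
    by_contra hcon
    apply ht
    rw [Set.mem_Icc, not_and_or] at hcon
    rcases hcon with hcon | hcon
    · have : N m * (t - R) ≤ 1 := by
        rw [← le_div_iff₀' (hNpos m), one_div]; linarith
      simp only [hp, smoothStep_zero this, zero_mul, mul_zero]
    · have : N m * (R' - t) ≤ 1 := by
        rw [← le_div_iff₀' (hNpos m), one_div]; linarith
      simp only [hq, smoothStep_zero this, mul_zero]
  refine ⟨fun m t => s t * (p m t * q m t), fun m => hs.mul ((hsp m).mul (hsq m)), fun m => ?_,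
    fun m => ?_, ⟨1 + K + 2 * (K * C), fun m t => ⟨?_, ?_⟩⟩, fun t ht => ?_⟩
  · refine (htsup m).trans fun t ht => ?_
    have := inv_pos.mpr (hNpos m)
    exact ⟨by linarith [ht.1], by linarith [ht.2]⟩
  · exact isCompact_Icc.of_isClosed_subset (isClosed_tsupport _) (htsup m)
  · rw [abs_mul]
    have := mul_le_one₀ (hb t) (abs_nonneg _) (hpq m t)
    nlinarith [mul_nonneg hK hC0]
  · rw [hder]
    have a1 : |deriv s t * (p m t * q m t)| ≤ K := by
      rw [abs_mul]
      exact (mul_le_of_le_one_right (abs_nonneg _) (hpq m t)).trans (hd t)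
    have a2 : |s t * deriv (p m) t * q m t| ≤ K * C := by
      rw [abs_mul]
      exact (mul_le_of_le_one_right (abs_nonneg _) (hqb m t)).trans (hspd m t)
    have a3 : |s t * deriv (q m) t * p m t| ≤ K * C := by
      rw [abs_mul]
      exact (mul_le_of_le_one_right (abs_nonneg _) (hpb m t)).trans (hsqd m t)
    rw [show deriv s t * (p m t * q m t) + s t * (deriv (p m) t * q m t + p m t * deriv (q m) t) =
      deriv s t * (p m t * q m t) + (s t * deriv (p m) t * q m t + s t * deriv (q m) t * p m t) by
        ring]
    refine (abs_add_le _ _).trans ?_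
    have := abs_add_le (s t * deriv (p m) t * q m t) (s t * deriv (q m) t * p m t)
    linarith
  · have hNt : Filter.Tendsto N Filter.atTop Filter.atTop :=
      Filter.tendsto_atTop_add_const_right _ _ tendsto_natCast_atTop_atTop
    have l1 : ∀ᶠ m in Filter.atTop, 2 < N m * (t - R) :=
      (hNt.atTop_mul_const (sub_pos.mpr ht.1)).eventually_gt_atTop 2
    have l2 : ∀ᶠ m in Filter.atTop, 2 < N m * (R' - t) :=
      (hNt.atTop_mul_const (sub_pos.mpr ht.2)).eventually_gt_atTop 2
    constructor
    · refine tendsto_const_nhds.congr' ?_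
      filter_upwards [l1, l2] with m m1 m2
      simp only [hp, hq, smoothStep_one m1.le, smoothStep_one m2.le, mul_one]
    · refine tendsto_const_nhds.congr' ?_
      filter_upwards [l1, l2] with m m1 m2
      rw [hder, hpd, hqd, deriv_smoothStep_one m1, deriv_smoothStep_one m2]
      simp only [hp, hq, smoothStep_one m1.le, smoothStep_one m2.le, mul_one, mul_zero, neg_zero,
        add_zero]

end Cutoffs

section Trigonometric

variable {R R' : ℝ}

lemma contDiff_slabSin (n : ℤ) : ContDiff ℝ ∞ (slabSin R R' n) := by
  unfold slabSin; fun_prop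

lemma contDiff_slabCos (n : ℤ) : ContDiff ℝ ∞ (slabCos R R' n) := by
  unfold slabCos; fun_prop

lemma deriv_slabSin (n : ℤ) (t : ℝ) :
    deriv (slabSin R R' n) t = slabFreq R R' n * slabCos R R' n t := by
  have e1 : HasDerivAt (fun t => slabFreq R R' n * (t - R)) (slabFreq R R' n * 1) t :=
    ((hasDerivAt_id t).sub_const R).const_mul _
  have := e1.sin.deriv
  rw [mul_one, mul_comm] at this
  exact this

lemma deriv_slabCos (n : ℤ) (t : ℝ) :
    deriv (slabCos R R' n) t = -(slabFreq R R' n * slabSin R R' n t) := by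
  have e1 : HasDerivAt (fun t => slabFreq R R' n * (t - R)) (slabFreq R R' n * 1) t :=
    ((hasDerivAt_id t).sub_const R).const_mul _
  have := e1.cos.deriv
  rw [mul_one, show -Real.sin (slabFreq R R' n * (t - R)) * slabFreq R R' n =
    -(slabFreq R R' n * Real.sin (slabFreq R R' n * (t - R))) by ring] at this
  exact this

lemma slabCos_left (n : ℤ) : slabCos R R' n R = 1 := by
  simp [slabCos]

lemma slabSin_approximation (hR : R < R') (n : ℤ) :
    ∃ τ : ℕ → ℝ → ℝ, (∀ m, ContDiff ℝ ∞ (τ m)) ∧ (∀ m, tsupport (τ m) ⊆ Set.Ioo R R') ∧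
      (∀ m, HasCompactSupport (τ m)) ∧
      (∃ C, ∀ m t, |τ m t| ≤ C ∧ |deriv (τ m) t| ≤ C) ∧
      ∀ t ∈ Set.Ioo R R',
        Filter.Tendsto (fun m => τ m t) Filter.atTop (nhds (slabSin R R' n t)) ∧
        Filter.Tendsto (fun m => deriv (τ m) t) Filter.atTop
          (nhds (slabFreq R R' n * slabCos R R' n t)) := by
  simp_rw [← deriv_slabSin]
  have hL : R' - R ≠ 0 := by linarith
  refine exists_test_approximation (K := |slabFreq R R' n|) (contDiff_slabSin n)
    (fun t => Real.abs_sin_le_one _) (fun t => ?_) (fun t => ?_) (fun t => ?_)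
  · rw [deriv_slabSin, abs_mul]
    exact mul_le_of_le_one_right (abs_nonneg _) (Real.abs_cos_le_one _)
  · rw [← abs_mul]
    exact Real.abs_sin_le_abs
  -- Because k(R' - R) = nπ, the sine also vanishes at the upper end, where it equals sin(k(R' - t))
  -- up to sign.
  · have e : slabFreq R R' n * (t - R) = n * Real.pi - slabFreq R R' n * (R' - t) := by
      unfold slabFreq; field_simp; ring
    have e2 : |slabSin R R' n t| = |Real.sin (slabFreq R R' n * (R' - t))| := by
      rw [slabSin, e, Real.sin_int_mul_pi_sub, abs_neg, abs_mul]
      rcases Int.even_or_odd n with h | h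
      · rw [h.neg_one_zpow]; simp
      · rw [h.neg_one_zpow]; simp
    rw [e2, ← abs_mul]
    exact Real.abs_sin_le_abs

end Trigonometric

/-! ### Test functions of product form ψ(y)τ(t). -/

section ProductTest

variable {R R' : ℝ}

/-- The pairing of a square integrable function on the plane with a real function. -/
noncomputable def planePair (x : Lp ℂ 2 (volume : Measure E2)) (ψ : E2 → ℝ) : ℂ :=
  ∫ y, x y * ψ y

lemma memLp_plane_of_hasCompactSupport {ψ : E2 → ℝ} (h : Continuous ψ)
    (hc : HasCompactSupport ψ) : MemLp (fun y => (ψ y : ℂ)) 2 (volume : Measure E2) :=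
  (Complex.continuous_ofReal.comp h).memLp_of_hasCompactSupport
    (hc.comp_left (g := fun r : ℝ => (r : ℂ)) Complex.ofReal_zero)

lemma integrable_planePair (x : Lp ℂ 2 (volume : Measure E2)) {ψ : E2 → ℝ} (h : Continuous ψ)
    (hc : HasCompactSupport ψ) : Integrable fun y => x y * (ψ y : ℂ) :=
  (Lp.memLp x).integrable_mul (memLp_plane_of_hasCompactSupport h hc)

lemma planePair_add (x z : Lp ℂ 2 (volume : Measure E2)) {ψ : E2 → ℝ} (h : Continuous ψ)
    (hc : HasCompactSupport ψ) : planePair (x + z) ψ = planePair x ψ + planePair z ψ := by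
  unfold planePair
  rw [← integral_add (integrable_planePair x h hc) (integrable_planePair z h hc)]
  refine integral_congr_ae ?_
  filter_upwards [Lp.coeFn_add x z] with y hy
  rw [hy, Pi.add_apply, add_mul]

lemma planePair_smul (c : ℂ) (x : Lp ℂ 2 (volume : Measure E2)) (ψ : E2 → ℝ) :
    planePair (c • x) ψ = c * planePair x ψ := by
  unfold planePair
  rw [← integral_const_mul]
  refine integral_congr_ae ?_
  filter_upwards [Lp.coeFn_smul c x] with y hy
  rw [hy, Pi.smul_apply, smul_eq_mul, mul_assoc]

lemma planePair_neg (x : Lp ℂ 2 (volume : Measure E2)) (ψ : E2 → ℝ) :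
    planePair (-x) ψ = -planePair x ψ := by
  have := planePair_smul (-1) x ψ
  simpa using this

lemma planePair_sub (x z : Lp ℂ 2 (volume : Measure E2)) {ψ : E2 → ℝ} (h : Continuous ψ)
    (hc : HasCompactSupport ψ) : planePair (x - z) ψ = planePair x ψ - planePair z ψ := by
  rw [sub_eq_add_neg, planePair_add _ _ h hc, planePair_neg, sub_eq_add_neg]

lemma planePair_zero (ψ : E2 → ℝ) : planePair 0 ψ = 0 := by
  have := planePair_smul 0 0 ψ
  simpa using this

lemma planeDeriv_ofReal {ψ : E2 → ℝ} (h : ContDiff ℝ ∞ ψ) (i : Fin 2) (y : E2) :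
    planeDeriv i (fun z => (ψ z : ℂ)) y = ((planeDeriv i ψ y : ℝ) : ℂ) := by
  have e : fderiv ℝ (fun z => (ψ z : ℂ)) y = Complex.ofRealCLM.comp (fderiv ℝ ψ y) :=
    (Complex.ofRealCLM.hasFDerivAt.comp y (h.differentiable (by simp) y).hasFDerivAt).fderiv
  unfold planeDeriv
  rw [e]; simp

lemma continuous_planeDeriv {ψ : E2 → ℝ} (h : ContDiff ℝ ∞ ψ) (i : Fin 2) :
    Continuous (planeDeriv i ψ) :=
  (h.continuous_fderiv (by simp)).clm_apply continuous_const

lemma hasCompactSupport_planeDeriv {ψ : E2 → ℝ} (hc : HasCompactSupport ψ) (i : Fin 2) :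
    HasCompactSupport (planeDeriv i ψ) :=
  hc.fderiv_apply (𝕜 := ℝ) _

lemma isPlaneDiv_iff {a₀ a₁ b : Lp ℂ 2 (volume : Measure E2)} :
    IsPlaneDiv a₀ a₁ b ↔ ∀ ψ : E2 → ℝ, ContDiff ℝ ∞ ψ → HasCompactSupport ψ →
      planePair b ψ + (planePair a₀ (planeDeriv 0 ψ) + planePair a₁ (planeDeriv 1 ψ)) = 0 := by
  unfold IsPlaneDiv
  refine forall_congr' fun ψ => forall_congr' fun h => forall_congr' fun hc => ?_
  have i0 := integrable_planePair a₀ (continuous_planeDeriv h 0) (hasCompactSupport_planeDeriv hc 0)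
  have i1 := integrable_planePair a₁ (continuous_planeDeriv h 1) (hasCompactSupport_planeDeriv hc 1)
  have i2 : Integrable fun y => a₀ y * ((planeDeriv 0 ψ y : ℝ) : ℂ) +
      a₁ y * ((planeDeriv 1 ψ y : ℝ) : ℂ) :=
    i0.add i1
  unfold planePairing planePair
  simp_rw [planeDeriv_ofReal h]
  rw [integral_add (integrable_planePair b h.continuous hc) i2, integral_add i0 i1]

variable {e : ℤ → ℝ → ℝ}

lemma integrable_slab_product (q : Lp ℂ 2 (slabMeasure R R')) {ψ : E2 → ℝ} (h : Continuous ψ)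
    (hc : HasCompactSupport ψ) {τ : ℝ → ℝ} (hτ : Continuous τ) {C : ℝ} (hb : ∀ t, |τ t| ≤ C) :
    Integrable (fun p => q p * ((ψ p.1 * τ p.2 : ℝ) : ℂ)) (slabMeasure R R') := by
  have hψ : MemLp (fun p : E2 × ℝ => (ψ p.1 : ℂ)) 2 (slabMeasure R R') := by
    unfold slabMeasure
    exact (memLp_plane_of_hasCompactSupport h hc).comp_fst _
  have h1 : Integrable (fun p => q p * (ψ p.1 : ℂ)) (slabMeasure R R') :=
    (Lp.memLp q).integrable_mul hψ
  have := h1.bdd_mul (c := C) (f := fun p : E2 × ℝ => (τ p.2 : ℂ))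
    (Complex.continuous_ofReal.comp (hτ.comp continuous_snd)).aestronglyMeasurable
    (Filter.Eventually.of_forall fun p => by rw [Complex.norm_real]; exact hb _)
  refine this.congr (Filter.Eventually.of_forall fun p => ?_)
  push_cast
  ring

lemma planePair_slabCoeffLp (hR : R < R') (he : IsParsevalFamily R R' e) (n : ℤ)
    (q : Lp ℂ 2 (slabMeasure R R')) {ψ : E2 → ℝ} (h : Continuous ψ) (hc : HasCompactSupport ψ) :
    planePair (slabCoeffLp hR he n q) ψ =
      ∫ p, q p * ((ψ p.1 * e n p.2 : ℝ) : ℂ) ∂slabMeasure R R' := by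
  have h1 := integrable_slab_product q h hc (he.continuous n) (he.abs_le_one n)
  unfold slabMeasure at h1
  refine Eq.trans ?_ (integral_prod _ h1).symm
  refine integral_congr_ae ?_
  filter_upwards [coeFn_slabCoeffLp hR he n q] with y hy
  rw [hy, slabCoeff, ← integral_mul_const]
  refine integral_congr_ae (Filter.Eventually.of_forall fun t => ?_)
  change (e n t : ℂ) * q (y, t) * (ψ y : ℂ) = q (y, t) * ((ψ y * e n t : ℝ) : ℂ)
  push_cast
  ring

lemma ae_slabMeasure_mem : ∀ᵐ p ∂slabMeasure R R', p.2 ∈ Set.Ioo R R' := by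
  unfold slabMeasure
  exact Measure.quasiMeasurePreserving_snd.ae (ae_restrict_mem measurableSet_Ioo)

lemma slabDeriv_product {ψ : E2 → ℝ} (h : ContDiff ℝ ∞ ψ) (τ : ℝ → ℝ) (i : Fin 2) (p : E2 × ℝ) :
    slabDeriv i (fun p => ψ p.1 * τ p.2) p = planeDeriv i ψ p.1 * τ p.2 := by
  unfold slabDeriv planeDeriv
  simp only
  rw [fderiv_mul_const (h.differentiable (by simp) _)]
  simp [mul_comm]

lemma heightDeriv_product (ψ : E2 → ℝ) {τ : ℝ → ℝ} (h : ContDiff ℝ ∞ τ) (p : E2 × ℝ) :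
    heightDeriv (fun p => ψ p.1 * τ p.2) p = ψ p.1 * deriv τ p.2 := by
  unfold heightDeriv
  simp only
  rw [deriv_const_mul _ (h.differentiable (by simp) _)]

lemma contDiff_product {ψ : E2 → ℝ} (h : ContDiff ℝ ∞ ψ) {τ : ℝ → ℝ} (hτ : ContDiff ℝ ∞ τ) :
    ContDiff ℝ ∞ fun p : E2 × ℝ => ψ p.1 * τ p.2 :=
  (h.comp contDiff_fst).mul (hτ.comp contDiff_snd)

lemma tsupport_product_subset (ψ : E2 → ℝ) (τ : ℝ → ℝ) :
    tsupport (fun p : E2 × ℝ => ψ p.1 * τ p.2) ⊆ tsupport ψ ×ˢ tsupport τ := by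
  refine closure_minimal (fun p hp => ?_) ((isClosed_tsupport _).prod (isClosed_tsupport _))
  exact ⟨subset_tsupport _ (left_ne_zero_of_mul hp), subset_tsupport _ (right_ne_zero_of_mul hp)⟩

lemma hasCompactSupport_product {ψ : E2 → ℝ} (h : HasCompactSupport ψ) {τ : ℝ → ℝ}
    (hτ : HasCompactSupport τ) : HasCompactSupport fun p : E2 × ℝ => ψ p.1 * τ p.2 :=
  (h.isCompact.prod hτ.isCompact).of_isClosed_subset (isClosed_tsupport _)
    (tsupport_product_subset ψ τ)

end ProductTest

/-! ### The four equations satisfied by each mode. -/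

section PlaneEquations

variable {R R' : ℝ} {U W : Fin 3 → Lp ℂ 2 (slabMeasure R R')}
    {D : Lp ℂ 2 (slabMeasure R R')} {G G' : Fin 2 → Lp ℂ 2 (volume : Measure E2)}

/-- The sine coefficients of a square integrable function on the slab. -/
noncomputable def sinCoeff (hR : R < R') (n : ℤ) (q : Lp ℂ 2 (slabMeasure R R')) :
    Lp ℂ 2 (volume : Measure E2) :=
  slabCoeffLp hR (isParsevalFamily_slabSin hR) n q

/-- The cosine coefficients of a square integrable function on the slab. -/
noncomputable def cosCoeff (hR : R < R') (n : ℤ) (q : Lp ℂ 2 (slabMeasure R R')) :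
    Lp ℂ 2 (volume : Measure E2) :=
  slabCoeffLp hR (isParsevalFamily_slabCos hR) n q

/-- The boundary term of the `n`-th cosine mode. -/
noncomputable def boundaryTerm (R R' : ℝ) (n : ℤ) (x x' : Lp ℂ 2 (volume : Measure E2)) :
    Lp ℂ 2 (volume : Measure E2) :=
  (slabCos R R' n R' : ℂ) • x' - x

lemma integral_product_sin (hR : R < R') (n : ℤ) (q : Lp ℂ 2 (slabMeasure R R')) {ψ : E2 → ℝ}
    (h : Continuous ψ) (hc : HasCompactSupport ψ) :
    Integrable (fun p => q p * ((ψ p.1 * slabSin R R' n p.2 : ℝ) : ℂ)) (slabMeasure R R') ∧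
    ∫ p, q p * ((ψ p.1 * slabSin R R' n p.2 : ℝ) : ℂ) ∂slabMeasure R R' =
      planePair (sinCoeff hR n q) ψ :=
  have he := isParsevalFamily_slabSin hR
  ⟨integrable_slab_product q h hc (he.continuous n) (he.abs_le_one n),
    (planePair_slabCoeffLp hR he n q h hc).symm⟩

lemma integral_product_cos (hR : R < R') (n : ℤ) (q : Lp ℂ 2 (slabMeasure R R')) {ψ : E2 → ℝ}
    (h : Continuous ψ) (hc : HasCompactSupport ψ) :
    Integrable (fun p => q p * ((ψ p.1 * slabCos R R' n p.2 : ℝ) : ℂ)) (slabMeasure R R') ∧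
    ∫ p, q p * ((ψ p.1 * slabCos R R' n p.2 : ℝ) : ℂ) ∂slabMeasure R R' =
      planePair (cosCoeff hR n q) ψ :=
  have he := isParsevalFamily_slabCos hR
  ⟨integrable_slab_product q h hc (he.continuous n) (he.abs_le_one n),
    (planePair_slabCoeffLp hR he n q h hc).symm⟩

/-- Testing with a cosine, whose derivative is -k sin, brings in the sine modes of `U 1` next to the
cosine modes of `U 2`. The end values 1 and cos(k(R' - R)) of the cosine are the coefficients of the
boundary data. -/
lemma SlabSystem.plane_curl_zero (hR : R < R') (hs : SlabSystem R R' U W D G G') (n : ℤ) :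
    IsPlaneDiv (0 : Lp ℂ 2 (volume : Measure E2)) (cosCoeff hR n (U 2))
      (cosCoeff hR n (W 0) + (slabFreq R R' n : ℂ) • sinCoeff hR n (U 1) +
        boundaryTerm R R' n (G 1) (G' 1) : Lp ℂ 2 (volume : Measure E2)) := by
  rw [isPlaneDiv_iff]
  intro ψ h hc
  obtain ⟨τ, hτ, hτc, hτe, hτd⟩ := exists_compactSupport_eqOn hR
    (contDiff_slabCos (R := R) (R' := R') n)
  have heq := hs.curl_zero _ (contDiff_product h hτ) (hasCompactSupport_product hc hτc)
  obtain ⟨i1, e1⟩ := integral_product_cos hR n (W 0) h.continuous hc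
  obtain ⟨i2, e2⟩ := integral_product_cos hR n (U 2) (continuous_planeDeriv h 1)
    (hasCompactSupport_planeDeriv hc 1)
  obtain ⟨i3, e3⟩ := integral_product_sin hR n (U 1) h.continuous hc
  have i3' := i3.const_mul (slabFreq R R' n : ℂ)
  have i12 : Integrable (fun p => W 0 p * ((ψ p.1 * slabCos R R' n p.2 : ℝ) : ℂ) +
      U 2 p * ((planeDeriv 1 ψ p.1 * slabCos R R' n p.2 : ℝ) : ℂ)) (slabMeasure R R') := i1.add i2
  have hl : ∫ p, W 0 p * ((ψ p.1 * τ p.2 : ℝ) : ℂ) +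
      U 2 p * slabDeriv 1 (fun p => ψ p.1 * τ p.2) p -
      U 1 p * heightDeriv (fun p => ψ p.1 * τ p.2) p ∂slabMeasure R R' =
      planePair (cosCoeff hR n (W 0)) ψ + planePair (cosCoeff hR n (U 2)) (planeDeriv 1 ψ) +
        (slabFreq R R' n : ℂ) * planePair (sinCoeff hR n (U 1)) ψ := by
    rw [← e1, ← e2, ← e3, ← integral_const_mul, ← integral_add i1 i2, ← integral_add i12 i3']
    refine integral_congr_ae ?_
    filter_upwards [ae_slabMeasure_mem] with p hp
    rw [slabDeriv_product h, heightDeriv_product ψ hτ, hτd _ hp, hτe _ ⟨hp.1.le, hp.2.le⟩,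
      deriv_slabCos]
    push_cast; ring
  have hr : ∀ (x : Lp ℂ 2 (volume : Measure E2)) (t : ℝ), t ∈ Set.Icc R R' →
      ∫ y, x y * ((ψ y * τ t : ℝ) : ℂ) = slabCos R R' n t * planePair x ψ := by
    intro x t ht
    rw [planePair, ← integral_const_mul, hτe t ht]
    refine integral_congr_ae (Filter.Eventually.of_forall fun y => ?_)
    push_cast; ring
  rw [hl] at heq
  simp only [hr _ R ⟨le_rfl, hR.le⟩, hr _ R' ⟨hR.le, le_rfl⟩, slabCos_left] at heq
  have hcont := h.continuous
  rw [boundaryTerm, planePair_add _ _ hcont hc, planePair_add _ _ hcont hc,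
    planePair_sub _ _ hcont hc, planePair_smul, planePair_smul, planePair_zero]
  push_cast at heq
  linear_combination heq

/-- The same computation with the horizontal directions exchanged; the overall sign is reversed so
that the boundary term takes the same form. -/
lemma SlabSystem.plane_curl_one (hR : R < R') (hs : SlabSystem R R' U W D G G') (n : ℤ) :
    IsPlaneDiv (cosCoeff hR n (U 2)) (0 : Lp ℂ 2 (volume : Measure E2))
      (-cosCoeff hR n (W 1) + (slabFreq R R' n : ℂ) • sinCoeff hR n (U 0) +
        boundaryTerm R R' n (G 0) (G' 0) : Lp ℂ 2 (volume : Measure E2)) := by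
  rw [isPlaneDiv_iff]
  intro ψ h hc
  obtain ⟨τ, hτ, hτc, hτe, hτd⟩ := exists_compactSupport_eqOn hR
    (contDiff_slabCos (R := R) (R' := R') n)
  have heq := hs.curl_one _ (contDiff_product h hτ) (hasCompactSupport_product hc hτc)
  obtain ⟨i1, e1⟩ := integral_product_cos hR n (W 1) h.continuous hc
  obtain ⟨i2, e2⟩ := integral_product_cos hR n (U 2) (continuous_planeDeriv h 0)
    (hasCompactSupport_planeDeriv hc 0)
  obtain ⟨i3, e3⟩ := integral_product_sin hR n (U 0) h.continuous hc
  have i3' := i3.const_mul (slabFreq R R' n : ℂ)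
  have i12 : Integrable (fun p => W 1 p * ((ψ p.1 * slabCos R R' n p.2 : ℝ) : ℂ) -
      U 2 p * ((planeDeriv 0 ψ p.1 * slabCos R R' n p.2 : ℝ) : ℂ)) (slabMeasure R R') := i1.sub i2
  have hl : ∫ p, W 1 p * ((ψ p.1 * τ p.2 : ℝ) : ℂ) +
      U 0 p * heightDeriv (fun p => ψ p.1 * τ p.2) p -
      U 2 p * slabDeriv 0 (fun p => ψ p.1 * τ p.2) p ∂slabMeasure R R' =
      planePair (cosCoeff hR n (W 1)) ψ - planePair (cosCoeff hR n (U 2)) (planeDeriv 0 ψ) -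
        (slabFreq R R' n : ℂ) * planePair (sinCoeff hR n (U 0)) ψ := by
    rw [← e1, ← e2, ← e3, ← integral_const_mul, ← integral_sub i1 i2, ← integral_sub i12 i3']
    refine integral_congr_ae ?_
    filter_upwards [ae_slabMeasure_mem] with p hp
    rw [slabDeriv_product h, heightDeriv_product ψ hτ, hτd _ hp, hτe _ ⟨hp.1.le, hp.2.le⟩,
      deriv_slabCos]
    push_cast; ring
  have hr : ∀ (x : Lp ℂ 2 (volume : Measure E2)) (t : ℝ), t ∈ Set.Icc R R' →
      ∫ y, x y * ((ψ y * τ t : ℝ) : ℂ) = slabCos R R' n t * planePair x ψ := by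
    intro x t ht
    rw [planePair, ← integral_const_mul, hτe t ht]
    refine integral_congr_ae (Filter.Eventually.of_forall fun y => ?_)
    push_cast; ring
  rw [hl] at heq
  simp only [hr _ R ⟨le_rfl, hR.le⟩, hr _ R' ⟨hR.le, le_rfl⟩, slabCos_left] at heq
  have hcont := h.continuous
  rw [boundaryTerm, planePair_add _ _ hcont hc, planePair_add _ _ hcont hc,
    planePair_sub _ _ hcont hc, planePair_smul, planePair_smul, planePair_zero, planePair_neg]
  push_cast at heq
  linear_combination -heq

/-- This component contains no vertical derivative, so sine modes stay sine modes. -/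
lemma SlabSystem.plane_curl_two (hR : R < R') (hs : SlabSystem R R' U W D G G') (n : ℤ) :
    IsPlaneDiv (sinCoeff hR n (U 1)) (-sinCoeff hR n (U 0) : Lp ℂ 2 (volume : Measure E2))
      (sinCoeff hR n (W 2)) := by
  rw [isPlaneDiv_iff]
  intro ψ h hc
  obtain ⟨τ, hτ, hτc, hτe, hτd⟩ := exists_compactSupport_eqOn hR
    (contDiff_slabSin (R := R) (R' := R') n)
  have heq := hs.curl_two _ (contDiff_product h hτ) (hasCompactSupport_product hc hτc)
  obtain ⟨i1, e1⟩ := integral_product_sin hR n (W 2) h.continuous hc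
  obtain ⟨i2, e2⟩ := integral_product_sin hR n (U 1) (continuous_planeDeriv h 0)
    (hasCompactSupport_planeDeriv hc 0)
  obtain ⟨i3, e3⟩ := integral_product_sin hR n (U 0) (continuous_planeDeriv h 1)
    (hasCompactSupport_planeDeriv hc 1)
  have i12 : Integrable (fun p => W 2 p * ((ψ p.1 * slabSin R R' n p.2 : ℝ) : ℂ) +
      U 1 p * ((planeDeriv 0 ψ p.1 * slabSin R R' n p.2 : ℝ) : ℂ)) (slabMeasure R R') := i1.add i2
  rw [planePair_neg, ← e1, ← e2, ← e3, ← sub_eq_add_neg, ← add_sub_assoc, ← integral_add i1 i2,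
    ← integral_sub i12 i3, ← heq]
  refine integral_congr_ae ?_
  filter_upwards [ae_slabMeasure_mem] with p hp
  rw [slabDeriv_product h, slabDeriv_product h, hτe _ ⟨hp.1.le, hp.2.le⟩]

/-- The sine is a bounded limit, together with its derivative, of functions supported inside (R,
R'), hence admissible. Its derivative k cos involves the cosine modes of `U 2`, the same ones as in
the curl equations, so the system for one mode is closed. -/
lemma SlabSystem.plane_div (hR : R < R') (hs : SlabSystem R R' U W D G G') (n : ℤ) :
    IsPlaneDiv (sinCoeff hR n (U 0)) (sinCoeff hR n (U 1))
      (sinCoeff hR n D + (slabFreq R R' n : ℂ) • cosCoeff hR n (U 2) :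
        Lp ℂ 2 (volume : Measure E2)) := by
  rw [isPlaneDiv_iff]
  intro ψ h hc
  obtain ⟨τ, hτ, hτs, hτc, ⟨C, hC⟩, hτl⟩ := slabSin_approximation hR n
  have hcont := h.continuous
  obtain ⟨i0, e0⟩ := integral_product_sin hR n (U 0) (continuous_planeDeriv h 0)
    (hasCompactSupport_planeDeriv hc 0)
  obtain ⟨i1, e1⟩ := integral_product_sin hR n (U 1) (continuous_planeDeriv h 1)
    (hasCompactSupport_planeDeriv hc 1)
  obtain ⟨i2, e2⟩ := integral_product_cos hR n (U 2) hcont hc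
  obtain ⟨i3, e3⟩ := integral_product_sin hR n D hcont hc
  have i2' := i2.const_mul (slabFreq R R' n : ℂ)
  have hone : ∀ t : ℝ, |(fun _ => (1 : ℝ)) t| ≤ 1 := fun t => by simp
  have b0 := (integrable_slab_product (U 0) (continuous_planeDeriv h 0)
    (hasCompactSupport_planeDeriv hc 0) continuous_const hone).norm.const_mul C
  have b1 := (integrable_slab_product (U 1) (continuous_planeDeriv h 1)
    (hasCompactSupport_planeDeriv hc 1) continuous_const hone).norm.const_mul C
  have b2 := (integrable_slab_product (U 2) hcont hc continuous_const hone).norm.const_mul C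
  have b3 := (integrable_slab_product D hcont hc continuous_const hone).norm.const_mul C
  have hz : ∀ m, ∫ p, D p * ((ψ p.1 * τ m p.2 : ℝ) : ℂ) +
      (U 0 p * ((planeDeriv 0 ψ p.1 * τ m p.2 : ℝ) : ℂ) +
        U 1 p * ((planeDeriv 1 ψ p.1 * τ m p.2 : ℝ) : ℂ) +
        U 2 p * ((ψ p.1 * deriv (τ m) p.2 : ℝ) : ℂ)) ∂slabMeasure R R' = 0 := by
    intro m
    rw [← hs.div _ (contDiff_product h (hτ m)) (hasCompactSupport_product hc (hτc m))
      ((tsupport_product_subset _ _).trans (Set.prod_mono (Set.subset_univ _) (hτs m)))]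
    refine integral_congr_ae (Filter.Eventually.of_forall fun p => ?_)
    simp only
    rw [slabDeriv_product h, slabDeriv_product h, heightDeriv_product ψ (hτ m)]
  have hbound : ∀ (z : ℂ) (a r : ℝ), |r| ≤ C →
      ‖z * ((a * r : ℝ) : ℂ)‖ ≤ C * ‖z * ((a * (fun _ : ℝ => (1 : ℝ)) 0 : ℝ) : ℂ)‖ := by
    intro z a r hr
    rw [norm_mul, norm_mul, Complex.norm_real, Complex.norm_real, norm_mul, mul_one]
    calc ‖z‖ * (‖a‖ * ‖r‖) = ‖r‖ * (‖z‖ * ‖a‖) := by ring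
      _ ≤ _ := mul_le_mul_of_nonneg_right hr (by positivity)
  have hlim := tendsto_integral_of_dominated_convergence (μ := slabMeasure R R')
    (F := fun m p => D p * ((ψ p.1 * τ m p.2 : ℝ) : ℂ) +
      (U 0 p * ((planeDeriv 0 ψ p.1 * τ m p.2 : ℝ) : ℂ) +
        U 1 p * ((planeDeriv 1 ψ p.1 * τ m p.2 : ℝ) : ℂ) +
        U 2 p * ((ψ p.1 * deriv (τ m) p.2 : ℝ) : ℂ)))
    (f := fun p => D p * ((ψ p.1 * slabSin R R' n p.2 : ℝ) : ℂ) +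
      (U 0 p * ((planeDeriv 0 ψ p.1 * slabSin R R' n p.2 : ℝ) : ℂ) +
        U 1 p * ((planeDeriv 1 ψ p.1 * slabSin R R' n p.2 : ℝ) : ℂ) +
        U 2 p * ((ψ p.1 * (slabFreq R R' n * slabCos R R' n p.2) : ℝ) : ℂ)))
    _ ?_ (b3.add ((b0.add b1).add b2)) ?_ ?_
  · simp_rw [hz] at hlim
    have hval := tendsto_nhds_unique hlim tendsto_const_nhds
    have i01 : Integrable (fun p => U 0 p * ((planeDeriv 0 ψ p.1 * slabSin R R' n p.2 : ℝ) : ℂ) +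
        U 1 p * ((planeDeriv 1 ψ p.1 * slabSin R R' n p.2 : ℝ) : ℂ)) (slabMeasure R R') := i0.add i1
    have i012 : Integrable (fun p => U 0 p * ((planeDeriv 0 ψ p.1 * slabSin R R' n p.2 : ℝ) : ℂ) +
        U 1 p * ((planeDeriv 1 ψ p.1 * slabSin R R' n p.2 : ℝ) : ℂ) +
        (slabFreq R R' n : ℂ) * (U 2 p * ((ψ p.1 * slabCos R R' n p.2 : ℝ) : ℂ)))
        (slabMeasure R R') := i01.add i2'
    rw [planePair_add _ _ hcont hc, planePair_smul, ← e0, ← e1, ← e2, ← e3, add_assoc,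
      add_comm (_ * _), ← integral_const_mul, ← integral_add i0 i1, ← integral_add i01 i2',
      ← integral_add i3 i012, ← hval]
    refine integral_congr_ae (Filter.Eventually.of_forall fun p => ?_)
    push_cast; ring
  · intro m
    have hm := hτ m
    have hmd : Continuous (deriv (τ m)) := hm.continuous_deriv (by simp)
    have c0 := integrable_slab_product (U 0) (continuous_planeDeriv h 0)
      (hasCompactSupport_planeDeriv hc 0) hm.continuous (fun t => (hC m t).1)
    have c1 := integrable_slab_product (U 1) (continuous_planeDeriv h 1)
      (hasCompactSupport_planeDeriv hc 1) hm.continuous (fun t => (hC m t).1)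
    have c2 := integrable_slab_product (U 2) hcont hc hmd (fun t => (hC m t).2)
    have c3 := integrable_slab_product D hcont hc hm.continuous (fun t => (hC m t).1)
    exact (c3.add ((c0.add c1).add c2)).aestronglyMeasurable
  · intro m
    refine Filter.Eventually.of_forall fun p => ?_
    have n0 := hbound (U 0 p) (planeDeriv 0 ψ p.1) _ (hC m p.2).1
    have n1 := hbound (U 1 p) (planeDeriv 1 ψ p.1) _ (hC m p.2).1
    have n2 := hbound (U 2 p) (ψ p.1) _ (hC m p.2).2
    have n3 := hbound (D p) (ψ p.1) _ (hC m p.2).1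
    exact (norm_add_le _ _).trans (add_le_add n3 ((norm_add_le _ _).trans
      (add_le_add ((norm_add_le _ _).trans (add_le_add n0 n1)) n2)))
  · filter_upwards [ae_slabMeasure_mem] with p hp
    obtain ⟨l1, l2⟩ := hτl p.2 hp
    have hcast : ∀ (z : ℂ) (a : ℝ) {x : ℕ → ℝ} {l : ℝ}, Filter.Tendsto x Filter.atTop (nhds l) →
        Filter.Tendsto (fun m => z * ((a * x m : ℝ) : ℂ)) Filter.atTop
          (nhds (z * ((a * l : ℝ) : ℂ))) := fun z a x l hx =>
      ((Complex.continuous_ofReal.tendsto _).comp (hx.const_mul a)).const_mul z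
    exact (hcast _ _ l1).add (((hcast _ _ l1).add (hcast _ _ l1)).add (hcast _ _ l2))

end PlaneEquations

/-! ### Algebra of a single mode and summation of the multiplier. -/

section Multiplier

lemma enorm_sq_eq_ofReal {F : Type*} [NormedAddCommGroup F] (z : F) :
    ‖z‖ₑ ^ 2 = ENNReal.ofReal (‖z‖ ^ 2) := by
  rw [ENNReal.ofReal_pow (norm_nonneg _), ofReal_norm]

/-- With x = δ(n + 1), the inequality (r + x)² ≤ 2(r² + x²) gives 1/(r² + x²) ≤ 2/((r + x - δ)(r +
x)), and the right-hand side telescopes. -/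
lemma sum_multiplier_le {r δ : ℝ} (hr : 0 < r) (hδ : 0 < δ) (N : ℕ) :
    ∑ n ∈ Finset.range N, r ^ 2 / (r ^ 2 + (δ * ((n : ℝ) + 1)) ^ 2) ≤
      2 * r ^ 2 / δ * (1 / r - 1 / (r + δ * N)) := by
  induction N with
  | zero => simp
  | succ N ih =>
    rw [Finset.sum_range_succ]
    have hN : (0 : ℝ) ≤ N := N.cast_nonneg
    have h1 : r ^ 2 / (r ^ 2 + (δ * ((N : ℝ) + 1)) ^ 2) ≤
        2 * r ^ 2 / δ * (1 / (r + δ * N) - 1 / (r + δ * (N + 1))) := by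
      have e : 2 * r ^ 2 / δ * (1 / (r + δ * N) - 1 / (r + δ * (N + 1))) =
          r ^ 2 * (2 / ((r + δ * N) * (r + δ * (N + 1)))) := by
        have a1 : r + δ * N ≠ 0 := by positivity
        have a2 : r + δ * (N + 1) ≠ 0 := by positivity
        field_simp
        ring
      rw [e, div_eq_mul_inv]
      refine mul_le_mul_of_nonneg_left ?_ (by positivity)
      rw [inv_eq_one_div, div_le_div_iff₀ (by positivity) (by positivity)]
      nlinarith [sq_nonneg (r - δ * (N + 1)), mul_pos hδ hr,
        mul_nonneg hδ.le (mul_nonneg hδ.le hN)]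
    push_cast
    calc _ ≤ 2 * r ^ 2 / δ * (1 / r - 1 / (r + δ * N)) +
          2 * r ^ 2 / δ * (1 / (r + δ * N) - 1 / (r + δ * (N + 1))) := add_le_add ih h1
      _ = _ := by ring

lemma tsum_multiplier_nat_le {r δ : ℝ} (hr : 0 ≤ r) (hδ : 0 < δ) :
    ∑' n : ℕ, ENNReal.ofReal (r ^ 2 / (r ^ 2 + (δ * ((n : ℝ) + 1)) ^ 2)) ≤
      ENNReal.ofReal (2 * r / δ) := by
  refine ENNReal.tsum_le_of_sum_range_le fun N => ?_
  rw [← ENNReal.ofReal_sum_of_nonneg fun n _ => by positivity]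
  refine ENNReal.ofReal_le_ofReal ?_
  rcases hr.eq_or_lt with rfl | hr
  · simp
  · refine (sum_multiplier_le hr hδ N).trans ?_
    have h1 : 0 ≤ 1 / (r + δ * N) := by positivity
    calc 2 * r ^ 2 / δ * (1 / r - 1 / (r + δ * N)) ≤ 2 * r ^ 2 / δ * (1 / r) := by
          gcongr; linarith
      _ = 2 * r / δ := by field_simp

/-- The term n = 0 is at most 1 (it is 0 when r = 0, by the convention for division by zero), and
the positive and negative n contribute at most 2r/δ each. -/
lemma tsum_multiplier_int_le {r δ : ℝ} (hr : 0 ≤ r) (hδ : 0 < δ) :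
    ∑' n : ℤ, ENNReal.ofReal (r ^ 2 / (r ^ 2 + (δ * (n : ℝ)) ^ 2)) ≤
      ENNReal.ofReal (1 + 4 * r / δ) := by
  set f : ℤ → ℝ≥0∞ := fun n => ENNReal.ofReal (r ^ 2 / (r ^ 2 + (δ * (n : ℝ)) ^ 2)) with hf
  have h1 := (HasSum.of_nat_of_neg_add_one (f := f) ENNReal.summable.hasSum
    ENNReal.summable.hasSum).tsum_eq
  have h2 : ∑' n : ℕ, f (-((n : ℤ) + 1)) ≤ ENNReal.ofReal (2 * r / δ) := by
    refine le_trans (le_of_eq (tsum_congr fun n => ?_)) (tsum_multiplier_nat_le hr hδ)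
    simp only [hf]
    push_cast
    congr 3
    ring
  have h3 : ∑' n : ℕ, f (n : ℤ) ≤ ENNReal.ofReal 1 + ENNReal.ofReal (2 * r / δ) := by
    rw [tsum_eq_zero_add' ENNReal.summable]
    refine add_le_add (ENNReal.ofReal_le_ofReal (div_le_one_of_le₀ ?_ (by positivity)))
      (le_trans (le_of_eq (tsum_congr fun n => ?_)) (tsum_multiplier_nat_le hr hδ))
    · nlinarith [sq_nonneg (δ * ((0 : ℕ) : ℤ))]
    · simp only [hf]
      push_cast
      rfl
  rw [h1]
  refine (add_le_add h3 h2).trans (le_of_eq ?_)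
  rw [← ENNReal.ofReal_add (by positivity) (by positivity),
    ← ENNReal.ofReal_add (by positivity) (by positivity)]
  congr 1
  ring

/-- This is where the half derivative comes from: about r terms of the sum have size comparable to
1. Here δ = π/(R' - R), and 4/π is estimated by 4. -/
lemma tsum_slabFreq_multiplier_le {R R' : ℝ} (hR : R < R') {r : ℝ} (hr : 0 ≤ r) :
    ∑' n : ℤ, ENNReal.ofReal (r ^ 2 / (r ^ 2 + slabFreq R R' n ^ 2)) ≤
      ENNReal.ofReal ((1 + 4 * (R' - R)) * √(1 + r ^ 2)) := by
  have hL : 0 < R' - R := by linarith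
  have h := tsum_multiplier_int_le hr (div_pos Real.pi_pos hL)
  have e : ∀ n : ℤ, Real.pi / (R' - R) * n = slabFreq R R' n := fun n => by
    unfold slabFreq; ring
  simp_rw [e] at h
  refine h.trans (ENNReal.ofReal_le_ofReal ?_)
  have h1 : 1 ≤ √(1 + r ^ 2) := Real.one_le_sqrt.mpr (by nlinarith [sq_nonneg r])
  have h2 : r ≤ √(1 + r ^ 2) := Real.le_sqrt_of_sq_le (by linarith)
  have h3 : 4 * r / (Real.pi / (R' - R)) ≤ 4 * (R' - R) * r := by
    rw [div_div_eq_mul_div, div_le_iff₀ Real.pi_pos]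
    have : 0 ≤ 4 * (R' - R) * r := by positivity
    nlinarith [Real.pi_gt_three]
  have h4 : 4 * (R' - R) * r ≤ 4 * (R' - R) * √(1 + r ^ 2) := by gcongr
  linarith

/-- The Fourier version of |p × a|² + |p · a|² = |p|²|a|². The vertical derivative acts as a real
factor ±k because it exchanges sines and cosines; with these signs all mixed terms cancel. -/
lemma mode_identity {a₀ a₁ a₂ x₀ x₁ w d : ℂ} {ξ₀ ξ₁ k : ℝ}
    (h0 : x₀ = Complex.I * ξ₀ * a₂ - k * a₀) (h1 : x₁ = Complex.I * ξ₁ * a₂ - k * a₁)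
    (h2 : w = Complex.I * (ξ₀ * a₁ - ξ₁ * a₀))
    (h3 : d = Complex.I * (ξ₀ * a₀ + ξ₁ * a₁) - k * a₂) :
    ‖x₀‖ ^ 2 + ‖x₁‖ ^ 2 + ‖w‖ ^ 2 + ‖d‖ ^ 2 =
      (ξ₀ ^ 2 + ξ₁ ^ 2 + k ^ 2) * (‖a₀‖ ^ 2 + ‖a₁‖ ^ 2 + ‖a₂‖ ^ 2) := by
  subst h0 h1 h2 h3
  simp only [Complex.sq_norm, Complex.normSq_apply, Complex.sub_re, Complex.sub_im, Complex.mul_re,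
    Complex.mul_im, Complex.add_re, Complex.add_im, Complex.I_re, Complex.I_im, Complex.ofReal_re,
    Complex.ofReal_im]
  ring

lemma norm_add_sq_le_two (z w : ℂ) : ‖z + w‖ ^ 2 ≤ 2 * ‖z‖ ^ 2 + 2 * ‖w‖ ^ 2 := by
  have h := norm_add_le z w
  have h0 := norm_nonneg (z + w)
  nlinarith [sq_nonneg (‖z‖ - ‖w‖)]

lemma norm_sub_sq_le_two (z w : ℂ) : ‖z - w‖ ^ 2 ≤ 2 * ‖z‖ ^ 2 + 2 * ‖w‖ ^ 2 := by
  have h := norm_add_sq_le_two z (-w)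
  rwa [norm_neg, ← sub_eq_add_neg] at h

/-- The boundary data and the curl enter the right-hand sides of `mode_identity` together. Splitting
them off with |z + w|² ≤ 2|z|² + 2|w|² costs a factor 2 for the curl, and a second splitting a
factor 4 for the two traces. The multiplier is kept on the traces only and bounded by 1 elsewhere.
-/
lemma mode_estimate {a₀ a₁ a₂ w₀ w₁ w₂ d g₀ g₁ g₀' g₁' : ℂ} {ξ₀ ξ₁ k c : ℝ} (hc : |c| ≤ 1)
    (h0 : -w₁ + k * a₀ + (c * g₀' - g₀) = Complex.I * ξ₀ * a₂)
    (h1 : w₀ + k * a₁ + (c * g₁' - g₁) = Complex.I * ξ₁ * a₂)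
    (h2 : w₂ = Complex.I * (ξ₀ * a₁ - ξ₁ * a₀))
    (h3 : d + k * a₂ = Complex.I * (ξ₀ * a₀ + ξ₁ * a₁)) :
    (ξ₀ ^ 2 + ξ₁ ^ 2) * (‖a₀‖ ^ 2 + ‖a₁‖ ^ 2 + ‖a₂‖ ^ 2) ≤
      2 * ‖w₀‖ ^ 2 + 2 * ‖w₁‖ ^ 2 + ‖w₂‖ ^ 2 + ‖d‖ ^ 2 +
        4 * ((ξ₀ ^ 2 + ξ₁ ^ 2) / (ξ₀ ^ 2 + ξ₁ ^ 2 + k ^ 2) *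
          (‖g₀‖ ^ 2 + ‖g₁‖ ^ 2 + (‖g₀'‖ ^ 2 + ‖g₁'‖ ^ 2))) := by
  set s := ξ₀ ^ 2 + ξ₁ ^ 2 with hs
  have hs0 : 0 ≤ s := by positivity
  -- If |ξ|² + k² = 0, there is nothing to divide by, but the left-hand side is zero.
  rcases (add_nonneg hs0 (sq_nonneg k)).eq_or_lt with hz | hpos
  · have : s = 0 := by nlinarith [sq_nonneg k]
    rw [this]; simp only [zero_mul, zero_div, mul_zero, add_zero]; positivity
  have key := mode_identity (x₀ := c * g₀' - g₀ - w₁) (x₁ := c * g₁' - g₁ + w₀) (w := w₂) (d := d)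
    (a₀ := a₀) (a₁ := a₁) (a₂ := a₂) (ξ₀ := ξ₀) (ξ₁ := ξ₁) (k := k)
    (by linear_combination h0) (by linear_combination h1) h2 (by linear_combination h3)
  set A := ‖a₀‖ ^ 2 + ‖a₁‖ ^ 2 + ‖a₂‖ ^ 2 with hA
  set Γ := ‖g₀‖ ^ 2 + ‖g₁‖ ^ 2 + (‖g₀'‖ ^ 2 + ‖g₁'‖ ^ 2) with hΓ
  have hcg : ∀ z : ℂ, ‖(c : ℂ) * z‖ ^ 2 ≤ ‖z‖ ^ 2 := by
    intro z
    rw [norm_mul, Complex.norm_real]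
    have := mul_le_of_le_one_left (norm_nonneg z) hc
    gcongr
    exact this
  have hx0 := norm_sub_sq_le_two (c * g₀' - g₀) w₁
  have hx1 := norm_add_sq_le_two (c * g₁' - g₁) w₀
  have hb0 := norm_sub_sq_le_two (c * g₀') g₀
  have hb1 := norm_sub_sq_le_two (c * g₁') g₁
  have hc0 := hcg g₀'
  have hc1 := hcg g₁'
  set Ω := 2 * ‖w₀‖ ^ 2 + 2 * ‖w₁‖ ^ 2 + ‖w₂‖ ^ 2 + ‖d‖ ^ 2 with hΩ
  have hΩ0 : 0 ≤ Ω := by positivity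
  have hsum : (s + k ^ 2) * A ≤ Ω + 4 * Γ := by rw [← key]; linarith
  have hρ1 : s / (s + k ^ 2) ≤ 1 := div_le_one_of_le₀ (by nlinarith [sq_nonneg k]) hpos.le
  have hρ0 : 0 ≤ s / (s + k ^ 2) := by positivity
  calc s * A = s / (s + k ^ 2) * ((s + k ^ 2) * A) := by field_simp
    _ ≤ s / (s + k ^ 2) * (Ω + 4 * Γ) := by gcongr
    _ = s / (s + k ^ 2) * Ω + 4 * (s / (s + k ^ 2) * Γ) := by ring
    _ ≤ Ω + 4 * (s / (s + k ^ 2) * Γ) := by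
        have := mul_le_of_le_one_left hΩ0 hρ1
        linarith

end Multiplier

/-! ### Plancherel's theorem and weak derivatives on the plane. -/

section Plancherel

/-- The Fourier transform on `L²(ℝ²)`. -/
noncomputable abbrev planeHat (x : Lp ℂ 2 (volume : Measure E2)) :
    Lp ℂ 2 (volume : Measure E2) := 𝓕 x

lemma l2Sq_planeHat (x : Lp ℂ 2 (volume : Measure E2)) :
    l2Sq volume (planeHat x) = l2Sq volume x := by
  rw [← ENNReal.toReal_eq_toReal_iff' (MemLp.l2Sq_lt_top (Lp.memLp _)).ne
    (MemLp.l2Sq_lt_top (Lp.memLp _)).ne, ← Lp_norm_sq, ← Lp_norm_sq, Lp.norm_fourier_eq]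

lemma planeHat_add (x z : Lp ℂ 2 (volume : Measure E2)) :
    planeHat (x + z) = planeHat x + planeHat z := FourierTransform.fourier_add x z

lemma planeHat_smul (c : ℂ) (x : Lp ℂ 2 (volume : Measure E2)) :
    planeHat (c • x) = c • planeHat x := FourierTransform.fourier_smul c x

lemma planeHat_neg (x : Lp ℂ 2 (volume : Measure E2)) : planeHat (-x) = -planeHat x :=
  (Lp.fourierTransformₗᵢ E2 ℂ).map_neg x

lemma planeHat_sub (x z : Lp ℂ 2 (volume : Measure E2)) :
    planeHat (x - z) = planeHat x - planeHat z := (Lp.fourierTransformₗᵢ E2 ℂ).map_sub x z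

lemma planeHat_zero : planeHat 0 = 0 := (Lp.fourierTransformₗᵢ E2 ℂ).map_zero

/-- A square integrable function on the plane whose Fourier transform decays well enough has a weak
derivative. -/
lemma exists_weak_planeDeriv (x : Lp ℂ 2 (volume : Measure E2)) (i : Fin 2)
    (h : l2Sq volume (fun η : E2 => 2 * Real.pi * Complex.I * (η i * planeHat x η)) ≠ ⊤) :
    ∃ b : Lp ℂ 2 (volume : Measure E2),
      l2Sq volume b =
        l2Sq volume (fun η : E2 => 2 * Real.pi * Complex.I * (η i * planeHat x η)) ∧
      ∀ ψ : E2 → ℝ, ContDiff ℝ ∞ ψ → HasCompactSupport ψ →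
        planePair b ψ = -planePair x (planeDeriv i ψ) := by
  have hm : AEStronglyMeasurable
      (fun η : E2 => 2 * Real.pi * Complex.I * (η i * planeHat x η)) volume := by
    have hc : Continuous fun η : E2 => (η i : ℂ) := by fun_prop
    exact (hc.aestronglyMeasurable.mul (Lp.aestronglyMeasurable _)).const_mul _
  have hL := memLp_of_l2Sq_lt_top hm h.lt_top
  have hhat : planeHat (𝓕⁻ (hL.toLp _) : Lp ℂ 2 (volume : Measure E2)) = hL.toLp _ :=
    FourierTransform.fourier_fourierInv_eq _
  refine ⟨𝓕⁻ (hL.toLp _), ?_, fun ψ hψ hc => ?_⟩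
  · rw [← l2Sq_planeHat, hhat]
    exact l2Sq_congr_ae hL.coeFn_toLp
  · have hz := Lp.coeFn_zero ℂ 2 (volume : Measure E2)
    -- A derivative in one direction is the divergence of the field with `x` in that slot and 0 in
    -- the other.
    fin_cases i
    · have hd : IsPlaneDiv x (0 : Lp ℂ 2 (volume : Measure E2))
          (𝓕⁻ (hL.toLp _) : Lp ℂ 2 (volume : Measure E2)) := by
        refine isPlaneDiv_of_fourier ?_
        change ∀ᵐ η, planeHat _ η = planeSymbol (planeHat x) (planeHat 0) η
        rw [hhat, planeHat_zero]
        filter_upwards [hL.coeFn_toLp, hz] with η h1 h2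
        rw [h1, planeSymbol, h2]
        simp
      have := isPlaneDiv_iff.mp hd ψ hψ hc
      rw [planePair_zero, add_zero] at this
      exact eq_neg_of_add_eq_zero_left this
    · have hd : IsPlaneDiv (0 : Lp ℂ 2 (volume : Measure E2)) x
          (𝓕⁻ (hL.toLp _) : Lp ℂ 2 (volume : Measure E2)) := by
        refine isPlaneDiv_of_fourier ?_
        change ∀ᵐ η, planeHat _ η = planeSymbol (planeHat 0) (planeHat x) η
        rw [hhat, planeHat_zero]
        filter_upwards [hL.coeFn_toLp, hz] with η h1 h2
        rw [h1, planeSymbol, h2]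
        simp
      have := isPlaneDiv_iff.mp hd ψ hψ hc
      rw [planePair_zero, zero_add] at this
      exact eq_neg_of_add_eq_zero_left this

end Plancherel

/-! ### The estimate of the horizontal derivatives. -/

section Estimate

variable {R R' : ℝ} {U W : Fin 3 → Lp ℂ 2 (slabMeasure R R')} {D : Lp ℂ 2 (slabMeasure R R')}
  {G G' : Fin 2 → Lp ℂ 2 (volume : Measure E2)}

/-- The density `|ĝ|²` of the boundary data. -/
noncomputable def traceDensity (G G' : Fin 2 → Lp ℂ 2 (volume : Measure E2)) (η : E2) : ℝ≥0∞ :=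
  ∑ i, ‖planeHat (G i) η‖ₑ ^ 2 + ∑ i, ‖planeHat (G' i) η‖ₑ ^ 2

/-- The square of the `H^{1/2}` norm of the boundary data. -/
noncomputable def traceSq (G G' : Fin 2 → Lp ℂ 2 (volume : Measure E2)) : ℝ≥0∞ :=
  ∫⁻ η : E2, ENNReal.ofReal (√(1 + (2 * Real.pi * ‖η‖) ^ 2)) * traceDensity G G' η

/-- The coefficients of the components of `u`, for the sine family in the first two components
and the cosine family in the third one. -/
noncomputable def modeCoeff (hR : R < R') (n : ℤ) (U : Fin 3 → Lp ℂ 2 (slabMeasure R R'))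
    (j : Fin 3) : Lp ℂ 2 (volume : Measure E2) :=
  ![sinCoeff hR n (U 0), sinCoeff hR n (U 1), cosCoeff hR n (U 2)] j

/-- The density of the `n`-th mode of the curl and the divergence. -/
noncomputable def modeDensity (hR : R < R') (n : ℤ) (W : Fin 3 → Lp ℂ 2 (slabMeasure R R'))
    (D : Lp ℂ 2 (slabMeasure R R')) (η : E2) : ℝ≥0∞ :=
  ‖planeHat (cosCoeff hR n (W 0)) η‖ₑ ^ 2 + ‖planeHat (cosCoeff hR n (W 1)) η‖ₑ ^ 2 +
    ‖planeHat (sinCoeff hR n (W 2)) η‖ₑ ^ 2 + ‖planeHat (sinCoeff hR n D) η‖ₑ ^ 2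

/-- The real estimate is used with ξ = 2πη. Passing to [0, ∞] allows sums over modes and integrals
over frequencies to be exchanged before anything is known to be finite. -/
lemma mode_estimate_enorm {a₀ a₁ a₂ w₀ w₁ w₂ d g₀ g₁ g₀' g₁' : ℂ} {k c : ℝ} (η : E2)
    (hcos : |c| ≤ 1) (h0 : -w₁ + k * a₀ + (c * g₀' - g₀) = 2 * Real.pi * Complex.I * (η 0 * a₂))
    (h1 : w₀ + k * a₁ + (c * g₁' - g₁) = 2 * Real.pi * Complex.I * (η 1 * a₂))
    (h2 : w₂ = 2 * Real.pi * Complex.I * (η 0 * a₁ - η 1 * a₀))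
    (h3 : d + k * a₂ = 2 * Real.pi * Complex.I * (η 0 * a₀ + η 1 * a₁)) (i : Fin 2) (j : Fin 3) :
    ‖2 * Real.pi * Complex.I * (η i * ![a₀, a₁, a₂] j)‖ₑ ^ 2 ≤
      2 * (‖w₀‖ₑ ^ 2 + ‖w₁‖ₑ ^ 2 + ‖w₂‖ₑ ^ 2 + ‖d‖ₑ ^ 2) +
        4 * (ENNReal.ofReal ((2 * Real.pi * ‖η‖) ^ 2 / ((2 * Real.pi * ‖η‖) ^ 2 + k ^ 2)) *
          (‖g₀‖ₑ ^ 2 + ‖g₁‖ₑ ^ 2 + (‖g₀'‖ₑ ^ 2 + ‖g₁'‖ₑ ^ 2))) := by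
  have key := mode_estimate (ξ₀ := 2 * Real.pi * η 0) (ξ₁ := 2 * Real.pi * η 1) (k := k) hcos
    (a₀ := a₀) (a₁ := a₁) (a₂ := a₂) (w₀ := w₀) (w₁ := w₁) (w₂ := w₂) (d := d)
    (g₀ := g₀) (g₁ := g₁) (g₀' := g₀') (g₁' := g₁')
    (by push_cast; linear_combination h0) (by push_cast; linear_combination h1)
    (by push_cast; linear_combination h2) (by push_cast; linear_combination h3)
  have hη : (2 * Real.pi * ‖η‖) ^ 2 = (2 * Real.pi * η 0) ^ 2 + (2 * Real.pi * η 1) ^ 2 := by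
    rw [mul_pow _ ‖η‖, EuclideanSpace.norm_sq_eq, Fin.sum_univ_two, Real.norm_eq_abs,
      Real.norm_eq_abs, sq_abs, sq_abs]
    ring
  rw [← hη] at key
  have hL : ‖2 * Real.pi * Complex.I * (η i * ![a₀, a₁, a₂] j)‖ ^ 2 ≤
      (2 * Real.pi * ‖η‖) ^ 2 * (‖a₀‖ ^ 2 + ‖a₁‖ ^ 2 + ‖a₂‖ ^ 2) := by
    have hi : |η i| ≤ ‖η‖ := PiLp.norm_apply_le η i
    have hjj : ‖![a₀, a₁, a₂] j‖ ^ 2 ≤ ‖a₀‖ ^ 2 + ‖a₁‖ ^ 2 + ‖a₂‖ ^ 2 := by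
      have h0 := sq_nonneg ‖a₀‖
      have h1 := sq_nonneg ‖a₁‖
      have h2 := sq_nonneg ‖a₂‖
      fin_cases j <;> simp <;> linarith
    calc _ = (2 * Real.pi * |η i|) ^ 2 * ‖![a₀, a₁, a₂] j‖ ^ 2 := by
          simp only [norm_mul, Complex.norm_real, Complex.norm_I, Real.norm_eq_abs,
            abs_of_pos Real.pi_pos, Complex.norm_ofNat]
          ring
      _ ≤ _ := by
          have := Real.pi_pos
          gcongr
  have hfin : ‖2 * Real.pi * Complex.I * (η i * ![a₀, a₁, a₂] j)‖ ^ 2 ≤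
      2 * (‖w₀‖ ^ 2 + ‖w₁‖ ^ 2 + ‖w₂‖ ^ 2 + ‖d‖ ^ 2) +
        4 * ((2 * Real.pi * ‖η‖) ^ 2 / ((2 * Real.pi * ‖η‖) ^ 2 + k ^ 2) *
          (‖g₀‖ ^ 2 + ‖g₁‖ ^ 2 + (‖g₀'‖ ^ 2 + ‖g₁'‖ ^ 2))) := by
    linarith [sq_nonneg ‖w₂‖, sq_nonneg ‖d‖]
  refine (enorm_sq_eq_ofReal _).trans_le ((ENNReal.ofReal_le_ofReal hfin).trans_eq ?_)
  simp only [enorm_sq_eq_ofReal]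
  rw [ENNReal.ofReal_add (by positivity) (by positivity), ENNReal.ofReal_mul (by positivity),
    ENNReal.ofReal_mul (by positivity), ENNReal.ofReal_mul (by positivity),
    ENNReal.ofReal_add (by positivity) (by positivity),
    ENNReal.ofReal_add (by positivity) (by positivity),
    ENNReal.ofReal_add (by positivity) (by positivity),
    ENNReal.ofReal_add (by positivity) (by positivity),
    ENNReal.ofReal_add (by positivity) (by positivity),
    ENNReal.ofReal_add (by positivity) (by positivity), ENNReal.ofReal_ofNat, ENNReal.ofReal_ofNat]

lemma ae_mode_estimate_of_eq {a₀ a₁ a₂ w₀ w₁ w₂ d g₀ g₁ g₀' g₁' : Lp ℂ 2 (volume : Measure E2)}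
    {k c : ℝ} (hcos : |c| ≤ 1)
    (e0 : ∀ᵐ η, (-w₁ + (k : ℂ) • a₀ + ((c : ℂ) • g₀' - g₀) : Lp ℂ 2 (volume : Measure E2)) η =
      planeSymbol a₂ (0 : Lp ℂ 2 (volume : Measure E2)) η)
    (e1 : ∀ᵐ η, (w₀ + (k : ℂ) • a₁ + ((c : ℂ) • g₁' - g₁) : Lp ℂ 2 (volume : Measure E2)) η =
      planeSymbol (0 : Lp ℂ 2 (volume : Measure E2)) a₂ η)
    (e2 : ∀ᵐ η, w₂ η = planeSymbol a₁ (-a₀ : Lp ℂ 2 (volume : Measure E2)) η)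
    (e3 : ∀ᵐ η, (d + (k : ℂ) • a₂ : Lp ℂ 2 (volume : Measure E2)) η = planeSymbol a₀ a₁ η)
    (i : Fin 2) (j : Fin 3) :
    ∀ᵐ η : E2, ‖2 * Real.pi * Complex.I * (η i * ![a₀ η, a₁ η, a₂ η] j)‖ₑ ^ 2 ≤
      2 * (‖w₀ η‖ₑ ^ 2 + ‖w₁ η‖ₑ ^ 2 + ‖w₂ η‖ₑ ^ 2 + ‖d η‖ₑ ^ 2) +
        4 * (ENNReal.ofReal ((2 * Real.pi * ‖η‖) ^ 2 / ((2 * Real.pi * ‖η‖) ^ 2 + k ^ 2)) *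
          (‖g₀ η‖ₑ ^ 2 + ‖g₁ η‖ₑ ^ 2 + (‖g₀' η‖ₑ ^ 2 + ‖g₁' η‖ₑ ^ 2))) := by
  filter_upwards [e0, e1, e2, e3, Lp.coeFn_zero ℂ 2 (volume : Measure E2),
    Lp.coeFn_add (-w₁ + (k : ℂ) • a₀) ((c : ℂ) • g₀' - g₀), Lp.coeFn_add (-w₁) ((k : ℂ) • a₀),
    Lp.coeFn_neg w₁, Lp.coeFn_smul (k : ℂ) a₀, Lp.coeFn_sub ((c : ℂ) • g₀') g₀,
    Lp.coeFn_smul (c : ℂ) g₀',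
    Lp.coeFn_add (w₀ + (k : ℂ) • a₁) ((c : ℂ) • g₁' - g₁), Lp.coeFn_add w₀ ((k : ℂ) • a₁),
    Lp.coeFn_smul (k : ℂ) a₁, Lp.coeFn_sub ((c : ℂ) • g₁') g₁, Lp.coeFn_smul (c : ℂ) g₁',
    Lp.coeFn_neg a₀, Lp.coeFn_add d ((k : ℂ) • a₂), Lp.coeFn_smul (k : ℂ) a₂]
    with η h0 h1 h2 h3 z f0 f1 f2 f3 f4 f5 q0 q1 q2 q3 q4 r s0 s1
  simp only [planeSymbol, f0, f1, f2, f3, f4, f5, q0, q1, q2, q3, q4, r, s0, s1, z, Pi.add_apply,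
    Pi.neg_apply, Pi.smul_apply, Pi.sub_apply, Pi.zero_apply, smul_eq_mul] at h0 h1 h2 h3
  exact mode_estimate_enorm η hcos (by linear_combination h0) (by linear_combination h1)
    (by linear_combination h2) (by linear_combination h3) i j

/-- The bound |cos| ≤ 1 has removed n from the boundary density, so that for this density the decay
in n is carried by the multiplier alone. -/
lemma SlabSystem.ae_mode_estimate (hR : R < R') (hs : SlabSystem R R' U W D G G') (n : ℤ)
    (i : Fin 2) (j : Fin 3) :
    ∀ᵐ η : E2, ‖2 * Real.pi * Complex.I * (η i * planeHat (modeCoeff hR n U j) η)‖ₑ ^ 2 ≤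
      2 * modeDensity hR n W D η +
        4 * (ENNReal.ofReal ((2 * Real.pi * ‖η‖) ^ 2 /
          ((2 * Real.pi * ‖η‖) ^ 2 + slabFreq R R' n ^ 2)) * traceDensity G G' η) := by
  have e0 := (hs.plane_curl_one hR n).fourier
  have e1 := (hs.plane_curl_zero hR n).fourier
  have e2 := (hs.plane_curl_two hR n).fourier
  have e3 := (hs.plane_div hR n).fourier
  simp only [boundaryTerm] at e0 e1
  change ∀ᵐ η, planeHat _ η = planeSymbol (planeHat _) (planeHat _) η at e0 e1 e2 e3
  rw [planeHat_add, planeHat_add, planeHat_sub, planeHat_neg, planeHat_smul, planeHat_smul,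
    planeHat_zero] at e0
  rw [planeHat_add, planeHat_add, planeHat_sub, planeHat_smul, planeHat_smul,
    planeHat_zero] at e1
  rw [planeHat_neg] at e2
  rw [planeHat_add, planeHat_smul] at e3
  unfold modeDensity traceDensity
  simp only [Fin.sum_univ_two]
  filter_upwards [ae_mode_estimate_of_eq (Real.abs_cos_le_one _) e0 e1 e2 e3 i j] with η h
  refine le_trans (le_of_eq ?_) h
  fin_cases j <;> rfl

/-- The bound for the horizontal derivatives. -/
noncomputable def horizontalBound (W : Fin 3 → Lp ℂ 2 (slabMeasure R R'))
    (D : Lp ℂ 2 (slabMeasure R R')) (G G' : Fin 2 → Lp ℂ 2 (volume : Measure E2)) : ℝ≥0∞ :=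
  2 * (ENNReal.ofReal (R' - R) * (∑ j, l2Sq (slabMeasure R R') (W j) +
      l2Sq (slabMeasure R R') D)) +
    4 * (ENNReal.ofReal (1 + 4 * (R' - R)) * traceSq G G')

lemma tsum_l2Sq_sinCoeff (hR : R < R') (q : Lp ℂ 2 (slabMeasure R R')) :
    ∑' n, l2Sq volume (planeHat (sinCoeff hR n q)) =
      ENNReal.ofReal (R' - R) * l2Sq (slabMeasure R R') q := by
  have he := isParsevalFamily_slabSin hR
  rw [← tsum_l2Sq_slabCoeff hR he (Lp.memLp q)]
  refine tsum_congr fun n => ?_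
  rw [l2Sq_planeHat]
  exact l2Sq_congr_ae (coeFn_slabCoeffLp hR he n q)

lemma tsum_l2Sq_cosCoeff (hR : R < R') (q : Lp ℂ 2 (slabMeasure R R')) :
    ∑' n, l2Sq volume (planeHat (cosCoeff hR n q)) =
      ENNReal.ofReal (R' - R) * l2Sq (slabMeasure R R') q := by
  have he := isParsevalFamily_slabCos hR
  rw [← tsum_l2Sq_slabCoeff hR he (Lp.memLp q)]
  refine tsum_congr fun n => ?_
  rw [l2Sq_planeHat]
  exact l2Sq_congr_ae (coeFn_slabCoeffLp hR he n q)

lemma aemeasurable_enorm_sq (x : Lp ℂ 2 (volume : Measure E2)) :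
    AEMeasurable (fun η => ‖x η‖ₑ ^ 2) volume :=
  (Lp.aestronglyMeasurable x).enorm.pow_const 2

lemma lintegral_modeDensity (hR : R < R') :
    ∑' n, ∫⁻ η, modeDensity hR n W D η =
      ENNReal.ofReal (R' - R) * (∑ j, l2Sq (slabMeasure R R') (W j) +
        l2Sq (slabMeasure R R') D) := by
  have h : ∀ n, ∫⁻ η, modeDensity hR n W D η =
      l2Sq volume (planeHat (cosCoeff hR n (W 0))) +
      l2Sq volume (planeHat (cosCoeff hR n (W 1))) +
      l2Sq volume (planeHat (sinCoeff hR n (W 2))) +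
      l2Sq volume (planeHat (sinCoeff hR n D)) := by
    intro n
    unfold modeDensity
    rw [lintegral_add_right' _ (aemeasurable_enorm_sq _),
      lintegral_add_right' _ (aemeasurable_enorm_sq _),
      lintegral_add_right' _ (aemeasurable_enorm_sq _)]
    rfl
  simp_rw [h]
  rw [ENNReal.tsum_add, ENNReal.tsum_add, ENNReal.tsum_add, tsum_l2Sq_cosCoeff,
    tsum_l2Sq_cosCoeff, tsum_l2Sq_sinCoeff, tsum_l2Sq_sinCoeff, Fin.sum_univ_three, mul_add,
    mul_add, mul_add]

lemma aemeasurable_traceDensity (G G' : Fin 2 → Lp ℂ 2 (volume : Measure E2)) :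
    AEMeasurable (traceDensity G G') volume :=
  (Finset.aemeasurable_fun_sum _ fun _ _ => aemeasurable_enorm_sq _).add
    (Finset.aemeasurable_fun_sum _ fun _ _ => aemeasurable_enorm_sq _)

/-- Summing over n, Parseval handles the curl and divergence densities. For the traces, Tonelli
moves the sum inside the integral, where it acts only on the multiplier and produces the H^{1/2}
weight. -/
lemma SlabSystem.tsum_mode_le (hR : R < R') (hs : SlabSystem R R' U W D G G')
    (i : Fin 2) (j : Fin 3) :
    ∑' n, l2Sq volume (fun η : E2 =>
        2 * Real.pi * Complex.I * (η i * planeHat (modeCoeff hR n U j) η)) ≤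
      horizontalBound W D G G' := by
  have hm : ∀ n, AEMeasurable (fun η : E2 => ENNReal.ofReal ((2 * Real.pi * ‖η‖) ^ 2 /
      ((2 * Real.pi * ‖η‖) ^ 2 + slabFreq R R' n ^ 2)) * traceDensity G G' η) volume := by
    intro n
    refine AEMeasurable.mul ?_ (aemeasurable_traceDensity G G')
    exact (by fun_prop : Measurable _).aemeasurable
  have h1 : ∀ n, l2Sq volume (fun η : E2 =>
      2 * Real.pi * Complex.I * (η i * planeHat (modeCoeff hR n U j) η)) ≤
      2 * (∫⁻ η, modeDensity hR n W D η) +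
        4 * ∫⁻ η : E2, (ENNReal.ofReal ((2 * Real.pi * ‖η‖) ^ 2 /
          ((2 * Real.pi * ‖η‖) ^ 2 + slabFreq R R' n ^ 2)) * traceDensity G G' η) := by
    intro n
    refine (lintegral_mono_ae (hs.ae_mode_estimate hR n i j)).trans_eq ?_
    rw [lintegral_add_right' _ ((hm n).const_mul 4), lintegral_const_mul' _ _ (by simp),
      lintegral_const_mul' _ _ (by simp)]
  refine (ENNReal.tsum_le_tsum h1).trans ?_
  rw [ENNReal.tsum_add, ENNReal.tsum_mul_left, ENNReal.tsum_mul_left, lintegral_modeDensity,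
    horizontalBound, ← lintegral_tsum hm]
  gcongr
  rw [traceSq, ← lintegral_const_mul' _ _ ENNReal.ofReal_ne_top]
  refine lintegral_mono fun η => ?_
  rw [ENNReal.tsum_mul_right, ← mul_assoc, ← ENNReal.ofReal_mul (by linarith)]
  gcongr
  exact tsum_slabFreq_multiplier_le hR (by positivity)

/-- The components of `u` have square integrable horizontal derivatives. -/
lemma SlabSystem.exists_horizontal_deriv (hR : R < R') (hs : SlabSystem R R' U W D G G')
    (hfin : traceSq G G' ≠ ⊤) (i : Fin 2) (j : Fin 3) :
    ∃ v : E2 × ℝ → ℂ, MemLp v 2 (slabMeasure R R') ∧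
      ENNReal.ofReal (R' - R) * l2Sq (slabMeasure R R') v ≤ horizontalBound W D G G' ∧
      ∀ φ : E2 × ℝ → ℝ, ContDiff ℝ ∞ φ → HasCompactSupport φ →
        ∫ p, (φ p : ℂ) * v p ∂slabMeasure R R' =
          - ∫ p, (slabDeriv i φ p : ℂ) * U j p ∂slabMeasure R R' := by
  have hM : horizontalBound W D G G' ≠ ⊤ := by
    have hW : ∀ q : Lp ℂ 2 (slabMeasure R R'), l2Sq (slabMeasure R R') q ≠ ⊤ := fun q =>
      (MemLp.l2Sq_lt_top (Lp.memLp q)).ne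
    refine ENNReal.add_ne_top.mpr ⟨ENNReal.mul_ne_top (by simp)
      (ENNReal.mul_ne_top ENNReal.ofReal_ne_top (ENNReal.add_ne_top.mpr ⟨?_, hW _⟩)),
      ENNReal.mul_ne_top (by simp) (ENNReal.mul_ne_top ENNReal.ofReal_ne_top hfin)⟩
    exact ENNReal.sum_ne_top.mpr fun j _ => hW _
  have hle := hs.tsum_mode_le hR i j
  have htop := ne_top_of_le_ne_top hM hle
  choose b hb hbψ using fun n => exists_weak_planeDeriv (modeCoeff hR n U j) i
    (ENNReal.ne_top_of_tsum_ne_top htop n)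
  simp_rw [← hb] at hle htop
  -- Reassembly needs only a Parseval family, so the sine components and the cosine component are
  -- treated alike from here on.
  obtain ⟨e, he, hej⟩ : ∃ e : ℤ → ℝ → ℝ, ∃ he : IsParsevalFamily R R' e,
      ∀ n, modeCoeff hR n U j = slabCoeffLp hR he n (U j) := by
    fin_cases j
    · exact ⟨_, isParsevalFamily_slabSin hR, fun n => rfl⟩
    · exact ⟨_, isParsevalFamily_slabSin hR, fun n => rfl⟩
    · exact ⟨_, isParsevalFamily_slabCos hR, fun n => rfl⟩
  obtain ⟨v, hv, hvle, hvφ⟩ := exists_weak_slabDeriv hR he i (Lp.memLp (U j)) b htop (by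
    intro n ψ hψ hc
    refine (hbψ n ψ hψ hc).trans (congrArg _ (integral_congr_ae ?_))
    rw [hej]
    filter_upwards [coeFn_slabCoeffLp hR he n (U j)] with y hy
    rw [hy])
  exact ⟨v, hv, hvle.trans hle, hvφ⟩

lemma ae_norm_fourier_traceComponent (g : Lp C2 2 (volume : Measure E2)) :
    ∀ᵐ η, ∑ i, ‖planeHat (traceComponent g i) η‖ₑ ^ 2 =
      ENNReal.ofReal (‖(𝓕 g : Lp C2 2 (volume : Measure E2)) η‖ ^ 2) := by
  have h : ∀ i, ∀ᵐ η, planeHat (traceComponent g i) η =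
      (𝓕 g : Lp C2 2 (volume : Measure E2)) η i := by
    intro i
    have := coeFn_traceComponent (𝓕 g) i
    rwa [traceComponent, ← fourier_compLp] at this
  filter_upwards [ae_all_iff.mpr h] with η hη
  rw [EuclideanSpace.norm_sq_eq, ENNReal.ofReal_sum_of_nonneg fun i _ => by positivity]
  refine Finset.sum_congr rfl fun i _ => ?_
  rw [hη i, enorm_sq_eq_ofReal]

lemma traceSq_traceComponent {g g' : Lp C2 2 (volume : Measure E2)} (hg : MemTHHalf g)
    (hg' : MemTHHalf g') :
    traceSq (traceComponent g) (traceComponent g') =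
      ENNReal.ofReal (thHalfNorm g g' ^ 2) := by
  have h0 : ∀ x : Lp C2 2 (volume : Measure E2), ∀ η : E2,
      0 ≤ √(1 + (2 * Real.pi * ‖η‖) ^ 2) * ‖(𝓕 x : Lp C2 2 (volume : Measure E2)) η‖ ^ 2 :=
    fun x η => by positivity
  have hn : ∀ x, 0 ≤ thHalfNormSq x := fun x => integral_nonneg (h0 x)
  rw [thHalfNorm, Real.sq_sqrt (add_nonneg (hn _) (hn _)), thHalfNormSq, thHalfNormSq,
    ← integral_add (integrable_thHalf hg) (integrable_thHalf hg'),
    ofReal_integral_eq_lintegral_ofReal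
      (f := fun η : E2 => √(1 + (2 * Real.pi * ‖η‖) ^ 2) *
          ‖(𝓕 g : Lp C2 2 (volume : Measure E2)) η‖ ^ 2 +
        √(1 + (2 * Real.pi * ‖η‖) ^ 2) * ‖(𝓕 g' : Lp C2 2 (volume : Measure E2)) η‖ ^ 2)
      ((integrable_thHalf hg).add (integrable_thHalf hg'))
      (Filter.Eventually.of_forall fun η => add_nonneg (h0 _ _) (h0 _ _))]
  refine lintegral_congr_ae ?_
  filter_upwards [ae_norm_fourier_traceComponent g, ae_norm_fourier_traceComponent g'] with η h1 h2
  rw [traceDensity, h1, h2, ← mul_add, ENNReal.ofReal_mul (by positivity),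
    ENNReal.ofReal_add (by positivity) (by positivity)]

end Estimate

/-! ### Vertical derivatives from the equations. -/

section Vertical

variable {R R' : ℝ} {U W : Fin 3 → Lp ℂ 2 (slabMeasure R R')} {D : Lp ℂ 2 (slabMeasure R R')}
  {G G' : Fin 2 → Lp ℂ 2 (volume : Measure E2)}

lemma l2Sq_sub_le {α : Type*} [MeasurableSpace α] {μ : Measure α} {f g : α → ℂ}
    (hf : AEStronglyMeasurable f μ) : l2Sq μ (f - g) ≤ 2 * l2Sq μ f + 2 * l2Sq μ g := by
  unfold l2Sq
  rw [← lintegral_const_mul' _ _ (by simp), ← lintegral_const_mul' _ _ (by simp),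
    ← lintegral_add_left' ((hf.enorm.pow_const 2).const_mul 2)]
  refine lintegral_mono fun x => ?_
  simp only [enorm_sq_eq_ofReal, Pi.sub_apply]
  refine (ENNReal.ofReal_le_ofReal (norm_sub_sq_le_two (f x) (g x))).trans_eq ?_
  rw [ENNReal.ofReal_add (by positivity) (by positivity), ENNReal.ofReal_mul (by positivity),
    ENNReal.ofReal_mul (by positivity), ENNReal.ofReal_ofNat]

lemma l2Sq_add_le {α : Type*} [MeasurableSpace α] {μ : Measure α} {f g : α → ℂ}
    (hf : AEStronglyMeasurable f μ) : l2Sq μ (f + g) ≤ 2 * l2Sq μ f + 2 * l2Sq μ g := by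
  have h := l2Sq_sub_le (g := -g) hf
  rw [sub_neg_eq_add] at h
  refine h.trans_eq ?_
  simp [l2Sq]

/-- Here 4 would do; 10 is the constant of the divergence case, used for all components. -/
lemma heightBound_curl {L a b c M : ℝ≥0∞} (ha : L * a ≤ M) (hb : L * b ≤ M)
    (hc : c ≤ 2 * a + 2 * b) : L * c ≤ 10 * M :=
  calc L * c ≤ L * (2 * a + 2 * b) := by gcongr
    _ = 2 * (L * a) + 2 * (L * b) := by ring
    _ ≤ 2 * M + 2 * M := by gcongr
    _ = 4 * M := by ring
    _ ≤ 10 * M := by gcongr; norm_num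

/-- The vertical derivative of the third component is a difference of three functions, so the factor
2 is paid twice: 4 + 4 + 2 = 10. -/
lemma heightBound_div {L a b c d M : ℝ≥0∞} (ha : L * a ≤ M) (hb : L * b ≤ M) (hd : L * d ≤ M)
    (hc : c ≤ 2 * (2 * a + 2 * b) + 2 * d) : L * c ≤ 10 * M :=
  calc L * c ≤ L * (2 * (2 * a + 2 * b) + 2 * d) := by gcongr
    _ = 4 * (L * a) + 4 * (L * b) + 2 * (L * d) := by ring
    _ ≤ 4 * M + 4 * M + 2 * M := by gcongr
    _ = 10 * M := by ring

lemma curl_le_horizontalBound (j : Fin 3) :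
    ENNReal.ofReal (R' - R) * l2Sq (slabMeasure R R') (W j) ≤ horizontalBound W D G G' := by
  unfold horizontalBound
  refine le_trans ?_ le_self_add
  calc _ ≤ ENNReal.ofReal (R' - R) * (∑ j, l2Sq (slabMeasure R R') (W j) +
        l2Sq (slabMeasure R R') D) := by
        gcongr
        exact (Finset.single_le_sum (f := fun j => l2Sq (slabMeasure R R') (W j))
          (fun _ _ => zero_le) (Finset.mem_univ j)).trans le_self_add
    _ ≤ _ := le_mul_of_one_le_left' (by norm_num)

lemma div_le_horizontalBound :
    ENNReal.ofReal (R' - R) * l2Sq (slabMeasure R R') D ≤ horizontalBound W D G G' := by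
  unfold horizontalBound
  refine le_trans ?_ le_self_add
  calc _ ≤ ENNReal.ofReal (R' - R) * (∑ j, l2Sq (slabMeasure R R') (W j) +
        l2Sq (slabMeasure R R') D) := by
        gcongr
        exact le_add_self
    _ ≤ _ := le_mul_of_one_le_left' (by norm_num)

lemma continuous_heightDeriv {f : E2 × ℝ → ℝ} (h : ContDiff ℝ ∞ f) :
    Continuous (heightDeriv f) := by
  rw [heightDeriv_eq_fderiv h]
  exact (h.continuous_fderiv (by simp)).clm_apply continuous_const

lemma hasCompactSupport_heightDeriv {f : E2 × ℝ → ℝ} (h : ContDiff ℝ ∞ f)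
    (hc : HasCompactSupport f) : HasCompactSupport (heightDeriv f) := by
  rw [heightDeriv_eq_fderiv h]
  exact hc.fderiv_apply (𝕜 := ℝ) _

lemma integrable_slab_mul {v : E2 × ℝ → ℂ} (hv : MemLp v 2 (slabMeasure R R'))
    {f : E2 × ℝ → ℝ} (h : Continuous f) (hc : HasCompactSupport f) :
    Integrable (fun p => (f p : ℂ) * v p) (slabMeasure R R') :=
  (memLp_slab_of_hasCompactSupport h hc).integrable_mul hv

/-- The components of `u` have square integrable vertical derivatives. -/
lemma SlabSystem.exists_vertical_deriv (hR : R < R') (hs : SlabSystem R R' U W D G G')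
    (hfin : traceSq G G' ≠ ⊤) (j : Fin 3) :
    ∃ v : E2 × ℝ → ℂ, MemLp v 2 (slabMeasure R R') ∧
      ENNReal.ofReal (R' - R) * l2Sq (slabMeasure R R') v ≤ 10 * horizontalBound W D G G' ∧
      ∀ f : E2 × ℝ → ℝ, ContDiff ℝ ∞ f → HasCompactSupport f →
        tsupport f ⊆ Set.univ ×ˢ Set.Ioo R R' →
        ∫ p, (f p : ℂ) * v p ∂slabMeasure R R' =
          - ∫ p, (heightDeriv f p : ℂ) * U j p ∂slabMeasure R R' := by
  -- Interior test functions vanish on both boundary planes, so the trace terms of the curl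
  -- equations drop out.
  have hz : ∀ f : E2 × ℝ → ℝ, tsupport f ⊆ Set.univ ×ˢ Set.Ioo R R' →
      (∀ y, f (y, R) = 0) ∧ ∀ y, f (y, R') = 0 := by
    intro f hf
    refine ⟨fun y => ?_, fun y => ?_⟩ <;> by_contra hne
    · exact lt_irrefl _ (hf (subset_tsupport _ hne)).2.1
    · exact lt_irrefl _ (hf (subset_tsupport _ hne)).2.2
  have hUi := fun j => Lp.memLp (U j)
  have hWi := fun j => Lp.memLp (W j)
  fin_cases j
  -- The second curl equation gives ∂ₜU₀ = W₁ + ∂₀U₂.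
  · obtain ⟨v, hv, hvb, hvf⟩ := hs.exists_horizontal_deriv hR hfin 0 2
    refine ⟨W 1 + v, (hWi 1).add hv, heightBound_curl (curl_le_horizontalBound 1) hvb
      (l2Sq_add_le (hWi 1).1), fun f hf hc hsup => ?_⟩
    have h1 := hs.curl_one f hf hc
    simp only [(hz f hsup).1, (hz f hsup).2, Complex.ofReal_zero, mul_zero, integral_zero,
      sub_zero] at h1
    have i0 := integrable_slab_mul (hWi 1) hf.continuous hc
    have i1 := integrable_slab_mul (hUi 0) (continuous_heightDeriv hf)
      (hasCompactSupport_heightDeriv hf hc)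
    have i2 := integrable_slab_mul (hUi 2) (continuous_slabDeriv 0 hf)
      (hasCompactSupport_slabDeriv 0 hf hc)
    have i3 := integrable_slab_mul hv hf.continuous hc
    have i01 : Integrable (fun p => (f p : ℂ) * W 1 p + (heightDeriv f p : ℂ) * U 0 p)
        (slabMeasure R R') := i0.add i1
    have e1 : ∫ p, W 1 p * f p + U 0 p * heightDeriv f p - U 2 p * slabDeriv 0 f p
          ∂slabMeasure R R' =
        ∫ p, (f p : ℂ) * W 1 p ∂slabMeasure R R' +
          ∫ p, (heightDeriv f p : ℂ) * U 0 p ∂slabMeasure R R' -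
          ∫ p, (slabDeriv 0 f p : ℂ) * U 2 p ∂slabMeasure R R' := by
      rw [← integral_add i0 i1, ← integral_sub i01 i2]
      refine integral_congr_ae (Filter.Eventually.of_forall fun p => ?_)
      simp only; ring
    have e2 : ∫ p, (f p : ℂ) * (W 1 + v : E2 × ℝ → ℂ) p ∂slabMeasure R R' =
        ∫ p, (f p : ℂ) * W 1 p ∂slabMeasure R R' + ∫ p, (f p : ℂ) * v p ∂slabMeasure R R' := by
      rw [← integral_add i0 i3]
      refine integral_congr_ae (Filter.Eventually.of_forall fun p => ?_)
      simp only [Pi.add_apply]; ring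
    refine e2.trans ?_
    change _ = - ∫ p, (heightDeriv f p : ℂ) * U 0 p ∂slabMeasure R R'
    linear_combination h1 - e1 + hvf f hf hc
  -- The first curl equation gives ∂ₜU₁ = ∂₁U₂ - W₀.
  · obtain ⟨v, hv, hvb, hvf⟩ := hs.exists_horizontal_deriv hR hfin 1 2
    refine ⟨v - W 0, hv.sub (hWi 0), heightBound_curl hvb (curl_le_horizontalBound 0)
      (l2Sq_sub_le hv.1), fun f hf hc hsup => ?_⟩
    have h1 := hs.curl_zero f hf hc
    simp only [(hz f hsup).1, (hz f hsup).2, Complex.ofReal_zero, mul_zero, integral_zero,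
      sub_zero] at h1
    have i0 := integrable_slab_mul (hWi 0) hf.continuous hc
    have i1 := integrable_slab_mul (hUi 1) (continuous_heightDeriv hf)
      (hasCompactSupport_heightDeriv hf hc)
    have i2 := integrable_slab_mul (hUi 2) (continuous_slabDeriv 1 hf)
      (hasCompactSupport_slabDeriv 1 hf hc)
    have i3 := integrable_slab_mul hv hf.continuous hc
    have i02 : Integrable (fun p => (f p : ℂ) * W 0 p + (slabDeriv 1 f p : ℂ) * U 2 p)
        (slabMeasure R R') := i0.add i2
    have e1 : ∫ p, W 0 p * f p + U 2 p * slabDeriv 1 f p - U 1 p * heightDeriv f p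
          ∂slabMeasure R R' =
        ∫ p, (f p : ℂ) * W 0 p ∂slabMeasure R R' +
          ∫ p, (slabDeriv 1 f p : ℂ) * U 2 p ∂slabMeasure R R' -
          ∫ p, (heightDeriv f p : ℂ) * U 1 p ∂slabMeasure R R' := by
      rw [← integral_add i0 i2, ← integral_sub i02 i1]
      refine integral_congr_ae (Filter.Eventually.of_forall fun p => ?_)
      simp only; ring
    have e2 : ∫ p, (f p : ℂ) * (v - W 0 : E2 × ℝ → ℂ) p ∂slabMeasure R R' =
        ∫ p, (f p : ℂ) * v p ∂slabMeasure R R' - ∫ p, (f p : ℂ) * W 0 p ∂slabMeasure R R' := by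
      rw [← integral_sub i3 i0]
      refine integral_congr_ae (Filter.Eventually.of_forall fun p => ?_)
      simp only [Pi.sub_apply]; ring
    refine e2.trans ?_
    change _ = - ∫ p, (heightDeriv f p : ℂ) * U 1 p ∂slabMeasure R R'
    linear_combination e1 - h1 + hvf f hf hc
  -- The divergence equation gives ∂ₜU₂ = D - ∂₀U₀ - ∂₁U₁.
  · obtain ⟨v, hv, hvb, hvf⟩ := hs.exists_horizontal_deriv hR hfin 0 0
    obtain ⟨q, hq, hqb, hqf⟩ := hs.exists_horizontal_deriv hR hfin 1 1
    have hD := Lp.memLp D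
    refine ⟨D - v - q, (hD.sub hv).sub hq, heightBound_div div_le_horizontalBound hvb hqb
      ((l2Sq_sub_le (hD.sub hv).1).trans ?_), fun f hf hc hsup => ?_⟩
    · gcongr
      exact l2Sq_sub_le hD.1
    have h1 := hs.div f hf hc hsup
    have i0 := integrable_slab_mul hD hf.continuous hc
    have i1 := integrable_slab_mul (hUi 0) (continuous_slabDeriv 0 hf)
      (hasCompactSupport_slabDeriv 0 hf hc)
    have i2 := integrable_slab_mul (hUi 1) (continuous_slabDeriv 1 hf)
      (hasCompactSupport_slabDeriv 1 hf hc)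
    have i3 := integrable_slab_mul (hUi 2) (continuous_heightDeriv hf)
      (hasCompactSupport_heightDeriv hf hc)
    have i4 := integrable_slab_mul hv hf.continuous hc
    have i5 := integrable_slab_mul hq hf.continuous hc
    have i12 : Integrable (fun p => (slabDeriv 0 f p : ℂ) * U 0 p + (slabDeriv 1 f p : ℂ) * U 1 p)
        (slabMeasure R R') := i1.add i2
    have i123 : Integrable (fun p => (slabDeriv 0 f p : ℂ) * U 0 p +
        (slabDeriv 1 f p : ℂ) * U 1 p + (heightDeriv f p : ℂ) * U 2 p)
        (slabMeasure R R') := i12.add i3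
    have i04 : Integrable (fun p => (f p : ℂ) * D p - (f p : ℂ) * v p)
        (slabMeasure R R') := i0.sub i4
    have e1 : ∫ p, D p * f p + (U 0 p * slabDeriv 0 f p + U 1 p * slabDeriv 1 f p +
          U 2 p * heightDeriv f p) ∂slabMeasure R R' =
        ∫ p, (f p : ℂ) * D p ∂slabMeasure R R' +
          (∫ p, (slabDeriv 0 f p : ℂ) * U 0 p ∂slabMeasure R R' +
          ∫ p, (slabDeriv 1 f p : ℂ) * U 1 p ∂slabMeasure R R' +
          ∫ p, (heightDeriv f p : ℂ) * U 2 p ∂slabMeasure R R') := by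
      rw [← integral_add i1 i2, ← integral_add i12 i3, ← integral_add i0 i123]
      refine integral_congr_ae (Filter.Eventually.of_forall fun p => ?_)
      simp only; ring
    have e2 : ∫ p, (f p : ℂ) * (D - v - q : E2 × ℝ → ℂ) p ∂slabMeasure R R' =
        ∫ p, (f p : ℂ) * D p ∂slabMeasure R R' - ∫ p, (f p : ℂ) * v p ∂slabMeasure R R' -
          ∫ p, (f p : ℂ) * q p ∂slabMeasure R R' := by
      rw [← integral_sub i0 i4, ← integral_sub i04 i5]
      refine integral_congr_ae (Filter.Eventually.of_forall fun p => ?_)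
      simp only [Pi.sub_apply]; ring
    refine e2.trans ?_
    change _ = - ∫ p, (heightDeriv f p : ℂ) * U 2 p ∂slabMeasure R R'
    linear_combination h1 - e1 - hvf f hf hc - hqf f hf hc

end Vertical

/-! ### From components in coordinates back to vector fields on the slab. -/

section Assemble

variable {R R' : ℝ}

lemma l2Norm_sq {F : Type*} [NormedAddCommGroup F] (Ω : Opens E3) (f : E3 → F) :
    l2Norm Ω f ^ 2 = (l2Sq (volume.restrict (Ω : Set E3)) f).toReal := by
  rw [l2Norm, l2Sq_eq_eLpNorm_sq, ENNReal.toReal_pow]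

lemma l2Sq_slab {F : Type*} [NormedAddCommGroup F] (f : E3 → F) :
    l2Sq (volume.restrict (slab R R' : Set E3)) f =
      l2Sq (slabMeasure R R') fun p => f (planeHeight p) :=
  ((measurePreserving_slab R R').lintegral_comp_emb measurableEmbedding_planeHeight _).symm

lemma l2Sq_eq_sum {α : Type*} [MeasurableSpace α] {μ : Measure α} {f : α → C3}
    (hf : AEStronglyMeasurable f μ) : l2Sq μ f = ∑ j, l2Sq μ fun x => f x j := by
  unfold l2Sq
  rw [← lintegral_finsetSum']
  · refine lintegral_congr fun x => ?_
    simp only [enorm_sq_eq_ofReal]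
    rw [EuclideanSpace.norm_sq_eq, ENNReal.ofReal_sum_of_nonneg fun i _ => by positivity]
  · intro j _
    exact (((EuclideanSpace.proj (𝕜 := ℂ) j).continuous.comp_aestronglyMeasurable
      hf).enorm).pow_const 2

/-- The weak partial derivatives are unique. -/
lemma IsWeakPartial.ae_eq {Ω : Opens E3} {j : Fin 3} {u v v' : E3 → C3} (hv : MemL2 Ω v)
    (hv' : MemL2 Ω v') (h : IsWeakPartial Ω j u v) (h' : IsWeakPartial Ω j u v') :
    v =ᵐ[volume.restrict (Ω : Set E3)] v' := by
  have hm : MemLp (v - v') 2 (volume.restrict (Ω : Set E3)) := hv.sub hv'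
  have key := IsOpen.ae_eq_zero_of_integral_contDiff_smul_eq_zero (μ := volume) Ω.isOpen
    (f := v - v') (locallyIntegrableOn_of_locallyIntegrable_restrict (hm.locallyIntegrable (by norm_num))) ?_
  · rw [Filter.EventuallyEq, ae_restrict_iff' Ω.isOpen.measurableSet]
    filter_upwards [key] with x hx hxΩ
    exact sub_eq_zero.mp (hx hxΩ)
  · intro φ hφ hc hs
    have hφL : MemLp φ 2 (volume.restrict (Ω : Set E3)) :=
      hφ.continuous.memLp_of_hasCompactSupport hc
    have i1 : Integrable (fun x => φ x • v x) (volume.restrict (Ω : Set E3)) :=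
      memLp_one_iff_integrable.mp (hv.smul hφL)
    have i2 : Integrable (fun x => φ x • v' x) (volume.restrict (Ω : Set E3)) :=
      memLp_one_iff_integrable.mp (hv'.smul hφL)
    have e1 := (h ⟨φ, hφ, hc, hs⟩).trans (h' ⟨φ, hφ, hc, hs⟩).symm
    simp only [TestFunction.coe_mk] at e1
    rw [← setIntegral_eq_integral_of_forall_compl_eq_zero (s := (Ω : Set E3))]
    · simp only [Pi.sub_apply, smul_sub]
      rw [integral_sub i1 i2, e1, sub_self]
    · intro x hx
      rw [image_eq_zero_of_notMem_tsupport fun hx' => hx (hs hx'), zero_smul]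

/-- `weakPartial` is an arbitrary choice; uniqueness almost everywhere lets its norm be computed
from any weak derivative at hand. -/
lemma l2Norm_weakPartial {Ω : Opens E3} {j : Fin 3} {u v : E3 → C3} (hv : MemL2 Ω v)
    (h : IsWeakPartial Ω j u v) : l2Norm Ω (weakPartial Ω j u) = l2Norm Ω v := by
  have hex : ∃ v, MemL2 Ω v ∧ IsWeakPartial Ω j u v := ⟨v, hv, h⟩
  unfold weakPartial
  rw [dif_pos hex, l2Norm, l2Norm,
    eLpNorm_congr_ae (IsWeakPartial.ae_eq hex.choose_spec.1 hv hex.choose_spec.2 h)]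

/-- A field whose components have square integrable weak derivatives in the coordinates `(y, t)`
has a square integrable weak derivative. -/
lemma exists_isWeakPartial {u : E3 → C3} (hu : MemL2 (slab R R') u) (i : Fin 3)
    (v : Fin 3 → E2 × ℝ → ℂ) (hv : ∀ j, MemLp (v j) 2 (slabMeasure R R'))
    (h : ∀ j, ∀ φ : E3 → ℝ, ContDiff ℝ ∞ φ → HasCompactSupport φ →
      tsupport φ ⊆ (slab R R' : Set E3) →
      ∫ p, (φ (planeHeight p) : ℂ) * v j p ∂slabMeasure R R' =
        - ∫ p, (partialD i φ (planeHeight p) : ℂ) * componentLp hu j p ∂slabMeasure R R') :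
    ∃ V, MemL2 (slab R R') V ∧ IsWeakPartial (slab R R') i u V ∧
      l2Norm (slab R R') V ^ 2 = (∑ j, l2Sq (slabMeasure R R') (v j)).toReal := by
  set V : E3 → C3 := fun x => WithLp.toLp 2 fun j => v j (planeHeight.symm x) with hV
  have hVj : ∀ p j, V (planeHeight p) j = v j p := fun p j => by simp [hV]
  have hVL : MemL2 (slab R R') V := MemLp.of_eval_piLp fun j =>
    (hv j).comp_measurePreserving (measurePreserving_slab_symm R R')
  refine ⟨V, hVL, fun φ => ?_, ?_⟩
  · have hφ : ContDiff ℝ ∞ (φ : E3 → ℝ) := φ.contDiff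
    have hc : HasCompactSupport (φ : E3 → ℝ) := φ.hasCompactSupport
    have hφL : MemLp (φ : E3 → ℝ) 2 (volume.restrict (slab R R' : Set E3)) :=
      hφ.continuous.memLp_of_hasCompactSupport hc
    have hdL : MemLp (partialD i φ) 2 (volume.restrict (slab R R' : Set E3)) :=
      Continuous.memLp_of_hasCompactSupport
        ((hφ.continuous_fderiv (by simp)).clm_apply continuous_const) (hc.fderiv_apply (𝕜 := ℝ) _)
    have i1 : Integrable (fun x => φ x • V x) (volume.restrict (slab R R' : Set E3)) :=
      memLp_one_iff_integrable.mp (hVL.smul hφL)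
    have i2 : Integrable (fun x => partialD i φ x • u x) (volume.restrict (slab R R' : Set E3)) :=
      memLp_one_iff_integrable.mp (hu.smul hdL)
    ext j
    rw [PiLp.neg_apply, eval_integral_piLp i1.eval_piLp, eval_integral_piLp i2.eval_piLp,
      setIntegral_slab, setIntegral_slab]
    simp only [PiLp.smul_apply, hVj, Complex.real_smul]
    rw [h j φ hφ hc φ.tsupport_subset]
    congr 1
    refine integral_congr_ae ?_
    filter_upwards [coeFn_componentLp hu j] with p hp
    rw [hp]
  · rw [l2Norm_sq, l2Sq_slab, l2Sq_eq_sum (memLp_planeHeight hVL).1]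
    simp only [hVj]

end Assemble

/-! ### Conclusion and constants. -/

section Final

variable {R R' : ℝ}

lemma exists_components {u : E3 → C3} (hR : R < R') (hc : MemHcurl (slab R R') u)
    (hd : MemHdiv (slab R R') u) {g g' : Lp C2 2 (volume : Measure E2)}
    (ht : HasTangentialTrace R R' u g g') (hg : MemTHHalf g) (hg' : MemTHHalf g') (i j : Fin 3) :
    ∃ v : E2 × ℝ → ℂ, MemLp v 2 (slabMeasure R R') ∧
      ENNReal.ofReal (R' - R) * l2Sq (slabMeasure R R') v ≤
        10 * horizontalBound (componentLp (memL2_weakCurl hc).1)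
          ((memLp_planeHeight (memL2_weakDiv hd).1).toLp _) (traceComponent g)
          (traceComponent g') ∧
      ∀ φ : E3 → ℝ, ContDiff ℝ ∞ φ → HasCompactSupport φ → tsupport φ ⊆ (slab R R' : Set E3) →
        ∫ p, (φ (planeHeight p) : ℂ) * v p ∂slabMeasure R R' =
          - ∫ p, (partialD i φ (planeHeight p) : ℂ) * componentLp hc.1 j p ∂slabMeasure R R' := by
  have hs := slabSystem hc hd ht
  have hfin : traceSq (traceComponent g) (traceComponent g') ≠ ⊤ := by
    rw [traceSq_traceComponent hg hg']; exact ENNReal.ofReal_ne_top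
  have hcomp : ∀ φ : E3 → ℝ, HasCompactSupport φ → HasCompactSupport (φ ∘ planeHeight) :=
    fun φ h => h.comp_homeomorph planeHeight.toHomeomorph
  induction i using Fin.lastCases with
  | last =>
    obtain ⟨v, hv, hb, h⟩ := hs.exists_vertical_deriv hR hfin j
    refine ⟨v, hv, hb, fun φ hφ hφc hφs => ?_⟩
    have hts : tsupport (φ ∘ planeHeight) ⊆ Set.univ ×ˢ Set.Ioo R R' := by
      have e : tsupport (φ ∘ planeHeight) = planeHeight ⁻¹' tsupport φ :=
        tsupport_comp_eq_preimage φ planeHeight.toHomeomorph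
      rw [e]
      intro p hp
      have := hφs hp
      refine ⟨Set.mem_univ _, ?_⟩
      have h2 : R < planeHeight p 2 ∧ planeHeight p 2 < R' := this
      rwa [planeHeight_apply_two] at h2
    refine (h _ (hφ.comp planeHeight.contDiff) (hcomp φ hφc) hts).trans ?_
    simp_rw [← partialD_planeHeight_two hφ]
    rfl
  | cast i =>
    obtain ⟨v, hv, hb, h⟩ := hs.exists_horizontal_deriv hR hfin i j
    refine ⟨v, hv, hb.trans (le_mul_of_one_le_left' (by norm_num)), fun φ hφ hφc _ => ?_⟩
    refine (h _ (hφ.comp planeHeight.contDiff) (hcomp φ hφc)).trans ?_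
    simp_rw [← partialD_planeHeight_castSucc hφ]

lemma toReal_horizontalBound {w : E3 → C3} {d : E3 → ℂ} (hR : R < R')
    (hw : MemL2 (slab R R') w) (hd : MemL2 (slab R R') d) {g g' : Lp C2 2 (volume : Measure E2)}
    (hg : MemTHHalf g) (hg' : MemTHHalf g') :
    horizontalBound (componentLp hw) ((memLp_planeHeight hd).toLp _) (traceComponent g)
        (traceComponent g') =
      ENNReal.ofReal (2 * ((R' - R) * (l2Norm (slab R R') w ^ 2 + l2Norm (slab R R') d ^ 2)) +
        4 * ((1 + 4 * (R' - R)) * thHalfNorm g g' ^ 2)) := by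
  have hL : 0 ≤ R' - R := by linarith
  have ew : ∑ j, l2Sq (slabMeasure R R') (componentLp hw j) =
      ENNReal.ofReal (l2Norm (slab R R') w ^ 2) := by
    rw [l2Norm_sq, ENNReal.ofReal_toReal (MemLp.l2Sq_lt_top hw).ne, l2Sq_slab,
      l2Sq_eq_sum (memLp_planeHeight hw).1]
    exact Finset.sum_congr rfl fun j _ => l2Sq_congr_ae (coeFn_componentLp hw j)
  have ed : l2Sq (slabMeasure R R') ((memLp_planeHeight hd).toLp _) =
      ENNReal.ofReal (l2Norm (slab R R') d ^ 2) := by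
    rw [l2Norm_sq, ENNReal.ofReal_toReal (MemLp.l2Sq_lt_top hd).ne, l2Sq_slab]
    exact l2Sq_congr_ae (memLp_planeHeight hd).coeFn_toLp
  have hK0 : 0 ≤ 1 + 4 * (R' - R) := by positivity
  rw [horizontalBound, ew, ed, traceSq_traceComponent hg hg']
  generalize 1 + 4 * (R' - R) = K at *
  rw [ENNReal.ofReal_add (by positivity) (by positivity), ENNReal.ofReal_mul (by positivity),
    ENNReal.ofReal_mul hL, ENNReal.ofReal_mul (by positivity), ENNReal.ofReal_mul (by positivity),
    ENNReal.ofReal_add (by positivity) (by positivity), ENNReal.ofReal_ofNat, ENNReal.ofReal_ofNat]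

/-- The factor 30 is 10 for each of the three components of the field. -/
lemma exists_gradient {u : E3 → C3} (hR : R < R') (hc : MemHcurl (slab R R') u)
    (hd : MemHdiv (slab R R') u) {g g' : Lp C2 2 (volume : Measure E2)}
    (ht : HasTangentialTrace R R' u g g') (hg : MemTHHalf g) (hg' : MemTHHalf g') (i : Fin 3) :
    ∃ V, MemL2 (slab R R') V ∧ IsWeakPartial (slab R R') i u V ∧
      (R' - R) * l2Norm (slab R R') V ^ 2 ≤
        30 * (2 * ((R' - R) * (l2Norm (slab R R') (weakCurl (slab R R') u) ^ 2 +
          l2Norm (slab R R') (weakDiv (slab R R') u) ^ 2)) +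
          4 * ((1 + 4 * (R' - R)) * thHalfNorm g g' ^ 2)) := by
  have hL : 0 ≤ R' - R := by linarith
  choose v hv hb h using exists_components hR hc hd ht hg hg' i
  obtain ⟨V, hV, hp, hn⟩ := exists_isWeakPartial hc.1 i v hv h
  refine ⟨V, hV, hp, ?_⟩
  simp_rw [toReal_horizontalBound hR (memL2_weakCurl hc).1 (memL2_weakDiv hd).1 hg hg'] at hb
  obtain ⟨M, hM⟩ : ∃ M, M = 2 * ((R' - R) * (l2Norm (slab R R') (weakCurl (slab R R') u) ^ 2 +
          l2Norm (slab R R') (weakDiv (slab R R') u) ^ 2)) +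
          4 * ((1 + 4 * (R' - R)) * thHalfNorm g g' ^ 2) := ⟨_, rfl⟩
  rw [← hM] at hb ⊢
  have hM0 : 0 ≤ M := by rw [hM]; positivity
  rw [hn, ENNReal.toReal_sum fun j _ => (MemLp.l2Sq_lt_top (hv j)).ne, Finset.mul_sum]
  have hj : ∀ j ∈ Finset.univ, (R' - R) * (l2Sq (slabMeasure R R') (v j)).toReal ≤ 10 * M := by
    intro j _
    have := ENNReal.toReal_mono (ENNReal.mul_ne_top (by simp) ENNReal.ofReal_ne_top) (hb j)
    rwa [ENNReal.toReal_mul, ENNReal.toReal_mul, ENNReal.toReal_ofReal hL,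
      ENNReal.toReal_ofReal hM0] at this
  refine (Finset.sum_le_sum hj).trans_eq ?_
  simp; ring

end Final

theorem mainTheorem8 (R R' : ℝ) (hR : R < R') :
    ∃ c : ℝ, ∀ u : E3 → C3,
      MemHcurl (slab R R') u → MemHdiv (slab R R') u →
      ∀ g g' : Lp C2 2 (volume : Measure E2),
        HasTangentialTrace R R' u g g' → MemTHHalf g → MemTHHalf g' →
        MemH1 (slab R R') u ∧
        h1Norm (slab R R') u ≤
          c * (hcurlNorm (slab R R') u + l2Norm (slab R R') (weakDiv (slab R R') u) +
            thHalfNorm g g') := by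
  have hL : 0 < R' - R := by linarith
  -- The bound of `exists_gradient`, divided by R' - R, has coefficients 30·2 = 60 and 30·4 = 120;
  -- summing over three directions gives 180 and 360. The term ‖u‖² in the H¹ norm is absorbed as
  -- well, since its coefficient is 1 ≤ 180.
  refine ⟨√(180 + 360 * ((1 + 4 * (R' - R)) / (R' - R))),
    fun u hc hd g g' ht hg hg' => ?_⟩
  have hgrad := exists_gradient hR hc hd ht hg hg'
  refine ⟨⟨hc.1, fun j => (hgrad j).imp fun V hV => ⟨hV.1, hV.2.1⟩⟩, ?_⟩
  choose V hV hVp hVn using hgrad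
  have ha : 0 ≤ hcurlNorm (slab R R') u := Real.sqrt_nonneg _
  have hb : 0 ≤ l2Norm (slab R R') (weakDiv (slab R R') u) := ENNReal.toReal_nonneg
  have ht0 : 0 ≤ thHalfNorm g g' := Real.sqrt_nonneg _
  have ha2 : hcurlNorm (slab R R') u ^ 2 =
      l2Norm (slab R R') u ^ 2 + l2Norm (slab R R') (weakCurl (slab R R') u) ^ 2 :=
    Real.sq_sqrt (by positivity)
  have hsum : ∀ j ∈ Finset.univ, l2Norm (slab R R') (weakPartial (slab R R') j u) ^ 2 ≤
      60 * (l2Norm (slab R R') (weakCurl (slab R R') u) ^ 2 +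
          l2Norm (slab R R') (weakDiv (slab R R') u) ^ 2) +
        120 * ((1 + 4 * (R' - R)) / (R' - R)) * thHalfNorm g g' ^ 2 := by
    intro j _
    rw [l2Norm_weakPartial (hV j) (hVp j)]
    refine le_of_mul_le_mul_left ((hVn j).trans_eq ?_) hL
    field_simp
    ring
  have hsum' := Finset.sum_le_sum hsum
  rw [Finset.sum_const, Finset.card_univ, Fintype.card_fin, nsmul_eq_mul] at hsum'
  push_cast at hsum'
  have hκ : 0 ≤ (1 + 4 * (R' - R)) / (R' - R) := by positivity
  generalize (1 + 4 * (R' - R)) / (R' - R) = κ at *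
  refine (Real.sqrt_le_left (by positivity)).mpr ?_
  rw [mul_pow, Real.sq_sqrt (by positivity)]
  generalize hcurlNorm (slab R R') u = a at *
  generalize l2Norm (slab R R') (weakDiv (slab R R') u) = b at *
  generalize thHalfNorm g g' = t at *
  have hsq : a ^ 2 + b ^ 2 + t ^ 2 ≤ (a + b + t) ^ 2 := by
    nlinarith [mul_nonneg ha hb, mul_nonneg ha ht0, mul_nonneg hb ht0]
  have h1 := mul_le_mul_of_nonneg_left hsq (by positivity : 0 ≤ 180 + 360 * κ)
  have h2 := mul_nonneg hκ (sq_nonneg a)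
  have h3 := mul_nonneg hκ (sq_nonneg b)
  have h4 := sq_nonneg (l2Norm (slab R R') u)
  nlinarith [sq_nonneg t]
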